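/- Let $q>0$, let $V:\mathbb R^3\to[0,\infty)$ be continuous and periodic with respect to a lattice ($V(x+Az)=V(x)$ for all $x\in\mathbb R^3$, $z\in\mathbb Z^3$, with $A$ an invertible $3\times3$ matrix), and let $W:\mathbb R\to\mathbb R$ be an even $C^2$ function with $W(0)=W'(0)=0$, $W''(0)=2E_0>0$. Put $N(s)=W(s)-E_0s^2$ and assume: $N(s_0)<-s_0^2\max V$ for some $s_0>0$; $|N'(s)|\le c_1s^{r-1}+c_2s^{l-1}$ for $s\ge0$, with some $r,l\in(2,6)$; and $N(s)\ge -cs^p$ for all large $s$, with some $c\ge0$ and $2<p<2+\tfrac43$. Consider on $\mathbb R\times\mathbb R^3$ the nonlinear Schrödinger–Maxwell equations $$-\tfrac12\Delta u+\tfrac12W'(u)+\bigl[\tfrac12|\nabla S-q\mathbf A|^2+(\partial_tS+q\varphi+V)\bigr]u=0,$$ $$-\nabla\cdot(\partial_t\mathbf A+\nabla\varphi)=qu^2,\qquad \nabla\times(\nabla\times\mathbf A)+\partial_t(\partial_t\mathbf A+\nabla\varphi)=q(\nabla S-q\mathbf A)u^2,$$ with $u$ real and the phase $S$ valued in $\mathbb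 R/2\pi\mathbb Z$. Their states are $\mathbf u=(u,\Theta,\mathbf E,\mathbf H)$ with $\Theta=(\nabla S-q\mathbf A)u$, $\mathbf E=-\partial_t\mathbf A-\nabla\varphi$, $\mathbf H=\nabla\times\mathbf A$, in the phase space $$X=\{(u,\Theta,\mathbf E,\mathbf H)\in H^1(\mathbb R^3)\times L^2(\mathbb R^3)^9:\ \nabla\cdot\mathbf E=qu^2\},$$ with the distance of the norm $\|\mathbf u\|^2=\int|\nabla u|^2+2E_0u^2+\Theta^2+\mathbf E^2+\mathbf H^2$. Energy and charge are $$E(\mathbf u)=\int\tfrac12|\nabla u|^2+Vu^2+W(u)+\tfrac12(\Theta^2+\mathbf E^2+\mathbf H^2),\qquad C(\mathbf u)=\int u^2 .$$ Let $D\subseteq X$ be a set of states in which the Cauchy problem is globally well posed: for each $\mathbf u\in D$ there is, among curves with values in $D$, exactly one global continuous weak solution $t\mapsto\gamma_t\mathbf u$ starting at $\mathbf u$. A hylomorphic soliton of the dynamical system $(D,\gamma)$ is an element of a set $$\Gamma=\{\mathbf u\in X:E(\mathbf u)=e_0,\ |C(\mathbf u)|=c_0\},\qquad e_0=\min\{E(\mathbf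 u):\mathbf u\in X,\ |C(\mathbf u)|=c_0\},$$ where $\Gamma\subseteq D$, $0\notin\Gamma$, $\Gamma$ is invariant under $\gamma$, $\Gamma$ is stable (for every $\varepsilon>0$ there is $\delta>0$ such that for $\mathbf u\in D$, $d(\mathbf u,\Gamma)\le\delta$ implies $d(\gamma_t\mathbf u,\Gamma)\le\varepsilon$ for all $t\ge0$), and $\Gamma$ is compact up to space translations (every sequence in $\Gamma$ has a subsequence that converges in $X$ after suitable translations). **Theorem.** Let $\mathbf u_\delta=(u_\delta,\Theta_\delta,\mathbf E_\delta,\mathbf H_\delta)$ be any hylomorphic soliton of $(D,\gamma)$. Then $\Theta_\delta=\mathbf H_\delta=0$ and $\gamma_t\mathbf u_\delta=\mathbf u_\delta$ for all $t\in\mathbb R$. Moreover there are a time-independent $\varphi_\delta\in\mathcal D^{1,2}(\mathbb R^3)$ (the completion of $C_c^\infty(\mathbb R^3)$ in the norm $\|\nabla\varphi\|_{L^2}$) and $\omega\in\mathbb R$ such that $\mathbf E_\delta=-\nabla\varphi_\delta$, the pair $(u_\delta,\varphi_\delta)$ is a weak solution of the nonlinear Schrödinger–Poisson system $$-\tfrac12\Delta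 u_\delta+Vu_\delta+\tfrac12W'(u_\delta)+q\varphi_\delta u_\delta=-\omega u_\delta,\qquad -\Delta\varphi_\delta=qu_\delta^2,$$ and $u=u_\delta$, $S=\omega t$, $\varphi=\varphi_\delta$, $\mathbf A=0$ is a weak solution of the Schrödinger–Maxwell equations. -/

import Mathlib

open MeasureTheory Filter Topology Set

noncomputable section

namespace NSM

/-! ### Space, space-time and weak derivatives -/

/-- Physical space `ℝ³` with the Euclidean norm. -/
abbrev R3 : Type := EuclideanSpace ℝ (Fin 3)

/-- Space-time `ℝ × ℝ³`; a point is `z = (t, x)`. -/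
abbrev M4 : Type := ℝ × R3

/-- The `i`-th coordinate vector of `ℝ³`. -/
def e (i : Fin 3) : R3 := EuclideanSpace.single i 1

/-- The direction of `∂/∂t` in space-time. -/
def dt : M4 := (1, 0)

/-- The direction of `∂/∂xᵢ` in space-time. -/
def dx (i : Fin 3) : M4 := (0, e i)

/-- Test functions: real, smooth, compactly supported. -/
def IsTest {F : Type*} [NormedAddCommGroup F] [NormedSpace ℝ F] (η : F → ℝ) : Prop :=
  ContDiff ℝ (⊤ : ℕ∞) η ∧ HasCompactSupport η

/-- `g` is the weak derivative of `f` in the direction `v` (both locally integrable). -/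
def IsWeakDeriv {F G : Type*} [NormedAddCommGroup F] [NormedSpace ℝ F] [MeasureSpace F]
    [NormedAddCommGroup G] [NormedSpace ℝ G] (f : F → G) (v : F) (g : F → G) : Prop :=
  LocallyIntegrable f ∧ LocallyIntegrable g ∧
    ∀ η : F → ℝ, IsTest η → ∫ x, fderiv ℝ η x v • f x = -∫ x, η x • g x

/-- `g` is the weak gradient of `f` on `ℝ³`. -/
def IsWeakGradient (f : R3 → ℝ) (g : R3 → R3) : Prop :=
  ∀ i, IsWeakDeriv f (e i) (fun x => g x i)

/-- `φ` belongs to `𝒟^{1,2}(ℝ³)`, the completion of the test functions for `‖∇φ‖_{L²}`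
(realized as functions through the embedding in `L⁶`), and `g` is its gradient. -/
def MemD12 (φ : R3 → ℝ) (g : R3 → R3) : Prop :=
  ∃ η : ℕ → R3 → ℝ, (∀ n, IsTest (η n)) ∧
    Tendsto (fun n => eLpNorm (fun x => η n x - φ x) 6 volume) atTop (𝓝 0) ∧
    Tendsto (fun n => eLpNorm (fun x => gradient (η n) x - g x) 2 volume) atTop (𝓝 0)

/-! ### The hypotheses on `W` and `V` -/

/-- Assumptions on the potential `V`: continuous, nonnegative, periodic with respect to a lattice
`A ℤ³` with `A` an invertible `3 × 3` matrix. -/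
structure LatticePotential (V : R3 → ℝ) : Prop where
  cont : Continuous V
  nonneg : ∀ x, 0 ≤ V x
  periodic : ∃ A : Matrix (Fin 3) (Fin 3) ℝ, IsUnit A.det ∧
    ∀ (x : R3) (z : Fin 3 → ℤ),
      V (x + WithLp.toLp 2 (A.mulVec (fun i => (z i : ℝ)))) = V x

/-- The function `N` of the splitting `W(s) = E₀ s² + N(s)`. -/
def nonlin (W : ℝ → ℝ) (E₀ : ℝ) (s : ℝ) : ℝ := W s - E₀ * s ^ 2

/-- Assumptions on the nonlinearity. `W` is the restriction to the real axis of a radial function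
on `ℂ`, so it is even; the growth conditions only concern `s ≥ 0`. -/
structure Nonlinearity (V : R3 → ℝ) (W : ℝ → ℝ) (E₀ : ℝ) : Prop where
  even : ∀ s, W (-s) = W s
  smooth : ContDiff ℝ 2 W
  zero : W 0 = 0
  deriv_zero : deriv W 0 = 0
  deriv2_zero : deriv (deriv W) 0 = 2 * E₀
  E₀_pos : 0 < E₀
  negative : ∃ V₀, IsGreatest (range V) V₀ ∧ ∃ s₀ > 0, nonlin W E₀ s₀ < -V₀ * s₀ ^ 2
  growth : ∃ r ∈ Ioo (2 : ℝ) 6, ∃ l ∈ Ioo (2 : ℝ) 6, ∃ c₁ c₂ : ℝ, ∀ s : ℝ, 0 ≤ s →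
    |deriv (nonlin W E₀) s| ≤ c₁ * s ^ (r - 1) + c₂ * s ^ (l - 1)
  lower : ∃ c ≥ (0 : ℝ), ∃ p ∈ Ioo (2 : ℝ) (2 + 4 / 3), ∀ᶠ s in atTop,
    -c * s ^ p ≤ nonlin W E₀ s

/-! ### The phase space -/

/-- Fields `(u, Θ, 𝐄, 𝐇)` in `L²`, together with a vector field `Du` that is required to be the
weak gradient of `u` in the phase space `X` below. -/
@[ext] structure Fields where
  u : Lp ℝ 2 (volume : Measure R3)
  Du : Lp R3 2 (volume : Measure R3)
  Θ : Lp R3 2 (volume : Measure R3)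
  elec : Lp R3 2 (volume : Measure R3)
  mag : Lp R3 2 (volume : Measure R3)

/-- The zero state. -/
instance : Zero Fields := ⟨⟨0, 0, 0, 0, 0⟩⟩

/-- The phase space `X = {(u,Θ,𝐄,𝐇) ∈ H¹(ℝ³) × L²(ℝ³)⁹ : ∇·𝐄 = q u²}`, the divergence being taken
in the sense of distributions. -/
def X (q : ℝ) : Set Fields :=
  {U | IsWeakGradient U.u U.Du ∧
    ∀ η : R3 → ℝ, IsTest η →
      ∫ x, ∑ i, U.elec x i * fderiv ℝ η x (e i) = -∫ x, q * U.u x ^ 2 * η x}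

/-- The distance of the norm `‖𝐮‖² = ∫ |∇u|² + 2E₀u² + Θ² + 𝐄² + 𝐇²`. -/
def fdist (E₀ : ℝ) (U U' : Fields) : ℝ :=
  Real.sqrt (‖U.Du - U'.Du‖ ^ 2 + 2 * E₀ * ‖U.u - U'.u‖ ^ 2 + ‖U.Θ - U'.Θ‖ ^ 2
    + ‖U.elec - U'.elec‖ ^ 2 + ‖U.mag - U'.mag‖ ^ 2)

/-- Distance of a state from a (nonempty) set of states. -/
def fdistSet (E₀ : ℝ) (U : Fields) (Γ : Set Fields) : ℝ := sInf (fdist E₀ U '' Γ)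

/-- Space translation `(T_τ 𝐮)(x) = 𝐮(x - τ)`. -/
def translate (τ : R3) (U : Fields) : Fields where
  u := Lp.compMeasurePreserving (fun x => x - τ) (measurePreserving_sub_right volume τ) U.u
  Du := Lp.compMeasurePreserving (fun x => x - τ) (measurePreserving_sub_right volume τ) U.Du
  Θ := Lp.compMeasurePreserving (fun x => x - τ) (measurePreserving_sub_right volume τ) U.Θ
  elec := Lp.compMeasurePreserving (fun x => x - τ) (measurePreserving_sub_right volume τ) U.elec
  mag := Lp.compMeasurePreserving (fun x => x - τ) (measurePreserving_sub_right volume τ) U.mag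

/-- The energy
`E(𝐮) = ∫ ½|∇u|² + V u² + W(u) + ½(Θ² + 𝐄² + 𝐇²)`. -/
def energy (V : R3 → ℝ) (W : ℝ → ℝ) (U : Fields) : ℝ :=
  ∫ x, (1 / 2 * ‖U.Du x‖ ^ 2 + V x * U.u x ^ 2 + W (U.u x)
    + 1 / 2 * (‖U.Θ x‖ ^ 2 + ‖U.elec x‖ ^ 2 + ‖U.mag x‖ ^ 2))

/-- The hylenic charge `C(𝐮) = ∫ u²`. -/
def charge (U : Fields) : ℝ := ∫ x, U.u x ^ 2

/-! ### The evolution equations -/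

/-- Weak solutions, on all of space-time, of
```
-½ Δu + ½ W'(u) + [½ |∇S - qA|² + (∂ₜS + qφ + V)] u = 0,
-∇·(∂ₜA + ∇φ) = q u²,
∇×(∇×A) + ∂ₜ(∂ₜA + ∇φ) = q (∇S - qA) u²,
```
with `𝐄 = -∂ₜA - ∇φ` and `𝐇 = ∇×A`. The unknowns are `u`, the phase `S` with values in `ℝ/2πℤ`,
and the gauge potentials `φ`, `A`; the other arguments are `Du = ∇u`, `St = ∂ₜS`, `DS = ∇S`,
`elec = 𝐄`, `mag = 𝐇`. Derivatives of `S` are those of `e^{iS}` divided by `i e^{iS}`.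
The components of a curl are `(∇×B)ᵢ = ∂ᵢ₊₁Bᵢ₊₂ - ∂ᵢ₊₂Bᵢ₊₁`, indices modulo 3. -/
structure IsWeakSolution (V : R3 → ℝ) (W : ℝ → ℝ) (q : ℝ)
    (u : M4 → ℝ) (Du : M4 → R3) (S : M4 → Real.Angle) (St : M4 → ℝ) (DS : M4 → R3)
    (φ : M4 → ℝ) (A elec mag : M4 → R3) : Prop where
  grad_u : ∀ i, IsWeakDeriv u (dx i) (fun z => Du z i)
  phase_t : IsWeakDeriv (fun z => ((S z).toCircle : ℂ)) dt
    (fun z => Complex.I * (St z : ℂ) * ((S z).toCircle : ℂ))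
  phase_x : ∀ i, IsWeakDeriv (fun z => ((S z).toCircle : ℂ)) (dx i)
    (fun z => Complex.I * (DS z i : ℂ) * ((S z).toCircle : ℂ))
  -- every term below is a locally integrable function
  int_φ : LocallyIntegrable φ
  int_A : LocallyIntegrable A
  int_elec : LocallyIntegrable elec
  int_mag : LocallyIntegrable mag
  int_charge : LocallyIntegrable (fun z => u z ^ 2)
  int_current : LocallyIntegrable (fun z => u z ^ 2 • (DS z - q • A z))
  int_W : LocallyIntegrable (fun z => deriv W (u z))
  int_matter : LocallyIntegrable
    (fun z => (1 / 2 * ‖DS z - q • A z‖ ^ 2 + (St z + q * φ z + V z.2)) * u z)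
  -- `𝐄 = -∂ₜA - ∇φ` and `𝐇 = ∇×A`
  elec_eq : ∀ i, ∀ η : M4 → ℝ, IsTest η →
    ∫ z, elec z i * η z = ∫ z, (A z i * fderiv ℝ η z dt + φ z * fderiv ℝ η z (dx i))
  mag_eq : ∀ i, ∀ η : M4 → ℝ, IsTest η →
    ∫ z, mag z i * η z =
      -∫ z, (A z (i + 2) * fderiv ℝ η z (dx (i + 1)) - A z (i + 1) * fderiv ℝ η z (dx (i + 2)))
  -- the matter equation
  matter : ∀ η : M4 → ℝ, IsTest η →
    ∫ z, (1 / 2 * ∑ i, Du z i * fderiv ℝ η z (dx i) + 1 / 2 * deriv W (u z) * η z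
      + (1 / 2 * ‖DS z - q • A z‖ ^ 2 + (St z + q * φ z + V z.2)) * u z * η z) = 0
  -- the Gauss law
  gauss : ∀ η : M4 → ℝ, IsTest η →
    ∫ z, ∑ i, elec z i * fderiv ℝ η z (dx i) = -∫ z, q * u z ^ 2 * η z
  -- the Ampere law `∇×𝐇 - ∂ₜ𝐄 = q (∇S - qA) u²`
  ampere : ∀ i, ∀ η : M4 → ℝ, IsTest η →
    ∫ z, (-(mag z (i + 2) * fderiv ℝ η z (dx (i + 1))
        - mag z (i + 1) * fderiv ℝ η z (dx (i + 2))) + elec z i * fderiv ℝ η z dt)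
      = ∫ z, q * (DS z - q • A z) i * u z ^ 2 * η z

/-- A curve `t ↦ 𝐮(t)` in the phase space is a (global) solution of the evolution equations: it is
continuous in `X` and comes, through `𝐄 = -∂ₜA - ∇φ`, `𝐇 = ∇×A`, `Θ = (∇S - qA)u`, from a weak
solution `(u, S, φ, A)`. -/
def IsTrajectory (V : R3 → ℝ) (W : ℝ → ℝ) (q E₀ : ℝ) (U : ℝ → Fields) : Prop :=
  (∀ t, U t ∈ X q) ∧
  (∀ t₀, Tendsto (fun t => fdist E₀ (U t) (U t₀)) (𝓝 t₀) (𝓝 0)) ∧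
  ∃ (u : M4 → ℝ) (Du : M4 → R3) (S : M4 → Real.Angle) (St : M4 → ℝ) (DS : M4 → R3)
    (φ : M4 → ℝ) (A elec mag : M4 → R3),
    IsWeakSolution V W q u Du S St DS φ A elec mag ∧
    ∀ᵐ t, ∀ᵐ x : R3,
      (U t).u x = u (t, x) ∧ (U t).Du x = Du (t, x) ∧
      (U t).Θ x = u (t, x) • (DS (t, x) - q • A (t, x)) ∧
      (U t).elec x = elec (t, x) ∧ (U t).mag x = mag (t, x)

/-- `(D, γ)` is a dynamical system described by the evolution equations: the Cauchy problem with
data in `D ⊆ X` has, among curves in `D`, exactly one global solution `t ↦ γ_t 𝐮`. -/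
structure IsEvolution (V : R3 → ℝ) (W : ℝ → ℝ) (q E₀ : ℝ) (D : Set Fields)
    (γ : ℝ → Fields → Fields) : Prop where
  subset : D ⊆ X q
  maps : ∀ t, ∀ U ∈ D, γ t U ∈ D
  initial : ∀ U ∈ D, γ 0 U = U
  solves : ∀ U ∈ D, IsTrajectory V W q E₀ (fun t => γ t U)
  unique : ∀ Y : ℝ → Fields, IsTrajectory V W q E₀ Y → (∀ t, Y t ∈ D) → ∀ t, Y t = γ t (Y 0)

/-! ### Solitons -/

/-- `Γ` is invariant under the evolution. -/
def IsInvariantSet (γ : ℝ → Fields → Fields) (Γ : Set Fields) : Prop :=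
  ∀ U ∈ Γ, ∀ t, γ t U ∈ Γ

/-- `Γ` is (orbitally) stable for the dynamical system `(D, γ)`. -/
def IsStableSet (E₀ : ℝ) (D : Set Fields) (γ : ℝ → Fields → Fields) (Γ : Set Fields) : Prop :=
  ∀ ε > 0, ∃ δ > 0, ∀ U ∈ D, fdistSet E₀ U Γ ≤ δ → ∀ t ≥ 0, fdistSet E₀ (γ t U) Γ ≤ ε

/-- `Γ` is compact up to space translations. -/
def IsTranslationCompact (q E₀ : ℝ) (Γ : Set Fields) : Prop :=
  ∀ U : ℕ → Fields, (∀ n, U n ∈ Γ) →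
    ∃ (k : ℕ → ℕ) (τ : ℕ → R3), StrictMono k ∧ ∃ U' ∈ X q,
      Tendsto (fun n => fdist E₀ (translate (τ n) (U (k n))) U') atTop (𝓝 0)

/-- `Γ` is a soliton manifold of the dynamical system `(D, γ)`. -/
structure IsSolitonManifold (q E₀ : ℝ) (D : Set Fields) (γ : ℝ → Fields → Fields)
    (Γ : Set Fields) : Prop where
  subset : Γ ⊆ D
  invariant : IsInvariantSet γ Γ
  stable : IsStableSet E₀ D γ Γ
  compact : IsTranslationCompact q E₀ Γ
  zero_notMem : (0 : Fields) ∉ Γ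

/-- `U` is a hylomorphic soliton: it belongs to a soliton manifold of the form
`Γ(e₀, c₀) = {𝐮 ∈ X : E(𝐮) = e₀, |C(𝐮)| = c₀}` with
`e₀ = min {E(𝐮) : 𝐮 ∈ X, |C(𝐮)| = c₀}`. -/
def IsHylomorphicSoliton (V : R3 → ℝ) (W : ℝ → ℝ) (q E₀ : ℝ) (D : Set Fields)
    (γ : ℝ → Fields → Fields) (U : Fields) : Prop :=
  ∃ e₀ c₀ : ℝ,
    IsLeast (energy V W '' {Y | Y ∈ X q ∧ |charge Y| = c₀}) e₀ ∧
    IsSolitonManifold q E₀ D γ {Y | Y ∈ X q ∧ energy V W Y = e₀ ∧ |charge Y| = c₀} ∧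
    U ∈ {Y | Y ∈ X q ∧ energy V W Y = e₀ ∧ |charge Y| = c₀}

/-- `(u, φ)` is a weak solution of the nonlinear Schrödinger–Poisson system
`-½ Δu + V u + ½ W'(u) + q φ u = -ω u`, `-Δφ = q u²` on `ℝ³`, where `Du = ∇u`, `Dφ = ∇φ`. -/
structure SolvesSchrodingerPoisson (V : R3 → ℝ) (W : ℝ → ℝ) (q ω : ℝ)
    (u : R3 → ℝ) (Du : R3 → R3) (φ : R3 → ℝ) (Dφ : R3 → R3) : Prop where
  grad_u : IsWeakGradient u Du
  grad_φ : IsWeakGradient φ Dφ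
  int_V : LocallyIntegrable (fun x => V x * u x)
  int_W : LocallyIntegrable (fun x => deriv W (u x))
  int_φ : LocallyIntegrable (fun x => φ x * u x)
  int_charge : LocallyIntegrable (fun x => u x ^ 2)
  schrodinger : ∀ η : R3 → ℝ, IsTest η →
    ∫ x, (1 / 2 * ∑ i, Du x i * fderiv ℝ η x (e i)
      + (V x * u x + 1 / 2 * deriv W (u x) + q * φ x * u x) * η x) = ∫ x, -ω * u x * η x
  poisson : ∀ η : R3 → ℝ, IsTest η →
    ∫ x, ∑ i, Dφ x i * fderiv ℝ η x (e i) = ∫ x, q * u x ^ 2 * η x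

end NSM

end

noncomputable section

namespace NSM

/-! A soliton minimizes `energy` on `X` at fixed charge, and each static property comes from one
kind of competitor. The constraints do not involve `Θ` and `mag`, so replacing these by zero is
admissible and lowers the energy unless they already vanish (`IsMinimizer.Θ_mag_eq_zero`). The Gauss
law sees `elec` only through its pairings with gradients, so projecting it onto the closure of the
gradients is admissible and shortens it; hence `elec` is an `L²` limit of gradients, and Sobolev's
inequality supplies the potential (`IsMinimizer.exists_potential`). Finally `u` is varied at fixed
charge while `elec` is adjusted so that the Gauss law survives exactly. The first variation
(`IsMinimizer.euler_lagrange`), extended to all test functions, is the Schrödinger equation with `ω`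
as multiplier (`IsMinimizer.exists_solvesSchrodingerPoisson`).

For stationarity, invariance of `Γ` makes every state of the orbit a minimizer, so `Θ` and `mag`
vanish along it. Ampère's law then says that `elec` does not depend on time, and the Gauss law, as
`q ≠ 0`, that `u²` does not either. Thus `u(t) = ±u(0)` pointwise, with a sign that could depend on
`t` and `x`. Continuity in `L²` alone does not exclude this, since the flipped region could grow
gradually. What excludes it is that each `u(t)` is in `H¹` (`lintegral_flip_pow_four_le`): cut
`[0,T]` into steps with `L²` jumps at most `ε`. The function `|u(0)|` restricted to the points first
flipped at step `i` is an `H¹` function `wᵢ` with `‖wᵢ‖₂ ≤ ε`, and interpolation with Sobolev gives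
`∫ wᵢ⁴ ≤ ε C³ ‖∇wᵢ‖₂³`. The supports are disjoint, so the `‖∇wᵢ‖₂²` add up to at most `‖∇u(0)‖₂²`.
The total flipped amount is therefore `O(ε)`, independently of the number of steps, hence zero.

The space-time statement follows from the static one by Fubini, since only the phase `ωt` and the
test function depend on time. -/

/-! ### Translations and mollifiers in `L²`. -/

theorem eLpNorm_two_sq {α E : Type*} [MeasurableSpace α] [NormedAddCommGroup E] (μ : Measure α)
    (f : α → E) : eLpNorm f 2 μ ^ 2 = ∫⁻ x, ‖f x‖ₑ ^ 2 ∂μ := by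
  have h := eLpNorm_nnreal_pow_eq_lintegral (μ := μ) (f := f) (p := 2) two_ne_zero
  simpa using h

theorem MemLp.tendsto_eLpNorm_translate {E : Type*} [NormedAddCommGroup E] {f : R3 → E}
    (hf : MemLp f 2 volume) :
    Tendsto (fun y : R3 => eLpNorm (fun x => f (x - y) - f x) 2 volume) (𝓝 0) (𝓝 0) := by
  have : Fact ((1 : ENNReal) ≤ 2) := ⟨by norm_num⟩
  -- Translations form a continuous family of maps, and composition of an `Lp` function with such a
  -- measure-preserving family is continuous.
  let g : C(R3, C(R3, R3)) :=
    ContinuousMap.curry ⟨fun p : R3 × R3 => p.2 - p.1, by fun_prop⟩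
  have hg : ∀ y, MeasurePreserving (g y) volume volume := fun y =>
    measurePreserving_sub_right volume y
  have h1 := (tendsto_const_nhds (x := hf.toLp f) (f := 𝓝 (0 : R3))).compMeasurePreservingLp
    (g.continuous.tendsto 0) hg (hg 0) (by norm_num)
  rw [tendsto_iff_edist_tendsto_0] at h1
  refine h1.congr fun y => ?_
  rw [Lp.edist_def]
  refine eLpNorm_congr_ae ?_
  have e1 : ∀ y, (Lp.compMeasurePreserving (g y) (hg y) (hf.toLp f) : R3 → E)
      =ᵐ[volume] fun x => f (x - y) := fun y =>
    (Lp.coeFn_compMeasurePreserving _ (hg y)).trans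
      ((hg y).quasiMeasurePreserving.ae_eq_comp hf.coeFn_toLp)
  filter_upwards [e1 y, e1 0] with x h1 h2
  simp only [Pi.sub_apply, h1, h2, sub_zero]

/-- The difference is the average of `f (x - y) - f x` over a probability density in `y`. Jensen's
inequality and Tonelli then reduce its `L²` norm to those of the translation differences. -/
theorem ContDiffBump.eLpNorm_convolution_sub_le {E : Type*} [NormedAddCommGroup E]
    [NormedSpace ℝ E] [CompleteSpace E] {f : R3 → E} (hf : MemLp f 2 volume)
    (φ : ContDiffBump (0 : R3)) {ε : ENNReal}
    (h : ∀ y ∈ Metric.ball (0 : R3) φ.rOut, eLpNorm (fun x => f (x - y) - f x) 2 volume ≤ ε) :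
    eLpNorm (fun x => convolution (φ.normed volume) f (ContinuousLinearMap.lsmul ℝ ℝ) volume x
      - f x) 2 volume ≤ ε := by
  -- A strongly measurable representative makes `f (x - y) - f x` jointly measurable, as Tonelli
  -- requires.
  wlog hm : StronglyMeasurable f generalizing f
  · have hae := hf.1.ae_eq_mk
    have hf' : MemLp (hf.1.mk f) 2 volume := (memLp_congr_ae hae).1 hf
    have h2 := this hf' (fun y hy => ?_) hf.1.stronglyMeasurable_mk
    · refine le_of_eq_of_le (eLpNorm_congr_ae ?_) h2
      have := convolution_congr (ContinuousLinearMap.lsmul ℝ ℝ) (f := φ.normed volume)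
        (f' := φ.normed volume) (Filter.EventuallyEq.rfl) hae
      filter_upwards [hae] with x hx
      rw [hx, this]
    · refine le_of_eq_of_le (eLpNorm_congr_ae ?_) (h y hy)
      filter_upwards [hae, (measurePreserving_sub_right volume y).quasiMeasurePreserving.ae_eq_comp
        hae] with x h1 h2
      simp only [Function.comp_apply] at h2
      rw [h1, h2]
  let ρ : R3 → ENNReal := fun y => ENNReal.ofReal (φ.normed volume y)
  have hρm : Measurable ρ := (φ.continuous_normed.measurable).ennreal_ofReal
  have hρ1 : ∫⁻ y, ρ y = 1 := by
    rw [← ofReal_integral_eq_lintegral_ofReal φ.integrable_normed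
      (ae_of_all _ φ.nonneg_normed), φ.integral_normed, ENNReal.ofReal_one]
  let ν : Measure R3 := volume.withDensity ρ
  have hν : IsProbabilityMeasure ν := ⟨by simp [ν, withDensity_apply, hρ1]⟩
  have key : ∀ x, ‖convolution (φ.normed volume) f (ContinuousLinearMap.lsmul ℝ ℝ) volume x
      - f x‖ₑ ^ 2 ≤ ∫⁻ y, ‖f (x - y) - f x‖ₑ ^ 2 ∂ν := by
    intro x
    have e0 := (φ.hasCompactSupport_normed (μ := volume)).convolutionExists_left
      (ContinuousLinearMap.lsmul ℝ ℝ) φ.continuous_normed (hf.locallyIntegrable (by norm_num)) x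
    have e1 : convolution (φ.normed volume) f (ContinuousLinearMap.lsmul ℝ ℝ) volume x - f x
        = ∫ y, (f (x - y) - f x) ∂ν := by
      rw [integral_withDensity_eq_integral_toReal_smul hρm (ae_of_all _ fun y => by simp [ρ])]
      have : ∀ y, (ρ y).toReal • (f (x - y) - f x)
          = φ.normed volume y • f (x - y) - φ.normed volume y • f x := fun y => by
        simp only [ρ, ENNReal.toReal_ofReal (φ.nonneg_normed y), smul_sub]
      simp_rw [this]
      rw [integral_sub]
      · rw [integral_smul_const, φ.integral_normed, one_smul]; rfl
      · exact e0
      · exact φ.integrable_normed.smul_const _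
    rw [e1]
    have e2 : ‖∫ y, (f (x - y) - f x) ∂ν‖ₑ ≤ eLpNorm (fun y => f (x - y) - f x) 1 ν := by
      rw [eLpNorm_one_eq_lintegral_enorm]; exact enorm_integral_le_lintegral_enorm _
    have e3 : eLpNorm (fun y => f (x - y) - f x) 1 ν ≤ eLpNorm (fun y => f (x - y) - f x) 2 ν :=
      eLpNorm_le_eLpNorm_of_exponent_le (by norm_num)
        ((hm.comp_measurable (by fun_prop)).sub stronglyMeasurable_const).aestronglyMeasurable
    calc _ ≤ eLpNorm (fun y => f (x - y) - f x) 2 ν ^ 2 := by gcongr; exact e2.trans e3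
      _ = _ := eLpNorm_two_sq _ _
  rw [← ENNReal.pow_le_pow_left_iff two_ne_zero, eLpNorm_two_sq]
  have hmm : Measurable (fun p : R3 × R3 => ‖f (p.1 - p.2) - f p.1‖ₑ ^ 2) :=
    (((hm.comp_measurable (by fun_prop)).sub
      (hm.comp_measurable measurable_fst)).enorm).pow_const 2
  calc _ ≤ ∫⁻ x, ∫⁻ y, ‖f (x - y) - f x‖ₑ ^ 2 ∂ν := lintegral_mono key
    _ = ∫⁻ y, (∫⁻ x, ‖f (x - y) - f x‖ₑ ^ 2) ∂ν := 
        lintegral_lintegral_swap (f := fun x y => ‖f (x - y) - f x‖ₑ ^ 2) hmm.aemeasurable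
    _ = ∫⁻ y, eLpNorm (fun x => f (x - y) - f x) 2 volume ^ 2 ∂ν := 
        lintegral_congr fun y => (eLpNorm_two_sq _ _).symm
    _ ≤ ∫⁻ y, ε ^ 2 ∂ν := by
        -- `ν` does not charge the complement of the support of the bump, so only `y` in the ball
        -- matter.
        refine lintegral_mono_ae ?_
        rw [ae_withDensity_iff hρm]
        refine ae_of_all _ fun y hy => ?_
        gcongr
        refine h y ?_
        rw [← φ.support_normed_eq (μ := volume)]
        intro h0
        simp [ρ, h0] at hy
    _ = ε ^ 2 := by simp

theorem tendsto_eLpNorm_convolution_sub {E : Type*} [NormedAddCommGroup E]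
    [NormedSpace ℝ E] [CompleteSpace E] {f : R3 → E} (hf : MemLp f 2 volume)
    {φ : ℕ → ContDiffBump (0 : R3)} (hφ : Tendsto (fun n => (φ n).rOut) atTop (𝓝 0)) :
    Tendsto (fun n => eLpNorm (fun x => convolution ((φ n).normed volume) f
      (ContinuousLinearMap.lsmul ℝ ℝ) volume x - f x) 2 volume) atTop (𝓝 0) := by
  rw [ENNReal.tendsto_nhds_zero]
  intro ε hε
  obtain ⟨δ, hδ, h⟩ := Metric.eventually_nhds_iff_ball.1
    (ENNReal.tendsto_nhds_zero.1 (MemLp.tendsto_eLpNorm_translate hf) ε hε)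
  filter_upwards [hφ.eventually_lt_const hδ] with n hn
  exact ContDiffBump.eLpNorm_convolution_sub_le hf (φ n)
    fun y hy => h y (Metric.ball_subset_ball hn.le hy)

/-! ### Test functions and their gradients. -/

section Test

variable {F : Type*} [NormedAddCommGroup F] [NormedSpace ℝ F]

theorem IsTest.continuous {η : F → ℝ} (h : IsTest η) : Continuous η := h.1.continuous

theorem IsTest.differentiable {η : F → ℝ} (h : IsTest η) : Differentiable ℝ η :=
  h.1.differentiable (by simp)

theorem IsTest.fderiv_apply {η : F → ℝ} (h : IsTest η) (v : F) :
    IsTest (fun x => fderiv ℝ η x v) :=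
  ⟨(h.1.fderiv_right (m := (⊤ : ℕ∞)) (by simp)).clm_apply contDiff_const,
    h.2.fderiv_apply ℝ v⟩

theorem IsTest.smooth_mul {χ η : F → ℝ} (hχ : ContDiff ℝ (⊤ : ℕ∞) χ) (h : IsTest η) :
    IsTest (fun x => χ x * η x) :=
  ⟨hχ.mul h.1, h.2.mul_left⟩

theorem IsTest.add {χ η : F → ℝ} (hχ : IsTest χ) (h : IsTest η) :
    IsTest (fun x => χ x + η x) :=
  ⟨hχ.1.add h.1, hχ.2.add h.2⟩

theorem IsTest.const_mul {η : F → ℝ} (h : IsTest η) (c : ℝ) : IsTest (fun x => c * η x) :=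
  IsTest.smooth_mul contDiff_const h

theorem IsTest.zero : IsTest (fun _ : F => (0 : ℝ)) :=
  ⟨contDiff_const, HasCompactSupport.zero⟩

variable [MeasureSpace F] [BorelSpace F]

theorem IsTest.memLp [IsFiniteMeasureOnCompacts (volume : Measure F)] {η : F → ℝ} (h : IsTest η) (p : ENNReal) : MemLp η p volume :=
  h.continuous.memLp_of_hasCompactSupport h.2

theorem IsTest.integrable_mul {η f : F → ℝ} (h : IsTest η) (hf : LocallyIntegrable f) :
    Integrable (fun x => η x * f x) := by
  simpa using hf.integrable_smul_left_of_hasCompactSupport h.continuous h.2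

end Test

theorem gradient_apply (f : R3 → ℝ) (x : R3) (i : Fin 3) :
    gradient f x i = fderiv ℝ f x (e i) := by
  have h : inner ℝ (gradient f x) (e i) = fderiv ℝ f x (e i) := by
    simp [gradient]
  rw [← h, e, EuclideanSpace.inner_single_right]
  simp

theorem norm_gradient (f : R3 → ℝ) (x : R3) : ‖gradient f x‖ = ‖fderiv ℝ f x‖ := by
  simp [gradient]

theorem IsTest.continuous_gradient {η : R3 → ℝ} (h : IsTest η) : Continuous (gradient η) :=
  (InnerProductSpace.toDual ℝ R3).symm.continuous.comp
    (h.1.continuous_fderiv (by simp))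

theorem IsTest.hasCompactSupport_gradient {η : R3 → ℝ} (h : IsTest η) :
    HasCompactSupport (gradient η) :=
  (h.2.fderiv ℝ).comp_left (g := (InnerProductSpace.toDual ℝ R3).symm) (map_zero _)

theorem IsTest.memLp_gradient {η : R3 → ℝ} (h : IsTest η) (p : ENNReal) :
    MemLp (gradient η) p volume :=
  h.continuous_gradient.memLp_of_hasCompactSupport h.hasCompactSupport_gradient

/-! ### Weak gradients and `H¹(ℝ³)`. -/

theorem isWeakGradient_iff {f : R3 → ℝ} {g : R3 → R3} (hf : LocallyIntegrable f)
    (hg : LocallyIntegrable g) :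
    IsWeakGradient f g ↔ ∀ i, ∀ η : R3 → ℝ, IsTest η →
      ∫ x, fderiv ℝ η x (e i) * f x = -∫ x, η x * g x i := by
  have hgi : ∀ i, LocallyIntegrable (fun x => g x i) := fun i => by
    intro x
    obtain ⟨s, hs, h⟩ := hg x
    exact ⟨s, hs, (EuclideanSpace.proj (𝕜 := ℝ) i).integrable_comp h⟩
  exact ⟨fun h i => (h i).2.2, fun h i => ⟨hf, hgi i, h i⟩⟩

theorem _root_.MeasureTheory.MemLp.component {g : R3 → R3} {p : ENNReal} {μ : Measure R3}
    (h : MemLp g p μ) (i : Fin 3) : MemLp (fun x => g x i) p μ :=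
  (EuclideanSpace.proj (𝕜 := ℝ) i).comp_memLp' h

theorem eLpNorm_component_le (g : R3 → R3) (p : ENNReal) (i : Fin 3) :
    eLpNorm (fun x => g x i) p volume ≤ eLpNorm g p volume :=
  eLpNorm_mono fun x => PiLp.norm_apply_le (g x) i

theorem tendsto_integral_mul {α : Type*} [MeasurableSpace α] {μ : Measure α} {p q : ENNReal}
    [q.HolderTriple p 1] {a f : α → ℝ} {F : ℕ → α → ℝ} (ha : MemLp a q μ)
    (hF : ∀ n, MemLp (F n) p μ) (hf : MemLp f p μ)
    (h : Tendsto (fun n => eLpNorm (fun x => F n x - f x) p μ) atTop (𝓝 0)) :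
    Tendsto (fun n => ∫ x, a x * F n x ∂μ) atTop (𝓝 (∫ x, a x * f x ∂μ)) := by
  have hi : ∀ n, Integrable (fun x => a x * F n x) μ := fun n =>
    memLp_one_iff_integrable.1 (MemLp.mul' (p := q) (q := p) (r := 1) (hF n) ha)
  have h2 : Tendsto (fun n => eLpNorm a q μ * eLpNorm (fun x => F n x - f x) p μ) atTop (𝓝 0) := by
    have := ENNReal.Tendsto.const_mul (a := eLpNorm a q μ) h (Or.inr ha.2.ne)
    rwa [mul_zero] at this
  refine tendsto_integral_of_L1' (fun x => a x * f x) (ha.1.mul hf.1) (Eventually.of_forall hi) ?_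
  refine tendsto_of_tendsto_of_tendsto_of_le_of_le tendsto_const_nhds h2 (fun _ => zero_le) ?_
  intro n
  have h3 := eLpNorm_smul_le_mul_eLpNorm (p := q) (q := p) (r := 1) ((hF n).1.sub hf.1) ha.1
  refine le_of_eq_of_le (eLpNorm_congr_ae (ae_of_all _ fun x => ?_)) h3
  simp only [Pi.sub_apply, Pi.smul_apply', smul_eq_mul]
  ring

/-- `f ∈ H¹(ℝ³)` with weak gradient `g`. -/
structure MemH1 (f : R3 → ℝ) (g : R3 → R3) : Prop where
  memLp : MemLp f 2 volume
  memLp_grad : MemLp g 2 volume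
  weak : IsWeakGradient f g

/-- The defining identity only pairs with test functions, which lie in every `L^q`, so the functions
and the gradients may converge in different exponents: `p = 2` serves `H¹`, `p = 6` serves
`𝒟^{1,2}`. -/
theorem isWeakGradient_of_tendsto {p : ENNReal} (hp : 1 ≤ p) {F : ℕ → R3 → ℝ} {G : ℕ → R3 → R3}
    {f : R3 → ℝ} {g : R3 → R3} (hF : ∀ n, MemLp (F n) p volume) (hG : ∀ n, MemLp (G n) 2 volume)
    (hf : MemLp f p volume) (hg : MemLp g 2 volume)
    (hw : ∀ n, IsWeakGradient (F n) (G n))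
    (h1 : Tendsto (fun n => eLpNorm (fun x => F n x - f x) p volume) atTop (𝓝 0))
    (h2 : Tendsto (fun n => eLpNorm (fun x => G n x - g x) 2 volume) atTop (𝓝 0)) :
    IsWeakGradient f g := by
  rw [isWeakGradient_iff (hf.locallyIntegrable hp) (hg.locallyIntegrable (by norm_num))]
  intro i η hη
  have : ENNReal.HolderConjugate p (1 - p⁻¹)⁻¹ := ENNReal.HolderConjugate.inv_one_sub_inv' hp
  have : ENNReal.HolderTriple (1 - p⁻¹)⁻¹ p 1 := ENNReal.HolderTriple.symm
  have t1 := tendsto_integral_mul ((hη.fderiv_apply (e i)).memLp (1 - p⁻¹)⁻¹) hF hf h1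
  have t2 := tendsto_integral_mul (hη.memLp 2) (fun n => (hG n).component i) (hg.component i)
    (tendsto_of_tendsto_of_tendsto_of_le_of_le tendsto_const_nhds h2 (fun _ => zero_le)
      (fun n => eLpNorm_component_le (fun x => G n x - g x) 2 i))
  refine tendsto_nhds_unique t1 ?_
  simp_rw [fun n => ((isWeakGradient_iff ((hF n).locallyIntegrable hp)
    ((hG n).locallyIntegrable (by norm_num))).1 (hw n)) i η hη]
  exact t2.neg

theorem IsWeakGradient.ae_eq {f : R3 → ℝ} {g g' : R3 → R3} (h : IsWeakGradient f g)
    (h' : IsWeakGradient f g') : g =ᵐ[volume] g' := by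
  have : ∀ i, ∀ᵐ x, g x i = g' x i := fun i => by
    refine ae_eq_of_integral_contDiff_smul_eq (h i).2.1 (h' i).2.1 fun η h1 h2 => ?_
    have e1 := (h i).2.2 η ⟨h1, h2⟩
    have e2 := (h' i).2.2 η ⟨h1, h2⟩
    rw [e1] at e2
    exact neg_injective e2
  filter_upwards [ae_all_iff.2 this] with x hx
  ext i
  exact hx i

theorem isWeakDeriv_congr {F G : Type*} [NormedAddCommGroup F] [NormedSpace ℝ F] [MeasureSpace F]
    [NormedAddCommGroup G] [NormedSpace ℝ G] {f f' g g' : F → G} {v : F} (hf : f =ᵐ[volume] f')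
    (hg : g =ᵐ[volume] g') (h : IsWeakDeriv f v g) : IsWeakDeriv f' v g' := by
  refine ⟨h.1.congr hf, h.2.1.congr hg, fun η hη => ?_⟩
  have e1 : ∫ x, fderiv ℝ η x v • f' x = ∫ x, fderiv ℝ η x v • f x :=
    integral_congr_ae (hf.mono fun x hx => by simp only [hx])
  have e2 : ∫ x, η x • g' x = ∫ x, η x • g x :=
    integral_congr_ae (hg.mono fun x hx => by simp only [hx])
  rw [e1, e2, h.2.2 η hη]

theorem IsWeakGradient.congr {f f' : R3 → ℝ} {g g' : R3 → R3} (h : IsWeakGradient f g)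
    (hf : f =ᵐ[volume] f') (hg : g =ᵐ[volume] g') : IsWeakGradient f' g' := fun i =>
  isWeakDeriv_congr hf (hg.mono fun x hx => by simp only [hx]) (h i)

theorem MemH1.congr {f f' : R3 → ℝ} {g g' : R3 → R3} (h : MemH1 f g)
    (hf : f =ᵐ[volume] f') (hg : g =ᵐ[volume] g') : MemH1 f' g' :=
  ⟨(memLp_congr_ae hf).1 h.1, (memLp_congr_ae hg).1 h.2, h.weak.congr hf hg⟩

theorem MemH1.integral_fderiv_mul {f : R3 → ℝ} {g : R3 → R3} (h : MemH1 f g) {η : R3 → ℝ}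
    (hη : IsTest η) (i : Fin 3) : ∫ x, fderiv ℝ η x (e i) * f x = -∫ x, η x * g x i :=
  (h.weak i).2.2 η hη

theorem MemH1.locallyIntegrable {f : R3 → ℝ} {g : R3 → R3} (h : MemH1 f g) :
    LocallyIntegrable f := h.memLp.locallyIntegrable (by norm_num)

theorem MemH1.locallyIntegrable_grad {f : R3 → ℝ} {g : R3 → R3} (h : MemH1 f g) :
    LocallyIntegrable g := h.memLp_grad.locallyIntegrable (by norm_num)

theorem MemH1.mk' {f : R3 → ℝ} {g : R3 → R3} (hf : MemLp f 2 volume) (hg : MemLp g 2 volume)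
    (h : ∀ i, ∀ η : R3 → ℝ, IsTest η → ∫ x, fderiv ℝ η x (e i) * f x = -∫ x, η x * g x i) :
    MemH1 f g :=
  ⟨hf, hg, (isWeakGradient_iff (hf.locallyIntegrable (by norm_num))
    (hg.locallyIntegrable (by norm_num))).2 h⟩

theorem MemH1.linear_comb {f f' : R3 → ℝ} {g g' : R3 → R3} (h : MemH1 f g) (h' : MemH1 f' g')
    (a b : ℝ) : MemH1 (fun x => a * f x + b * f' x) (fun x => a • g x + b • g' x) := by
  refine MemH1.mk' ((h.memLp.const_mul a).add (h'.memLp.const_mul b))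
    ((h.memLp_grad.const_smul a).add (h'.memLp_grad.const_smul b)) fun i η hη => ?_
  have i1 := (hη.fderiv_apply (e i)).integrable_mul h.locallyIntegrable
  have i2 := (hη.fderiv_apply (e i)).integrable_mul h'.locallyIntegrable
  have i3 := hη.integrable_mul (h.weak i).2.1
  have i4 := hη.integrable_mul (h'.weak i).2.1
  have e1 : ∀ x, fderiv ℝ η x (e i) * (a * f x + b * f' x)
      = a * (fderiv ℝ η x (e i) * f x) + b * (fderiv ℝ η x (e i) * f' x) := fun x => by ring
  have e2 : ∀ x, η x * (a • g x + b • g' x) i = a * (η x * g x i) + b * (η x * g' x i) :=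
    fun x => by simp; ring
  simp_rw [e1, e2]
  rw [integral_add (i1.const_mul a) (i2.const_mul b), integral_add (i3.const_mul a)
    (i4.const_mul b)]
  simp only [integral_const_mul]
  rw [h.integral_fderiv_mul hη, h'.integral_fderiv_mul hη]
  ring

theorem isWeakGradient_of_contDiff {f : R3 → ℝ} (hf : ContDiff ℝ 1 f) :
    IsWeakGradient f (gradient f) := by
  have hc : Continuous (gradient f) := (InnerProductSpace.toDual ℝ R3).symm.continuous.comp
    (hf.continuous_fderiv (by simp))
  rw [isWeakGradient_iff hf.continuous.locallyIntegrable hc.locallyIntegrable]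
  intro i η hη
  simp_rw [gradient_apply]
  have l1 := hf.continuous.locallyIntegrable (μ := (volume : Measure R3))
  have l2 : LocallyIntegrable (fun x => fderiv ℝ f x (e i)) (volume : Measure R3) :=
    ((hf.continuous_fderiv (by simp)).clm_apply continuous_const).locallyIntegrable
  rw [integral_mul_fderiv_eq_neg_fderiv_mul_of_integrable
    ((hη.fderiv_apply (e i)).integrable_mul l1) (hη.integrable_mul l2) (hη.integrable_mul l1)
    (fun x _ => hη.differentiable x) (fun x _ => hf.differentiable (by simp) x), neg_neg]

theorem IsTest.memH1 {η : R3 → ℝ} (h : IsTest η) : MemH1 η (gradient η) :=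
  ⟨h.memLp 2, h.memLp_gradient 2, isWeakGradient_of_contDiff (h.1.of_le (by simp))⟩

/-! ### Density of test functions in `H¹`. -/

theorem tendsto_eLpNorm_two_of_dominated {α E : Type*} [MeasurableSpace α] {μ : Measure α}
    [NormedAddCommGroup E] {F : ℕ → α → E} {b : α → ℝ} (hF : ∀ n, AEStronglyMeasurable (F n) μ)
    (hb : MemLp b 2 μ) (hle : ∀ n, ∀ᵐ x ∂μ, ‖F n x‖ ≤ b x)
    (ht : ∀ᵐ x ∂μ, Tendsto (fun n => F n x) atTop (𝓝 0)) :
    Tendsto (fun n => eLpNorm (F n) 2 μ) atTop (𝓝 0) := by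
  have h1 : Tendsto (fun n => ∫⁻ x, ‖F n x‖ₑ ^ 2 ∂μ) atTop (𝓝 (∫⁻ _, 0 ∂μ)) := by
    refine tendsto_lintegral_of_dominated_convergence' (fun x => ‖b x‖ₑ ^ 2)
      (fun n => (hF n).enorm.pow_const 2) (fun n => ?_) ?_ ?_
    · filter_upwards [hle n] with x hx
      have : ‖F n x‖ₑ ≤ ‖b x‖ₑ := by
        rw [enorm_le_iff_norm_le]
        exact hx.trans (le_abs_self _)
      gcongr
    · rw [← eLpNorm_two_sq]
      exact ENNReal.pow_ne_top hb.2.ne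
    · filter_upwards [ht] with x hx
      have := hx.enorm
      simpa using ENNReal.Tendsto.pow (n := 2) this
  simp_rw [← eLpNorm_two_sq] at h1
  have h2 := (ENNReal.continuous_rpow_const (y := (1 / 2 : ℝ))).tendsto _ |>.comp h1
  have e : ∀ a : ENNReal, (a ^ 2) ^ (1 / 2 : ℝ) = a := fun a => by
    rw [← ENNReal.rpow_natCast, ← ENNReal.rpow_mul]; norm_num
  simp only [Function.comp_def, e, lintegral_zero,
    ENNReal.zero_rpow_of_pos (by norm_num : (0 : ℝ) < 1 / 2)] at h2
  exact h2

/-- The product rule comes from testing the weak gradient of `f` against `χ η`. -/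
theorem MemH1.smooth_mul {f : R3 → ℝ} {g : R3 → R3} (h : MemH1 f g) {χ : R3 → ℝ}
    (hχ : IsTest χ) : MemH1 (fun x => χ x * f x) (fun x => χ x • g x + f x • gradient χ x) := by
  have m1 : MemLp (fun x => χ x * f x) 2 volume :=
    MemLp.mul' (p := ⊤) (q := 2) h.memLp (hχ.memLp ⊤)
  have m2 : MemLp (fun x => χ x • g x) 2 volume :=
    MemLp.smul (p := ⊤) (q := 2) (r := 2) h.memLp_grad (hχ.memLp ⊤)
  have m3 : MemLp (fun x => f x • gradient χ x) 2 volume :=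
    MemLp.smul (p := 2) (q := ⊤) (r := 2) (hχ.memLp_gradient ⊤) h.memLp
  refine MemH1.mk' m1 (m2.add m3) fun i η hη => ?_
  have h1 := h.integral_fderiv_mul (IsTest.smooth_mul hχ.1 hη) i
  have e1 : ∀ x, fderiv ℝ (fun x => χ x * η x) x (e i) * f x
      = fderiv ℝ η x (e i) * (χ x * f x) + η x * fderiv ℝ χ x (e i) * f x := fun x => by
    rw [fderiv_fun_mul (hχ.differentiable x) (hη.differentiable x)]
    simp
    ring
  have e2 : ∀ x, η x * (χ x • g x + f x • gradient χ x) i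
      = χ x * η x * g x i + η x * fderiv ℝ χ x (e i) * f x := fun x => by
    simp [gradient_apply]
    ring
  have i1 : Integrable (fun x => fderiv ℝ η x (e i) * (χ x * f x)) :=
    (hη.fderiv_apply (e i)).integrable_mul (m1.locallyIntegrable (by norm_num))
  have i2 : Integrable (fun x => η x * fderiv ℝ χ x (e i) * f x) :=
    (IsTest.smooth_mul hη.1 (hχ.fderiv_apply (e i))).integrable_mul h.locallyIntegrable
  have i3 : Integrable (fun x => χ x * η x * g x i) :=
    (IsTest.smooth_mul hχ.1 hη).integrable_mul (h.weak i).2.1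
  simp_rw [e1] at h1
  simp_rw [e2]
  rw [integral_add i1 i2] at h1
  rw [integral_add i3 i2]
  linarith

/-- Multiply by the dilated cutoffs `b(x/(n+1))`: they tend to `1` boundedly, and their gradients
carry a factor `1/(n+1)`. -/
theorem MemH1.exists_hasCompactSupport {f : R3 → ℝ} {g : R3 → R3} (h : MemH1 f g) :
    ∃ (F : ℕ → R3 → ℝ) (G : ℕ → R3 → R3), (∀ n, HasCompactSupport (F n)) ∧
      (∀ n, MemH1 (F n) (G n)) ∧
      Tendsto (fun n => eLpNorm (fun x => F n x - f x) 2 volume) atTop (𝓝 0) ∧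
      Tendsto (fun n => eLpNorm (fun x => G n x - g x) 2 volume) atTop (𝓝 0) := by
  let b : ContDiffBump (0 : R3) := ⟨1, 2, one_pos, one_lt_two⟩
  have hb : IsTest b := ⟨b.contDiff, b.hasCompactSupport⟩
  let χ : ℕ → R3 → ℝ := fun n x => b (((n : ℝ) + 1)⁻¹ • x)
  have hpos : ∀ n : ℕ, (0 : ℝ) < ((n : ℝ) + 1)⁻¹ := fun n => by positivity
  have hχ : ∀ n, IsTest (χ n) := fun n =>
    ⟨b.contDiff.comp (contDiff_const_smul _), hb.2.comp_smul (hpos n).ne'⟩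
  have hlim : Tendsto (fun n : ℕ => ((n : ℝ) + 1)⁻¹) atTop (𝓝 0) := by
    simpa using tendsto_one_div_add_atTop_nhds_zero_nat (𝕜 := ℝ)
  have hgr : ∀ n x, gradient (χ n) x = ((n : ℝ) + 1)⁻¹ • gradient b (((n : ℝ) + 1)⁻¹ • x) := by
    intro n x
    ext i
    rw [gradient_apply, PiLp.smul_apply, gradient_apply, smul_eq_mul]
    simp only [χ]
    rw [fderiv_comp_smul]
    simp
  obtain ⟨C, hC⟩ := hb.continuous_gradient.bounded_above_of_compact_support
    hb.hasCompactSupport_gradient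
  have hχ1 : ∀ x, Tendsto (fun n => χ n x) atTop (𝓝 1) := by
    intro x
    have h0 : Tendsto (fun n : ℕ => ((n : ℝ) + 1)⁻¹ • x) atTop (𝓝 ((0 : ℝ) • x)) :=
      hlim.smul_const x
    rw [zero_smul] at h0
    have := (hb.continuous.tendsto 0).comp h0
    rwa [b.one_of_mem_closedBall (by simp [b])] at this
  have hχle : ∀ n x, |χ n x - 1| ≤ 1 := fun n x => by
    have h0 : 0 ≤ χ n x := b.nonneg
    have h1 : χ n x ≤ 1 := b.le_one
    rw [abs_le]; constructor <;> linarith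
  refine ⟨fun n x => χ n x * f x, fun n x => χ n x • g x + f x • gradient (χ n) x,
    fun n => (hχ n).2.mul_right, fun n => h.smooth_mul (hχ n), ?_, ?_⟩
  · refine tendsto_eLpNorm_two_of_dominated (b := fun x => ‖f x‖)
      (fun n => (((hχ n).continuous.aestronglyMeasurable).mul h.memLp.1).sub h.memLp.1)
      h.memLp.norm (fun n => ae_of_all _ fun x => ?_) (ae_of_all _ fun x => ?_)
    · have : χ n x * f x - f x = (χ n x - 1) * f x := by ring
      rw [this, norm_mul]
      exact mul_le_of_le_one_left (norm_nonneg _) (hχle n x)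
    · simpa using ((hχ1 x).mul_const (f x)).sub_const (f x)
  · refine tendsto_eLpNorm_two_of_dominated (b := fun x => ‖g x‖ + C * ‖f x‖)
      (fun n => ((((hχ n).continuous.aestronglyMeasurable).smul h.memLp_grad.1).add
        (h.memLp.1.smul (hχ n).continuous_gradient.aestronglyMeasurable)).sub h.memLp_grad.1)
      (h.memLp_grad.norm.add (h.memLp.norm.const_mul C)) (fun n => ae_of_all _ fun x => ?_)
      (ae_of_all _ fun x => ?_)
    · have : χ n x • g x + f x • gradient (χ n) x - g x
          = (χ n x - 1) • g x + f x • gradient (χ n) x := by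
        rw [sub_smul, one_smul]; abel
      rw [this]
      refine (norm_add_le _ _).trans ?_
      rw [norm_smul, norm_smul, hgr, norm_smul]
      have h1 : ‖((n : ℝ) + 1)⁻¹‖ ≤ 1 := by
        rw [Real.norm_of_nonneg (hpos n).le]
        exact inv_le_one_of_one_le₀ (by linarith [Nat.cast_nonneg (α := ℝ) n])
      have h2 := hC (((n : ℝ) + 1)⁻¹ • x)
      have h3 : ‖((n : ℝ) + 1)⁻¹‖ * ‖gradient b (((n : ℝ) + 1)⁻¹ • x)‖ ≤ C :=
        (mul_le_of_le_one_left (norm_nonneg _) h1).trans h2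
      have h4 := hχle n x
      rw [mul_comm C]
      gcongr
      exact mul_le_of_le_one_left (norm_nonneg _) h4
    · have h1 : Tendsto (fun n => gradient (χ n) x) atTop (𝓝 0) := by
        refine squeeze_zero_norm (a := fun n : ℕ => ((n : ℝ) + 1)⁻¹ * C) (fun n => ?_) ?_
        · rw [hgr, norm_smul, Real.norm_of_nonneg (hpos n).le]
          gcongr
          exact hC _
        · simpa using hlim.mul_const C
      simpa using (((hχ1 x).smul_const (g x)).add (h1.const_smul (f x))).sub_const (g x)

/-- Differentiate the kernel, then use the weak gradient identity with the test function `t ↦ ρ (x -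
t)`. -/
theorem MemH1.gradient_convolution {f : R3 → ℝ} {g : R3 → R3} (h : MemH1 f g)
    {ρ : R3 → ℝ} (hρ : IsTest ρ) (x : R3) :
    gradient (convolution ρ f (ContinuousLinearMap.lsmul ℝ ℝ) volume) x
      = convolution ρ g (ContinuousLinearMap.lsmul ℝ ℝ) volume x := by
  ext i
  have hd := (hρ.2.hasFDerivAt_convolution_left (ContinuousLinearMap.lsmul ℝ ℝ)
    (hρ.1.of_le (by simp)) h.locallyIntegrable x).fderiv
  have hη : IsTest (fun t => ρ (x - t)) := by
    refine ⟨hρ.1.comp (contDiff_const.sub contDiff_id), ?_⟩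
    have := hρ.2.comp_homeomorph (Homeomorph.subLeft x)
    exact this
  have hc1 : ConvolutionExists (fderiv ℝ ρ) f
      (ContinuousLinearMap.precompL R3 (ContinuousLinearMap.lsmul ℝ ℝ)) volume :=
    (hρ.2.fderiv ℝ).convolutionExists_left _ (hρ.1.continuous_fderiv (by simp))
      h.locallyIntegrable
  have hc2 : ConvolutionExists ρ g (ContinuousLinearMap.lsmul ℝ ℝ) volume :=
    hρ.2.convolutionExists_left _ hρ.continuous h.locallyIntegrable_grad
  rw [gradient_apply, hd]
  have e1 : (convolution (fderiv ℝ ρ) f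
      (ContinuousLinearMap.precompL R3 (ContinuousLinearMap.lsmul ℝ ℝ)) volume x) (e i)
      = ∫ t, fderiv ℝ ρ t (e i) * f (x - t) := by
    rw [convolution, ContinuousLinearMap.integral_apply (hc1 x)]
    rfl
  have e2 : (convolution ρ g (ContinuousLinearMap.lsmul ℝ ℝ) volume x) i
      = ∫ t, ρ t * g (x - t) i := by
    have := (EuclideanSpace.proj i : R3 →L[ℝ] ℝ).integral_comp_comm (hc2 x)
    exact this.symm
  have hder : ∀ t, fderiv ℝ (fun t => ρ (x - t)) t (e i) = -fderiv ℝ ρ (x - t) (e i) := by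
    intro t
    have := ((hρ.differentiable (x - t)).hasFDerivAt.comp t
      ((hasFDerivAt_id t).const_sub x)).fderiv
    simp only [Function.comp_def] at this
    rw [this]
    simp
  have h1 := h.integral_fderiv_mul hη i
  simp_rw [hder] at h1
  rw [e1, e2, ← integral_sub_left_eq_self _ volume x, ← integral_sub_left_eq_self
    (fun t => ρ t * g (x - t) i) volume x]
  simp only [sub_sub_cancel]
  simp only [neg_mul, integral_neg, neg_inj] at h1
  exact h1

theorem MemH1.exists_isTest_le {f : R3 → ℝ} {g : R3 → R3} (h : MemH1 f g) {ε : ENNReal}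
    (hε : 0 < ε) : ∃ η : R3 → ℝ, IsTest η ∧ eLpNorm (fun x => η x - f x) 2 volume ≤ ε ∧
      eLpNorm (fun x => gradient η x - g x) 2 volume ≤ ε := by
  have hε2 : 0 < ε / 2 := ENNReal.half_pos hε.ne'
  obtain ⟨F, G, hs, hFG, t1, t2⟩ := h.exists_hasCompactSupport
  obtain ⟨n, hn1, hn2⟩ := ((ENNReal.tendsto_nhds_zero.1 t1 _ hε2).and
    (ENNReal.tendsto_nhds_zero.1 t2 _ hε2)).exists
  let φ : ℕ → ContDiffBump (0 : R3) := fun k =>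
    ⟨((k : ℝ) + 1)⁻¹, 2 * ((k : ℝ) + 1)⁻¹, by positivity, by
      have : 0 < ((k : ℝ) + 1)⁻¹ := by positivity
      linarith⟩
  have hφ : Tendsto (fun k => (φ k).rOut) atTop (𝓝 0) := by
    have : Tendsto (fun n : ℕ => ((n : ℝ) + 1)⁻¹) atTop (𝓝 0) := by
      simpa using tendsto_one_div_add_atTop_nhds_zero_nat (𝕜 := ℝ)
    simpa using this.const_mul 2
  have hρ : ∀ k, IsTest ((φ k).normed volume) := fun k =>
    ⟨(φ k).contDiff_normed, (φ k).hasCompactSupport_normed⟩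
  obtain ⟨k, hk1, hk2⟩ := ((ENNReal.tendsto_nhds_zero.1
    (tendsto_eLpNorm_convolution_sub (hFG n).memLp hφ) _ hε2).and
    (ENNReal.tendsto_nhds_zero.1 (tendsto_eLpNorm_convolution_sub (hFG n).memLp_grad hφ)
      _ hε2)).exists
  have hη : IsTest (convolution ((φ k).normed volume) (F n)
      (ContinuousLinearMap.lsmul ℝ ℝ) volume) :=
    ⟨(hρ k).2.contDiff_convolution_left _ (hρ k).1 (hFG n).locallyIntegrable,
      (hρ k).2.convolution _ (hs n)⟩
  refine ⟨_, hη, ?_, ?_⟩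
  · rw [← ENNReal.add_halves ε]
    refine le_trans (le_of_eq_of_le (eLpNorm_congr_ae (ae_of_all _ fun x => ?_))
      (eLpNorm_add_le ((hη.memLp 2).1.sub (hFG n).memLp.1) ((hFG n).memLp.1.sub h.memLp.1)
        (by norm_num))) (add_le_add hk1 hn1)
    simp
  · rw [← ENNReal.add_halves ε]
    simp_rw [← (hFG n).gradient_convolution (hρ k)] at hk2
    refine le_trans (le_of_eq_of_le (eLpNorm_congr_ae (ae_of_all _ fun x => ?_))
      (eLpNorm_add_le ((hη.memLp_gradient 2).1.sub (hFG n).memLp_grad.1)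
        ((hFG n).memLp_grad.1.sub h.memLp_grad.1) (by norm_num))) (add_le_add hk2 hn2)
    simp

theorem MemH1.exists_seq_isTest {f : R3 → ℝ} {g : R3 → R3} (h : MemH1 f g) :
    ∃ η : ℕ → R3 → ℝ, (∀ n, IsTest (η n)) ∧
      Tendsto (fun n => eLpNorm (fun x => η n x - f x) 2 volume) atTop (𝓝 0) ∧
      Tendsto (fun n => eLpNorm (fun x => gradient (η n) x - g x) 2 volume) atTop (𝓝 0) := by
  choose η h1 h2 h3 using fun n : ℕ =>
    h.exists_isTest_le (ε := ((n : ENNReal))⁻¹) (ENNReal.inv_pos.2 (ENNReal.natCast_ne_top n))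
  exact ⟨η, h1, tendsto_of_tendsto_of_tendsto_of_le_of_le tendsto_const_nhds
    ENNReal.tendsto_inv_nat_nhds_zero (fun _ => zero_le) h2,
    tendsto_of_tendsto_of_tendsto_of_le_of_le tendsto_const_nhds
    ENNReal.tendsto_inv_nat_nhds_zero (fun _ => zero_le) h3⟩

/-! ### The Sobolev embedding in `L⁶`. -/

theorem exists_sobolev_const : ∃ C : NNReal, ∀ η : R3 → ℝ, IsTest η →
    eLpNorm η 6 volume ≤ C * eLpNorm (gradient η) 2 volume := by
  refine ⟨SNormLESNormFDerivOfEqConst ℝ (volume : Measure R3) 2, fun η hη => ?_⟩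
  have h := eLpNorm_le_eLpNorm_fderiv_of_eq (volume : Measure R3) (u := η)
    (hη.1.of_le (by simp)) hη.2 (p := 2) (p' := 6) (by norm_num) (by simp) (by simp; norm_num)
  refine h.trans (le_of_eq ?_)
  congr 1
  exact eLpNorm_congr_norm_ae (ae_of_all _ fun x => (norm_gradient η x).symm)

/-- A constant in the Sobolev inequality `‖η‖₆ ≤ C ‖∇η‖₂`. -/
def sobolevConst : NNReal := exists_sobolev_const.choose

theorem IsTest.eLpNorm_six_le {η : R3 → ℝ} (h : IsTest η) :
    eLpNorm η 6 volume ≤ sobolevConst * eLpNorm (gradient η) 2 volume :=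
  exists_sobolev_const.choose_spec η h

theorem gradient_sub_of_isTest {η χ : R3 → ℝ} (h : IsTest η) (h' : IsTest χ) (x : R3) :
    gradient (fun x => η x - χ x) x = gradient η x - gradient χ x := by
  ext i
  rw [PiLp.sub_apply, gradient_apply, gradient_apply, gradient_apply,
    fderiv_fun_sub (h.differentiable x) (h'.differentiable x)]
  rfl

theorem IsTest.sub {F : Type*} [NormedAddCommGroup F] [NormedSpace ℝ F] {η χ : F → ℝ}
    (h : IsTest η) (h' : IsTest χ) : IsTest (fun x => η x - χ x) := by
  have := h.add (h'.const_mul (-1))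
  simpa [sub_eq_add_neg] using this

/-- Sobolev's inequality for differences makes the sequence Cauchy in `L⁶`. This serves both `H¹`,
where the limit is known, and the closure of the gradients, where the limit is the electric
potential. -/
theorem exists_tendsto_eLpNorm_six {η : ℕ → R3 → ℝ} (hη : ∀ n, IsTest (η n)) {g : R3 → R3}
    (hg : MemLp g 2 volume)
    (h : Tendsto (fun n => eLpNorm (fun x => gradient (η n) x - g x) 2 volume) atTop (𝓝 0)) :
    ∃ φ : R3 → ℝ, MemLp φ 6 volume ∧
      Tendsto (fun n => eLpNorm (fun x => η n x - φ x) 6 volume) atTop (𝓝 0) ∧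
      eLpNorm φ 6 volume ≤ sobolevConst * eLpNorm g 2 volume := by
  have : Fact ((1 : ENNReal) ≤ 6) := ⟨by norm_num⟩
  have : Fact ((1 : ENNReal) ≤ 2) := ⟨by norm_num⟩
  let L : ℕ → Lp ℝ 6 (volume : Measure R3) := fun n => ((hη n).memLp 6).toLp
  let M : ℕ → Lp R3 2 (volume : Measure R3) := fun n => ((hη n).memLp_gradient 2).toLp
  have hM : Tendsto M atTop (𝓝 hg.toLp) := by
    rw [tendsto_iff_edist_tendsto_0]
    refine h.congr fun n => ?_
    rw [Lp.edist_toLp_toLp]; rfl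
  have hLM : ∀ n m, edist (L n) (L m) ≤ sobolevConst * edist (M n) (M m) := fun n m => by
    rw [Lp.edist_toLp_toLp, Lp.edist_toLp_toLp]
    refine (((hη n).sub (hη m)).eLpNorm_six_le).trans (le_of_eq ?_)
    congr 1
    exact eLpNorm_congr_ae (ae_of_all _ fun x => gradient_sub_of_isTest (hη n) (hη m) x)
  have hL : CauchySeq L := by
    have hc := hM.cauchySeq
    rw [EMetric.cauchySeq_iff] at hc ⊢
    intro ε hε
    -- The added `1` avoids a division by zero, since the constant is not known to be positive.
    obtain ⟨N, hN⟩ := hc (ε / (sobolevConst + 1))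
      (ENNReal.div_pos hε.ne' (by finiteness))
    refine ⟨N, fun m hm n hn => ?_⟩
    have h1 := hN m hm n hn
    rw [ENNReal.lt_div_iff_mul_lt (by simp) (by left; finiteness)] at h1
    refine ((hLM m n).trans ?_).trans_lt h1
    rw [mul_comm]
    gcongr
    exact le_self_add
  obtain ⟨l, hl⟩ := cauchySeq_tendsto_of_complete hL
  have hl' : Tendsto (fun n => eLpNorm (fun x => η n x - l x) 6 volume) atTop (𝓝 0) := by
    rw [tendsto_iff_edist_tendsto_0] at hl
    refine hl.congr fun n => ?_
    rw [Lp.edist_def]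
    refine eLpNorm_congr_ae ?_
    filter_upwards [((hη n).memLp 6).coeFn_toLp] with x hx
    simp only [Pi.sub_apply, L, hx]
  refine ⟨l, Lp.memLp l, hl', ?_⟩
  have t : Tendsto (fun n => (sobolevConst : ENNReal) * (eLpNorm (fun x => gradient (η n) x - g x)
      2 volume + eLpNorm g 2 volume) + eLpNorm (fun x => η n x - l x) 6 volume) atTop
      (𝓝 (sobolevConst * (0 + eLpNorm g 2 volume) + 0)) :=
    (ENNReal.Tendsto.const_mul (h.add tendsto_const_nhds) (Or.inr (by finiteness))).add hl'
  rw [zero_add, add_zero] at t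
  refine ge_of_tendsto' t fun n => ?_
  have e1 : eLpNorm (l : R3 → ℝ) 6 volume ≤ eLpNorm (η n) 6 volume
      + eLpNorm (fun x => η n x - l x) 6 volume := by
    refine le_of_eq_of_le (eLpNorm_congr_ae (ae_of_all _ fun x => ?_))
      (eLpNorm_sub_le ((hη n).memLp 6).1 (((hη n).memLp 6).sub (Lp.memLp l)).1 (by norm_num))
    simp
  have e2 : eLpNorm (gradient (η n)) 2 volume ≤
      eLpNorm (fun x => gradient (η n) x - g x) 2 volume + eLpNorm g 2 volume := by
    refine le_of_eq_of_le (eLpNorm_congr_ae (ae_of_all _ fun x => ?_))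
      (eLpNorm_add_le (((hη n).memLp_gradient 2).sub hg).1 hg.1 (by norm_num))
    simp
  refine e1.trans ?_
  gcongr
  exact (hη n).eLpNorm_six_le.trans (by gcongr)

theorem ae_eq_of_tendsto_eLpNorm {α : Type*} [MeasurableSpace α] {μ : Measure α}
    {p q : ENNReal} (hp : p ≠ 0) (hq : q ≠ 0) {F : ℕ → α → ℝ} {f f' : α → ℝ}
    (hF : ∀ n, AEStronglyMeasurable (F n) μ) (hf : AEStronglyMeasurable f μ)
    (hf' : AEStronglyMeasurable f' μ)
    (h : Tendsto (fun n => eLpNorm (fun x => F n x - f x) p μ) atTop (𝓝 0))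
    (h' : Tendsto (fun n => eLpNorm (fun x => F n x - f' x) q μ) atTop (𝓝 0)) : f =ᵐ[μ] f' :=
  tendstoInMeasure_ae_unique (tendstoInMeasure_of_tendsto_eLpNorm hp hF hf h)
    (tendstoInMeasure_of_tendsto_eLpNorm hq hF hf' h')

/-- Approximating test functions converge to `f` in `L²` and to some `φ` in `L⁶`; both imply
convergence in measure, so the limits agree. -/
theorem MemH1.eLpNorm_six_le {f : R3 → ℝ} {g : R3 → R3} (h : MemH1 f g) :
    eLpNorm f 6 volume ≤ sobolevConst * eLpNorm g 2 volume := by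
  obtain ⟨η, hη, h1, h2⟩ := h.exists_seq_isTest
  obtain ⟨φ, hφ, h3, h4⟩ := exists_tendsto_eLpNorm_six hη h.memLp_grad h2
  rwa [eLpNorm_congr_ae (ae_eq_of_tendsto_eLpNorm (by norm_num) (by norm_num)
    (fun n => (hη n).continuous.aestronglyMeasurable) h.memLp.1 hφ.1 h1 h3)]

theorem MemH1.memLp_six {f : R3 → ℝ} {g : R3 → R3} (h : MemH1 f g) : MemLp f 6 volume :=
  ⟨h.memLp.1, h.eLpNorm_six_le.trans_lt
    (ENNReal.mul_lt_top ENNReal.coe_lt_top h.memLp_grad.2)⟩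

/-! ### Chain rules in `H¹` and lattice operations. -/

theorem abs_sub_le_of_abs_deriv_le {Φ : ℝ → ℝ} (hΦ : ContDiff ℝ 1 Φ) {C : ℝ}
    (hC : ∀ s, |deriv Φ s| ≤ C) (s t : ℝ) : |Φ s - Φ t| ≤ C * |s - t| :=
  convex_univ.norm_image_sub_le_of_norm_deriv_le
    (fun x _ => hΦ.differentiable (by simp) x) (fun x _ => hC x) (mem_univ t) (mem_univ s)

theorem MemH1.comp {f : R3 → ℝ} {g : R3 → R3} (h : MemH1 f g) {Φ : ℝ → ℝ} (hΦ : ContDiff ℝ 1 Φ)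
    (h0 : Φ 0 = 0) {C : ℝ} (hC : ∀ s, |deriv Φ s| ≤ C) :
    MemH1 (fun x => Φ (f x)) (fun x => deriv Φ (f x) • g x) := by
  have hlip := abs_sub_le_of_abs_deriv_le hΦ hC
  have hd : Continuous (deriv Φ) := hΦ.continuous_deriv (by simp)
  have hm : ∀ {f : R3 → ℝ} {g : R3 → R3}, MemLp f 2 volume → MemLp g 2 volume →
      MemLp (fun x => Φ (f x)) 2 volume ∧ MemLp (fun x => deriv Φ (f x) • g x) 2 volume := by
    intro f g hf hg
    refine ⟨hf.of_le_mul (c := C) (hΦ.continuous.comp_aestronglyMeasurable hf.1)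
      (ae_of_all _ fun x => by simpa [h0] using hlip (f x) 0),
      hg.of_le_mul (c := C) ((hd.comp_aestronglyMeasurable hf.1).smul hg.1)
      (ae_of_all _ fun x => ?_)⟩
    rw [norm_smul]
    gcongr
    exact hC _
  obtain ⟨η', hη', h1', h2'⟩ := h.exists_seq_isTest
  -- Pointwise convergence along a subsequence is needed because `deriv Φ` is only continuous: the
  -- term `(Φ'(ηₙ) - Φ'(f)) g` is handled by dominated convergence.
  obtain ⟨k, hk, hae⟩ := (tendstoInMeasure_of_tendsto_eLpNorm two_ne_zero
    (fun n => (hη' n).continuous.aestronglyMeasurable) h.memLp.1 h1').exists_seq_tendsto_ae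
  let η := fun n => η' (k n)
  have hη : ∀ n, IsTest (η n) := fun n => hη' _
  have h1 : Tendsto (fun n => eLpNorm (fun x => η n x - f x) 2 volume) atTop (𝓝 0) :=
    h1'.comp hk.tendsto_atTop
  have h2 : Tendsto (fun n => eLpNorm (fun x => gradient (η n) x - g x) 2 volume) atTop (𝓝 0) :=
    h2'.comp hk.tendsto_atTop
  have hw : ∀ n, IsWeakGradient (fun x => Φ (η n x)) (fun x => deriv Φ (η n x) • gradient (η n) x) :=
    fun n => by
      refine (isWeakGradient_of_contDiff (hΦ.comp ((hη n).1.of_le (by simp)))).congr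
        (ae_of_all _ fun _ => rfl) (ae_of_all _ fun x => ?_)
      ext i
      rw [gradient_apply, PiLp.smul_apply, gradient_apply,
        fderiv_comp x (hΦ.differentiable (by simp) _) ((hη n).differentiable x)]
      simp [mul_comm]
  refine ⟨(hm h.memLp h.memLp_grad).1, (hm h.memLp h.memLp_grad).2,
    isWeakGradient_of_tendsto (p := 2) (by norm_num)
    (fun n => (hm ((hη n).memLp 2) ((hη n).memLp_gradient 2)).1)
    (fun n => (hm ((hη n).memLp 2) ((hη n).memLp_gradient 2)).2)
    (hm h.memLp h.memLp_grad).1 (hm h.memLp h.memLp_grad).2 hw ?_ ?_⟩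
  · have t : Tendsto (fun n => ENNReal.ofReal C * eLpNorm (fun x => η n x - f x) 2 volume) atTop
        (𝓝 0) := by
      have := ENNReal.Tendsto.const_mul (a := ENNReal.ofReal C) h1 (Or.inr (by finiteness))
      rwa [mul_zero] at this
    refine tendsto_of_tendsto_of_tendsto_of_le_of_le tendsto_const_nhds t (fun _ => zero_le)
      fun n => ?_
    exact eLpNorm_le_mul_eLpNorm_of_ae_le_mul (ae_of_all _ fun x => hlip _ _) 2
  · have t1 : Tendsto (fun n => eLpNorm (fun x => (deriv Φ (η n x) - deriv Φ (f x)) • g x) 2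
        volume) atTop (𝓝 0) := by
      refine tendsto_eLpNorm_two_of_dominated (b := fun x => (2 * C) * ‖g x‖) (fun n => ?_)
        (h.memLp_grad.norm.const_mul _) (fun n => ae_of_all _ fun x => ?_) ?_
      · exact ((hd.comp_aestronglyMeasurable (hη n).continuous.aestronglyMeasurable).sub
          (hd.comp_aestronglyMeasurable h.memLp.1)).smul h.memLp_grad.1
      · rw [norm_smul]
        gcongr
        refine (norm_sub_le _ _).trans ?_
        have h1 := hC (η n x)
        have h2 := hC (f x)
        simp only [Real.norm_eq_abs]
        linarith
      · filter_upwards [hae] with x hx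
        have := (((hd.tendsto _).comp hx).sub_const (deriv Φ (f x))).smul_const (g x)
        simpa using this
    have t2 : Tendsto (fun n => ENNReal.ofReal C * eLpNorm (fun x => gradient (η n) x - g x) 2
        volume) atTop (𝓝 0) := by
      have := ENNReal.Tendsto.const_mul (a := ENNReal.ofReal C) h2 (Or.inr (by finiteness))
      rwa [mul_zero] at this
    have t3 := t2.add t1
    rw [add_zero] at t3
    refine tendsto_of_tendsto_of_tendsto_of_le_of_le tendsto_const_nhds t3 (fun _ => zero_le)
      fun n => ?_
    have m1 : AEStronglyMeasurable (fun x => deriv Φ (η n x)) volume :=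
      hd.comp_aestronglyMeasurable (hη n).continuous.aestronglyMeasurable
    have e : ∀ x, deriv Φ (η n x) • gradient (η n) x - deriv Φ (f x) • g x
        = deriv Φ (η n x) • (gradient (η n) x - g x) + (deriv Φ (η n x) - deriv Φ (f x)) • g x :=
      fun x => by simp only [smul_sub, sub_smul]; abel
    simp_rw [e]
    refine (eLpNorm_add_le (m1.smul (((hη n).memLp_gradient 2).1.sub h.memLp_grad.1))
      ((m1.sub (hd.comp_aestronglyMeasurable h.memLp.1)).smul h.memLp_grad.1)
      (by norm_num)).trans (add_le_add ?_ le_rfl)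
    refine eLpNorm_le_mul_eLpNorm_of_ae_le_mul (ae_of_all _ fun x => ?_) 2
    rw [Pi.smul_apply', norm_smul]
    exact mul_le_mul_of_nonneg_right (hC _) (norm_nonneg _)

/-- A uniform Lipschitz bound lets the chain rule pass to pointwise limits by dominated convergence.
`Ψ'` is just the limit of the derivatives and need not be the derivative of `Ψ`;
`MemH1.grad_eq_zero` exploits exactly this. -/
theorem MemH1.comp_of_tendsto {f : R3 → ℝ} {g : R3 → R3} (h : MemH1 f g) {Φ : ℕ → ℝ → ℝ}
    {Ψ Ψ' : ℝ → ℝ} (hΦ : ∀ n, ContDiff ℝ 1 (Φ n)) (h0 : ∀ n, Φ n 0 = 0) {C : ℝ}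
    (hC : ∀ n s, |deriv (Φ n) s| ≤ C) (h1 : ∀ s, Tendsto (fun n => Φ n s) atTop (𝓝 (Ψ s)))
    (h2 : ∀ s, Tendsto (fun n => deriv (Φ n) s) atTop (𝓝 (Ψ' s))) :
    MemH1 (fun x => Ψ (f x)) (fun x => Ψ' (f x) • g x) := by
  have hn := fun n => h.comp (hΦ n) (h0 n) (hC n)
  have hb : ∀ n s, |Φ n s| ≤ C * |s| := fun n s => by
    simpa [h0] using abs_sub_le_of_abs_deriv_le (hΦ n) (hC n) s 0
  have hb' : ∀ s, |Ψ s| ≤ C * |s| := fun s => le_of_tendsto' (h1 s).abs fun n => hb n s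
  have hC' : ∀ s, |Ψ' s| ≤ C := fun s => le_of_tendsto' (h2 s).abs fun n => hC n s
  have m1 : AEStronglyMeasurable (fun x => Ψ (f x)) volume :=
    aestronglyMeasurable_of_tendsto_ae atTop (fun n => (hn n).memLp.1)
      (ae_of_all _ fun x => h1 (f x))
  have m2 : AEStronglyMeasurable (fun x => Ψ' (f x) • g x) volume :=
    aestronglyMeasurable_of_tendsto_ae atTop (fun n => (hn n).memLp_grad.1)
      (ae_of_all _ fun x => (h2 (f x)).smul_const (g x))
  have k1 : MemLp (fun x => Ψ (f x)) 2 volume :=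
    h.memLp.of_le_mul m1 (ae_of_all _ fun x => hb' (f x))
  have k2 : MemLp (fun x => Ψ' (f x) • g x) 2 volume :=
    h.memLp_grad.of_le_mul m2 (ae_of_all _ fun x => by
      rw [norm_smul]; gcongr; exact hC' _)
  refine ⟨k1, k2, isWeakGradient_of_tendsto (p := 2) (by norm_num) (fun n => (hn n).memLp)
    (fun n => (hn n).memLp_grad) k1 k2 (fun n => (hn n).weak) ?_ ?_⟩
  · refine tendsto_eLpNorm_two_of_dominated (b := fun x => (2 * C) * ‖f x‖)
      (fun n => (hn n).memLp.1.sub m1) (h.memLp.norm.const_mul _)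
      (fun n => ae_of_all _ fun x => ?_) (ae_of_all _ fun x => ?_)
    · refine (norm_sub_le _ _).trans ?_
      have h1 := hb n (f x)
      have h2 := hb' (f x)
      simp only [Real.norm_eq_abs]
      linarith
    · simpa using (h1 (f x)).sub_const (Ψ (f x))
  · refine tendsto_eLpNorm_two_of_dominated (b := fun x => (2 * C) * ‖g x‖)
      (fun n => (hn n).memLp_grad.1.sub m2) (h.memLp_grad.norm.const_mul _)
      (fun n => ae_of_all _ fun x => ?_) (ae_of_all _ fun x => ?_)
    · rw [← sub_smul, norm_smul]
      gcongr
      refine (norm_sub_le _ _).trans ?_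
      have h1 := hC n (f x)
      have h2 := hC' (f x)
      simp only [Real.norm_eq_abs]
      linarith
    · simpa using ((h2 (f x)).smul_const (g x)).sub_const (Ψ' (f x) • g x)

/-- Regularize `|s|` by `√(s² + ε²) - ε`, which vanishes at `0` and is `1`-Lipschitz. At `s = 0` the
limit derivative is `0`, in agreement with `0 / 0 = 0`. -/
theorem MemH1.abs {f : R3 → ℝ} {g : R3 → R3} (h : MemH1 f g) :
    MemH1 (fun x => |f x|) (fun x => (f x / |f x|) • g x) := by
  have hpos : ∀ n : ℕ, (0 : ℝ) < ((n : ℝ) + 1)⁻¹ := fun n => by positivity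
  have hlim : Tendsto (fun n : ℕ => ((n : ℝ) + 1)⁻¹) atTop (𝓝 0) := by
    simpa using tendsto_one_div_add_atTop_nhds_zero_nat (𝕜 := ℝ)
  have hp : ∀ (n : ℕ) (s : ℝ), 0 < s ^ 2 + (((n : ℝ) + 1)⁻¹) ^ 2 := fun n s => by
    have := hpos n
    positivity
  have hsq : ∀ s : ℝ, Tendsto (fun n : ℕ => √(s ^ 2 + (((n : ℝ) + 1)⁻¹) ^ 2)) atTop (𝓝 |s|) := by
    intro s
    have := ((hlim.pow 2).const_add (s ^ 2)).sqrt
    simpa [Real.sqrt_sq_eq_abs] using this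
  have hder : ∀ (n : ℕ) (s : ℝ), HasDerivAt (fun s => √(s ^ 2 + (((n : ℝ) + 1)⁻¹) ^ 2)
      - ((n : ℝ) + 1)⁻¹) (s / √(s ^ 2 + (((n : ℝ) + 1)⁻¹) ^ 2)) s := by
    intro n s
    have := ((((hasDerivAt_id s).pow 2).add_const ((((n : ℝ) + 1)⁻¹) ^ 2)).sqrt
      (hp n s).ne').sub_const ((n : ℝ) + 1)⁻¹
    convert! this using 1
    simp
    field_simp
  refine h.comp_of_tendsto (Φ := fun n s => √(s ^ 2 + (((n : ℝ) + 1)⁻¹) ^ 2) - ((n : ℝ) + 1)⁻¹)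
    (Ψ := fun s => |s|) (Ψ' := fun s => s / |s|) (C := 1) (fun n => ?_) (fun n => ?_)
    (fun n s => ?_) (fun s => ?_) (fun s => ?_)
  · refine ContDiff.sub (ContDiff.sqrt (by fun_prop) fun s => (hp n s).ne') contDiff_const
  · rw [zero_pow two_ne_zero, zero_add, Real.sqrt_sq (hpos n).le, sub_self]
  · rw [(hder n s).deriv, abs_div, abs_of_nonneg (Real.sqrt_nonneg _)]
    refine div_le_one_of_le₀ (Real.abs_le_sqrt ?_) (Real.sqrt_nonneg _)
    nlinarith [hpos n]
  · simpa using (hsq s).sub hlim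
  · simp_rw [fun n => (hder n s).deriv]
    rcases eq_or_ne s 0 with rfl | hs
    · simp
    · exact tendsto_const_nhds.div (hsq s) (abs_ne_zero.2 hs)

/-- The functions `arctan(ns)/n` tend to `0` while their derivatives tend to the indicator of `{0}`.
In the limit, `g` restricted to `{f = 0}` is a weak gradient of the zero function. -/
theorem MemH1.grad_eq_zero {f : R3 → ℝ} {g : R3 → R3} (h : MemH1 f g) :
    ∀ᵐ x, f x = 0 → g x = 0 := by
  have hpos : ∀ n : ℕ, (0 : ℝ) < (n : ℝ) + 1 := fun n => by positivity
  have hlim : Tendsto (fun n : ℕ => ((n : ℝ) + 1)⁻¹) atTop (𝓝 0) := by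
    simpa using tendsto_one_div_add_atTop_nhds_zero_nat (𝕜 := ℝ)
  have hder : ∀ (n : ℕ) (s : ℝ), HasDerivAt (fun s => ((n : ℝ) + 1)⁻¹ * Real.arctan (((n : ℝ) + 1)
      * s)) (1 / (1 + (((n : ℝ) + 1) * s) ^ 2)) s := by
    intro n s
    have := (((hasDerivAt_id s).const_mul ((n : ℝ) + 1)).arctan).const_mul ((n : ℝ) + 1)⁻¹
    convert! this using 1
    have := hpos n
    simp
    field_simp
  have key : MemH1 (fun x => (0 : ℝ)) (fun x => (if f x = 0 then (1 : ℝ) else 0) • g x) := by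
    refine h.comp_of_tendsto (Φ := fun n s => ((n : ℝ) + 1)⁻¹ * Real.arctan (((n : ℝ) + 1) * s))
      (Ψ := fun _ => 0) (Ψ' := fun s => if s = 0 then 1 else 0) (C := 1) (fun n => ?_) (fun n => ?_)
      (fun n s => ?_) (fun s => ?_) (fun s => ?_)
    · exact contDiff_const.mul (Real.contDiff_arctan.comp (contDiff_const.mul contDiff_id))
    · simp
    · rw [(hder n s).deriv, abs_of_nonneg (by positivity)]
      exact div_le_one_of_le₀ (by nlinarith [sq_nonneg (((n : ℝ) + 1) * s)]) (by positivity)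
    · refine squeeze_zero_norm (a := fun n : ℕ => ((n : ℝ) + 1)⁻¹ * (Real.pi / 2)) (fun n => ?_)
        (by simpa using hlim.mul_const (Real.pi / 2))
      rw [norm_mul, Real.norm_of_nonneg (inv_nonneg.2 (hpos n).le)]
      gcongr
      exact abs_le.2 ⟨(Real.neg_pi_div_two_lt_arctan _).le, (Real.arctan_lt_pi_div_two _).le⟩
    · simp_rw [fun n => (hder n s).deriv]
      rcases eq_or_ne s 0 with rfl | hs
      · simp
      · rw [if_neg hs]
        have t : Tendsto (fun n : ℕ => 1 + (((n : ℝ) + 1) * s) ^ 2) atTop atTop := by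
          refine tendsto_atTop_add_const_left _ _ ?_
          simp_rw [mul_pow]
          refine Tendsto.atTop_mul_const (by positivity) ?_
          exact (tendsto_pow_atTop two_ne_zero).comp
            (tendsto_atTop_add_const_right _ 1 tendsto_natCast_atTop_atTop)
        simpa [one_div, Pi.inv_def] using t.inv_tendsto_atTop
  have h0 : MemH1 (fun _ => (0 : ℝ)) (fun _ => (0 : R3)) := by
    have := h.linear_comb h 0 0
    simpa using this
  filter_upwards [key.weak.ae_eq h0.weak] with x hx h
  simpa [h] using hx

/-! ### Rigidity of continuous curves in `H¹` with constant square. -/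

/-- Cauchy–Schwarz for `|f| · |f|³`. The third power of the `L⁶` norm will leave, after Sobolev, two
powers of the gradient to sum and one to bound. -/
theorem lintegral_pow_four_le {α : Type*} [MeasurableSpace α] {μ : Measure α} {f : α → ℝ}
    (hf : AEStronglyMeasurable f μ) :
    ∫⁻ x, ‖f x‖ₑ ^ 4 ∂μ ≤ eLpNorm f 2 μ * eLpNorm f 6 μ ^ 3 := by
  have h := ENNReal.lintegral_mul_le_Lp_mul_Lq μ Real.HolderConjugate.two_two
    hf.enorm (hf.enorm.pow_const 3)
  have e6 : eLpNorm f 6 μ ^ 6 = ∫⁻ x, ‖f x‖ₑ ^ 6 ∂μ := by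
    simpa using eLpNorm_nnreal_pow_eq_lintegral (μ := μ) (f := f) (p := 6) (by norm_num)
  have s1 : (∫⁻ x, ‖f x‖ₑ ^ (2 : ℝ) ∂μ) ^ (1 / 2 : ℝ) = eLpNorm f 2 μ := by
    simp_rw [ENNReal.rpow_ofNat, ← eLpNorm_two_sq]
    rw [← ENNReal.rpow_natCast, ← ENNReal.rpow_mul]; norm_num
  have s2 : (∫⁻ x, (‖f x‖ₑ ^ 3) ^ (2 : ℝ) ∂μ) ^ (1 / 2 : ℝ) = eLpNorm f 6 μ ^ 3 := by
    simp_rw [ENNReal.rpow_ofNat, ← pow_mul]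
    norm_num only
    rw [← e6, ← ENNReal.rpow_natCast, ← ENNReal.rpow_mul, ← ENNReal.rpow_natCast]; norm_num
  rw [s1, s2] at h
  refine le_of_eq_of_le (lintegral_congr fun x => ?_) h
  simp only [Pi.mul_apply]
  ring

/-- The running maximum of `½|uᵢ - u₀|`. -/
def flipMax (u : ℕ → R3 → ℝ) : ℕ → R3 → ℝ
  | 0 => fun _ => 0
  | i + 1 => fun x => max (flipMax u i x) (|u (i + 1) x - u 0 x| / 2)

theorem flip_eq {a b : ℝ} (h : a ^ 2 = b ^ 2) : |a - b| / 2 = 0 ∨ |a - b| / 2 = |b| := by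
  rcases sq_eq_sq_iff_eq_or_eq_neg.1 h with rfl | rfl
  · left; simp
  · right
    rw [show -b - b = -(2 * b) by ring, abs_neg, abs_mul]; norm_num

/-- As `uᵢ = ±u₀`, the quantity `½|uᵢ - u₀|` is `|u₀|` where the sign is flipped and `0` elsewhere.
So `flipMax` is `|u₀|` on the points flipped at least once so far, and it lies in `H¹` because it is
built from absolute values and maxima. -/
theorem flipMax_eq {u : ℕ → R3 → ℝ} {x : R3} (h : ∀ i, u i x ^ 2 = u 0 x ^ 2) (i : ℕ) :
    flipMax u i x = 0 ∨ flipMax u i x = |u 0 x| := by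
  induction i with
  | zero => left; rfl
  | succ i ih =>
    have h1 := flip_eq (h (i + 1))
    simp only [flipMax]
    rcases max_choice (flipMax u i x) (|u (i + 1) x - u 0 x| / 2) with e | e <;> rw [e]
    · exact ih
    · exact h1

theorem flip_le_flipMax (u : ℕ → R3 → ℝ) (i : ℕ) (x : R3) :
    |u i x - u 0 x| / 2 ≤ flipMax u i x := by
  cases i with
  | zero => simp [flipMax]
  | succ i => exact le_max_right _ _

/-- A point counted for the first time at step `i + 1` still has `uᵢ = u₀`, so the flip is visible
as a jump of size `2|u₀|` in that very step. This lets the `L²` size of one step control the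
increment. -/
theorem flipMax_sub_eq {u : ℕ → R3 → ℝ} {x : R3} (h : ∀ i, u i x ^ 2 = u 0 x ^ 2) (i : ℕ) :
    flipMax u (i + 1) x - flipMax u i x = 0 ∨
      (flipMax u i x = 0 ∧ flipMax u (i + 1) x = |u 0 x| ∧ |u 0 x| ≤ |u (i + 1) x - u i x|) := by
  rcases flipMax_eq h i with h0 | h0
  · rcases flipMax_eq h (i + 1) with h1 | h1
    · left; rw [h0, h1, sub_self]
    · right
      refine ⟨h0, h1, ?_⟩
      have h2 := flip_le_flipMax u i x
      have h3 : u i x = u 0 x := by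
        have : |u i x - u 0 x| = 0 := le_antisymm (by linarith) (abs_nonneg _)
        linarith [abs_eq_zero.1 this]
      rw [h3]
      simp only [flipMax, h0] at h1
      rcases flip_eq (h (i + 1)) with h4 | h4
      · rw [h4] at h1
        rw [← h1]; simp
      · linarith [abs_nonneg (u 0 x)]
  · left
    have h1 : flipMax u (i + 1) x ≤ |u 0 x| := by
      rcases flipMax_eq h (i + 1) with h1 | h1 <;> rw [h1]
      exact abs_nonneg _
    have h2 : flipMax u i x ≤ flipMax u (i + 1) x := le_max_left _ _
    linarith

theorem max_eq_half_add_add_abs_sub (a b : ℝ) :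
    max a b = 1 / 2 * (a + b) + 1 / 2 * |a - b| := by
  rcases le_total a b with h | h
  · rw [max_eq_right h, abs_of_nonpos (by linarith)]; ring
  · rw [max_eq_left h, abs_of_nonneg (by linarith)]; ring

theorem MemH1.max {f f' : R3 → ℝ} {g g' : R3 → R3} (h : MemH1 f g) (h' : MemH1 f' g') :
    ∃ G, MemH1 (fun x => max (f x) (f' x)) G := by
  refine ⟨_, ((h.linear_comb h' 1 1).linear_comb (h.linear_comb h' 1 (-1)).abs (1 / 2)
    (1 / 2)).congr (ae_of_all _ fun x => ?_) EventuallyEq.rfl⟩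
  have h := max_eq_half_add_add_abs_sub (f x) (f' x)
  simp only [one_mul, neg_one_mul, ← sub_eq_add_neg]
  rw [h]

theorem MemH1.exists_flipMax {u : ℕ → R3 → ℝ} {g : ℕ → R3 → R3} (h : ∀ i, MemH1 (u i) (g i))
    (i : ℕ) : ∃ G, MemH1 (flipMax u i) G := by
  induction i with
  | zero =>
    have := (h 0).linear_comb (h 0) 0 0
    simp only [zero_mul, add_zero] at this
    exact ⟨_, this⟩
  | succ i ih =>
    obtain ⟨G, hG⟩ := ih
    have h1 := ((h (i + 1)).linear_comb (h 0) 1 (-1)).abs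
    obtain ⟨G', hG'⟩ := hG.max (h1.linear_comb h1 (1 / 2) 0)
    refine ⟨G', hG'.congr (ae_of_all _ fun x => ?_) EventuallyEq.rfl⟩
    simp only [flipMax]
    congr 1
    rw [zero_mul, add_zero, one_mul, neg_one_mul, ← sub_eq_add_neg]
    ring

/-- The bound does not depend on the number `N` of steps: the increments of `flipMax` have disjoint
supports, so their squared gradients sum to at most that of `u 0`. -/
theorem lintegral_flip_pow_four_le {u : ℕ → R3 → ℝ} {g : ℕ → R3 → R3}
    (h : ∀ i, MemH1 (u i) (g i)) (hsq : ∀ i, ∀ᵐ x, u i x ^ 2 = u 0 x ^ 2) {N : ℕ} {ε : ENNReal}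
    (hε : ∀ i < N, eLpNorm (fun x => u (i + 1) x - u i x) 2 volume ≤ ε) :
    ∫⁻ x, ‖(u N x - u 0 x) / 2‖ₑ ^ 4 ≤ ε * (sobolevConst * eLpNorm (g 0) 2 volume) ^ 3 := by
  choose B hB using MemH1.exists_flipMax h
  set b := flipMax u with hb
  have hg := (h 0).abs
  set D : R3 → R3 := fun x => (u 0 x / |u 0 x|) • g 0 x with hD
  have hDg : ∀ x, ‖D x‖ ≤ ‖g 0 x‖ := fun x => by
    rw [hD, norm_smul, norm_div, Real.norm_eq_abs, Real.norm_eq_abs, abs_abs]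
    exact mul_le_of_le_one_left (norm_nonneg _) (div_self_le_one _)
  let w : ℕ → R3 → ℝ := fun i x => b (i + 1) x - b i x
  let G : ℕ → R3 → R3 := fun i x => B (i + 1) x - B i x
  have hw : ∀ i, MemH1 (w i) (G i) := fun i =>
    ((hB (i + 1)).linear_comb (hB i) 1 (-1)).congr (ae_of_all _ fun x => by simp [w, sub_eq_add_neg])
      (ae_of_all _ fun x => by simp [G, sub_eq_add_neg])
  have hsq' : ∀ᵐ x, ∀ i, u i x ^ 2 = u 0 x ^ 2 := ae_all_iff.2 hsq
  have hw0 : ∀ᵐ x, ∀ i, w i x = 0 → G i x = 0 := ae_all_iff.2 fun i => (hw i).grad_eq_zero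
  -- `MemH1.grad_eq_zero` applied to `w i - |u 0|` identifies the gradient of the increment on its
  -- support.
  have hwD : ∀ᵐ x, ∀ i, w i x = |u 0 x| → G i x = D x := ae_all_iff.2 fun i => by
    filter_upwards [((hw i).linear_comb hg 1 (-1)).grad_eq_zero] with x hx h
    have := hx (by simp [h])
    rwa [one_smul, neg_one_smul, ← sub_eq_add_neg, sub_eq_zero] at this
  -- each increment
  have hstep : ∀ i < N, ∫⁻ x, ‖w i x‖ₑ ^ 4 ≤
      ε * (sobolevConst ^ 3 * eLpNorm (g 0) 2 volume) * ∫⁻ x, ‖G i x‖ₑ ^ 2 := by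
    intro i hi
    have h2 : eLpNorm (w i) 2 volume ≤ ε := by
      refine le_trans (eLpNorm_mono_ae ?_) (hε i hi)
      filter_upwards [hsq'] with x hx
      rcases flipMax_sub_eq hx i with h0 | ⟨h0, h1, h2⟩
      · simp only [w, b, h0]; simp
      · simp only [w, b, h0, h1, sub_zero, Real.norm_eq_abs, abs_abs]
        exact h2
    have hGD : eLpNorm (G i) 2 volume ≤ eLpNorm (g 0) 2 volume := by
      refine eLpNorm_mono_ae ?_
      filter_upwards [hsq', hw0, hwD] with x hx h0 hD
      rcases flipMax_sub_eq hx i with h1 | ⟨h1, h2, h3⟩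
      · rw [h0 i h1]; simp
      · rw [hD i (by simp only [w, b, h1, h2, sub_zero])]
        exact hDg x
    calc _ ≤ eLpNorm (w i) 2 volume * eLpNorm (w i) 6 volume ^ 3 :=
          lintegral_pow_four_le (hw i).memLp.1
      _ ≤ ε * (sobolevConst * eLpNorm (G i) 2 volume) ^ 3 := by
          gcongr
          exact (hw i).eLpNorm_six_le
      -- One factor `‖G i‖` is bounded by `‖g 0‖`; the square of the other two is kept because it is
      -- additive over disjoint supports.
      _ = ε * (sobolevConst ^ 3 * eLpNorm (G i) 2 volume) * eLpNorm (G i) 2 volume ^ 2 := by ring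
      _ ≤ _ := by
          rw [eLpNorm_two_sq]
          gcongr
  -- the increments have disjoint supports
  have hsum : ∀ᵐ x, ∀ n, ‖b n x‖ₑ ^ 4 ≤ ∑ i ∈ Finset.range n, ‖w i x‖ₑ ^ 4 := by
    filter_upwards [hsq'] with x hx n
    induction n with
    | zero => simp [b, flipMax]
    | succ n ih =>
      rw [Finset.sum_range_succ]
      rcases flipMax_sub_eq hx n with h0 | ⟨h0, h1, h2⟩
      · have : b (n + 1) x = b n x := by simp only [b]; linarith
        rw [this]
        exact ih.trans le_self_add
      · have : b (n + 1) x = w n x := by simp only [w, b, h0, sub_zero]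
        rw [this]
        exact le_add_self
  -- The case distinction carries the disjointness through the induction: where `b n` still vanishes
  -- no earlier gradient has contributed.
  have hsumG : ∀ᵐ x, ∀ n, ∑ i ∈ Finset.range n, ‖G i x‖ₑ ^ 2 ≤
      if b n x = 0 then 0 else ‖g 0 x‖ₑ ^ 2 := by
    filter_upwards [hsq', hw0, hwD] with x hx h0 hD n
    induction n with
    | zero => simp
    | succ n ih =>
      rw [Finset.sum_range_succ]
      rcases flipMax_sub_eq hx n with h1 | ⟨h1, h2, h3⟩
      · have : b (n + 1) x = b n x := by simp only [b]; linarith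
        rw [this, h0 n h1]
        simpa using ih
      · rw [if_pos h1] at ih
        have ih' := le_antisymm ih zero_le
        rw [ih', zero_add]
        have hwn : w n x = |u 0 x| := by simp only [w, b, h1, h2, sub_zero]
        -- The first case is degenerate: `b (n + 1) x = 0` although the point counts as flipped,
        -- which means `u 0 x = 0`.
        split_ifs with h4
        · have : w n x = 0 := by simp only [w, b] at h4 ⊢; rw [h4, h1, sub_zero]
          rw [h0 n this]; simp
        · rw [hD n hwn]
          have := enorm_le_iff_norm_le.2 (hDg x)
          gcongr
  calc ∫⁻ x, ‖(u N x - u 0 x) / 2‖ₑ ^ 4 ≤ ∫⁻ x, ∑ i ∈ Finset.range N, ‖w i x‖ₑ ^ 4 := by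
        refine lintegral_mono_ae ?_
        filter_upwards [hsum] with x hx
        refine le_trans ?_ (hx N)
        have : ‖(u N x - u 0 x) / 2‖ₑ ≤ ‖b N x‖ₑ := by
          rw [enorm_le_iff_norm_le, norm_div, Real.norm_two, Real.norm_eq_abs]
          exact (flip_le_flipMax u N x).trans (le_abs_self _)
        gcongr
    _ = ∑ i ∈ Finset.range N, ∫⁻ x, ‖w i x‖ₑ ^ 4 :=
        lintegral_finsetSum' _ fun i _ => (hw i).memLp.1.enorm.pow_const 4
    _ ≤ ∑ i ∈ Finset.range N,
          ε * (sobolevConst ^ 3 * eLpNorm (g 0) 2 volume) * ∫⁻ x, ‖G i x‖ₑ ^ 2 :=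
        Finset.sum_le_sum fun i hi => hstep i (Finset.mem_range.1 hi)
    _ = ε * (sobolevConst ^ 3 * eLpNorm (g 0) 2 volume) *
          ∫⁻ x, ∑ i ∈ Finset.range N, ‖G i x‖ₑ ^ 2 := by
        rw [lintegral_finsetSum' _ fun i _ => (hw i).memLp_grad.1.enorm.pow_const 2,
          Finset.mul_sum]
    _ ≤ ε * (sobolevConst ^ 3 * eLpNorm (g 0) 2 volume) * ∫⁻ x, ‖g 0 x‖ₑ ^ 2 := by
        refine mul_le_mul_right (lintegral_mono_ae ?_) _
        filter_upwards [hsumG] with x hx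
        refine (hx N).trans ?_
        split_ifs <;> simp
    _ = _ := by rw [← eLpNorm_two_sq]; ring

theorem ae_eq_of_continuous_of_sq_eq {u : ℝ → R3 → ℝ} {g : ℝ → R3 → R3}
    (h : ∀ t, MemH1 (u t) (g t)) (hsq : ∀ t, ∀ᵐ x, u t x ^ 2 = u 0 x ^ 2)
    (hc : ∀ t₀, Tendsto (fun t => eLpNorm (fun x => u t x - u t₀ x) 2 volume) (𝓝 t₀) (𝓝 0))
    (T : ℝ) : u T =ᵐ[volume] u 0 := by
  have : Fact ((1 : ENNReal) ≤ 2) := ⟨by norm_num⟩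
  -- The time interval is rescaled to `[0,1]`, which treats both signs of `T` at once; compactness
  -- there gives one step length for each `ε`.
  let v : ℝ → Lp ℝ 2 (volume : Measure R3) := fun s => (h (s * T)).memLp.toLp
  have hv : Continuous v := by
    rw [continuous_iff_continuousAt]
    intro s
    have h1 := (hc (s * T)).comp ((continuous_mul_const T).tendsto s)
    rw [ContinuousAt, tendsto_iff_edist_tendsto_0]
    refine h1.congr fun t => ?_
    rw [Lp.edist_toLp_toLp]; rfl
  have hu := (isCompact_Icc (a := (0 : ℝ)) (b := 1)).uniformContinuousOn_of_continuous
    hv.continuousOn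
  have key : ∫⁻ x, ‖(u T x - u 0 x) / 2‖ₑ ^ 4 = 0 := by
    set K : ENNReal := (sobolevConst * eLpNorm (g 0) 2 volume) ^ 3
    have hK : K ≠ ⊤ := ENNReal.pow_ne_top (ENNReal.mul_ne_top ENNReal.coe_ne_top
      (h 0).memLp_grad.2.ne)
    have hle : ∀ ε : ENNReal, 0 < ε → ∫⁻ x, ‖(u T x - u 0 x) / 2‖ₑ ^ 4 ≤ ε * K := by
      intro ε hε
      obtain ⟨δ, hδ, hd⟩ := EMetric.uniformContinuousOn_iff.1 hu ε hε
      obtain ⟨N, hN⟩ := ENNReal.exists_inv_nat_lt hδ.ne'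
      have hN0 : 0 < N + 1 := Nat.succ_pos N
      have hNr : (0 : ℝ) < ((N + 1 : ℕ) : ℝ) := Nat.cast_pos.2 hN0
      have := lintegral_flip_pow_four_le (u := fun i => u ((i / ((N + 1 : ℕ) : ℝ)) * T))
        (g := fun i => g ((i / ((N + 1 : ℕ) : ℝ)) * T)) (fun i => h _)
        (fun i => by simpa using hsq _) (N := N + 1) (ε := ε) (fun i hi => ?_)
      · simp only [div_self hNr.ne', Nat.cast_zero, zero_div, zero_mul, one_mul] at this
        exact this
      · have hi' : ((i : ℝ) + 1) ≤ ((N + 1 : ℕ) : ℝ) := by exact_mod_cast hi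
        have hi0 : (0 : ℝ) ≤ i := Nat.cast_nonneg i
        have := hd (a := ((i + 1 : ℕ) : ℝ) / ((N + 1 : ℕ) : ℝ)) ⟨by positivity, by
          rw [div_le_one hNr]; push_cast at *; exact hi'⟩ (b := (i : ℝ) / ((N + 1 : ℕ) : ℝ))
          ⟨by positivity, by rw [div_le_one hNr]; linarith⟩ ?_
        · rw [Lp.edist_toLp_toLp] at this
          exact this.le
        · refine lt_of_le_of_lt ?_ hN
          rw [edist_dist, Real.dist_eq, ← sub_div]
          have e : (((i + 1 : ℕ) : ℝ) - i) = 1 := by push_cast; ring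
          rw [e, abs_of_pos (by positivity), one_div, ENNReal.ofReal_inv_of_pos hNr,
            ENNReal.ofReal_natCast]
          gcongr
          exact Nat.le_succ N
    by_contra hne
    have hpos := pos_iff_ne_zero.2 hne
    have h1 := hle 1 one_pos
    have hfin : ∫⁻ x, ‖(u T x - u 0 x) / 2‖ₑ ^ 4 ≠ ⊤ := ne_top_of_le_ne_top (by simpa using hK) h1
    -- With `I` the integral, this `ε = I / (2(K + 1))` gives `I ≤ I / 2`, impossible for `0 < I <
    -- ⊤`.
    have h2 := hle ((∫⁻ x, ‖(u T x - u 0 x) / 2‖ₑ ^ 4) / (2 * (K + 1)))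
      (ENNReal.div_pos hne (by finiteness))
    have h3 : (∫⁻ x, ‖(u T x - u 0 x) / 2‖ₑ ^ 4) / (2 * (K + 1)) * K
        ≤ (∫⁻ x, ‖(u T x - u 0 x) / 2‖ₑ ^ 4) / 2 := by
      rw [ENNReal.div_eq_inv_mul, ENNReal.div_eq_inv_mul, ENNReal.mul_inv (by simp) (by simp)]
      calc _ = (2⁻¹ * ∫⁻ x, ‖(u T x - u 0 x) / 2‖ₑ ^ 4) * ((K + 1)⁻¹ * K) := by ring
        _ ≤ (2⁻¹ * ∫⁻ x, ‖(u T x - u 0 x) / 2‖ₑ ^ 4) * ((K + 1)⁻¹ * (K + 1)) := by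
            gcongr; exact le_self_add
        _ = _ := by rw [ENNReal.inv_mul_cancel (by simp) (by finiteness), mul_one]
    exact absurd (h2.trans h3) (not_le.2 (ENNReal.half_lt_self hne hfin))
  have hm : AEMeasurable (fun x => ‖(u T x - u 0 x) / 2‖ₑ ^ 4) volume :=
    (((h T).memLp.1.aemeasurable.sub (h 0).memLp.1.aemeasurable).div_const 2).enorm.pow_const 4
  rw [lintegral_eq_zero_iff' hm] at key
  filter_upwards [key] with x hx
  simp only [Pi.zero_apply, ne_eq, OfNat.ofNat_ne_zero, not_false_eq_true, pow_eq_zero_iff,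
    enorm_eq_zero] at hx
  linarith

/-! ### Growth of `W` and finiteness of the energy. -/

theorem rpow_le_add_pow_five {s a : ℝ} (hs : 0 ≤ s) (h1 : 1 < a) (h5 : a < 5) :
    s ^ a ≤ s + s ^ 5 := by
  rcases le_total s 1 with h | h
  · rcases hs.eq_or_lt with rfl | hs'
    · rw [Real.zero_rpow (by linarith)]; norm_num
    · have := Real.rpow_le_rpow_of_exponent_ge hs' h h1.le
      rw [Real.rpow_one] at this
      have : 0 ≤ s ^ 5 := by positivity
      linarith
  · have := Real.rpow_le_rpow_of_exponent_le h h5.le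
    rw [show (5 : ℝ) = ((5 : ℕ) : ℝ) by norm_num, Real.rpow_natCast] at this
    linarith

section Nonlinearity

variable {V : R3 → ℝ} {W : ℝ → ℝ} {E₀ : ℝ}

theorem Nonlinearity.contDiff_one (hW : Nonlinearity V W E₀) : ContDiff ℝ 1 W :=
  hW.smooth.of_le (by norm_num)

theorem Nonlinearity.hasDerivAt (hW : Nonlinearity V W E₀) (s : ℝ) :
    HasDerivAt W (deriv W s) s :=
  (hW.contDiff_one.differentiable (by simp) s).hasDerivAt

theorem Nonlinearity.continuous_deriv (hW : Nonlinearity V W E₀) : Continuous (deriv W) :=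
  hW.contDiff_one.continuous_deriv (by simp)

theorem Nonlinearity.continuous (hW : Nonlinearity V W E₀) : Continuous W :=
  hW.contDiff_one.continuous

/-- The exponents `r - 1` and `l - 1` lie in `(1, 5)`, and the quadratic part `E₀ s²` contributes
the linear term. Negative `s` are covered because `W'` is odd. -/
theorem Nonlinearity.deriv_bound (hW : Nonlinearity V W E₀) :
    ∃ C : ℝ, 0 ≤ C ∧ ∀ s, |deriv W s| ≤ C * (|s| + |s| ^ 5) := by
  obtain ⟨r, hr, l, hl, c₁, c₂, h⟩ := hW.growth
  have hE := hW.E₀_pos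
  have hpos : ∀ s : ℝ, 0 ≤ s → |deriv W s| ≤ (2 * E₀ + |c₁| + |c₂|) * (s + s ^ 5) := by
    intro s hs
    have hd : deriv (nonlin W E₀) s = deriv W s - 2 * E₀ * s := by
      have h1 : HasDerivAt (nonlin W E₀) (deriv W s - E₀ * (2 * s)) s := by
        have := (hW.hasDerivAt s).fun_sub ((hasDerivAt_pow 2 s).const_mul E₀)
        exact this.congr_deriv (by simp)
      rw [h1.deriv]; ring
    have h1 := h s hs
    rw [hd] at h1
    have h2 := rpow_le_add_pow_five hs (a := r - 1) (by linarith [hr.1]) (by linarith [hr.2])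
    have h3 := rpow_le_add_pow_five hs (a := l - 1) (by linarith [hl.1]) (by linarith [hl.2])
    have p1 := Real.rpow_nonneg hs (r - 1)
    have p2 := Real.rpow_nonneg hs (l - 1)
    have h4 : c₁ * s ^ (r - 1) ≤ |c₁| * (s + s ^ 5) :=
      mul_le_mul (le_abs_self _) h2 p1 (abs_nonneg _)
    have h5 : c₂ * s ^ (l - 1) ≤ |c₂| * (s + s ^ 5) :=
      mul_le_mul (le_abs_self _) h3 p2 (abs_nonneg _)
    have h6 : 0 ≤ E₀ * s ^ 5 := by positivity
    have h7 : 0 ≤ E₀ * s := by positivity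
    rw [abs_le] at h1 ⊢
    constructor <;> nlinarith
  refine ⟨2 * E₀ + |c₁| + |c₂|, by positivity, fun s => ?_⟩
  rcases le_total 0 s with hs | hs
  · rw [abs_of_nonneg hs]; exact hpos s hs
  · have h1 := hpos (-s) (by linarith)
    have h2 : deriv W s = -deriv W (-s) := by
      have := deriv_comp_neg (f := W) s
      rw [← this]
      congr 1
      ext x
      exact (hW.even x).symm
    rw [abs_of_nonpos hs, h2, abs_neg]
    exact h1

/-- The powers `2` and `6` are those that `H¹ ⊂ L² ∩ L⁶` makes integrable. -/
theorem Nonlinearity.bound (hW : Nonlinearity V W E₀) :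
    ∃ C : ℝ, 0 ≤ C ∧ ∀ s, |W s| ≤ C * (s ^ 2 + s ^ 6) := by
  obtain ⟨C, hC, h⟩ := hW.deriv_bound
  refine ⟨C, hC, fun s => ?_⟩
  have h1 := (convex_Icc (-|s|) |s|).norm_image_sub_le_of_norm_deriv_le (f := W)
    (C := C * (|s| + |s| ^ 5)) (fun x _ => (hW.hasDerivAt x).differentiableAt) (fun x hx => ?_)
    (x := 0) (y := s) (by simp) ⟨neg_abs_le s, le_abs_self s⟩
  · rw [hW.zero, sub_zero, sub_zero] at h1
    refine h1.trans (le_of_eq ?_)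
    rw [Real.norm_eq_abs, ← sq_abs s, show s ^ 6 = (s ^ 2) ^ 3 by ring, ← sq_abs s]
    ring
  · have hx' : |x| ≤ |s| := abs_le.2 hx
    refine (h x).trans ?_
    gcongr

end Nonlinearity

theorem LatticePotential.exists_bound {V : R3 → ℝ} {W : ℝ → ℝ} {E₀ : ℝ}
    (hV : LatticePotential V) (hW : Nonlinearity V W E₀) : ∃ M : ℝ, ∀ x, ‖V x‖ ≤ M := by
  obtain ⟨V₀, h, -⟩ := hW.negative
  exact ⟨V₀, fun x => by rw [Real.norm_of_nonneg (hV.nonneg x)]; exact h.2 ⟨x, rfl⟩⟩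

theorem LatticePotential.memLp_mul {V : R3 → ℝ} {W : ℝ → ℝ} {E₀ : ℝ}
    (hV : LatticePotential V) (hW : Nonlinearity V W E₀) {f : R3 → ℝ} (hf : MemLp f 2 volume) :
    MemLp (fun x => V x * f x) 2 volume := by
  obtain ⟨M, hM⟩ := hV.exists_bound hW
  refine hf.of_le_mul (c := M) (hV.cont.aestronglyMeasurable.mul hf.1) (ae_of_all _ fun x => ?_)
  rw [norm_mul]
  gcongr
  exact hM x

theorem _root_.MeasureTheory.MemLp.integrable_sq_add_pow_six {f : R3 → ℝ} (h2 : MemLp f 2 volume)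
    (h6 : MemLp f 6 volume) : Integrable (fun x => f x ^ 2 + f x ^ 6) := by
  have i2 : Integrable (fun x => ‖f x‖ ^ 2) := h2.integrable_norm_pow (p := 2) (by norm_num)
  have i6 : Integrable (fun x => ‖f x‖ ^ 6) := h6.integrable_norm_pow (p := 6) (by norm_num)
  refine (i2.add i6).congr (ae_of_all _ fun x => ?_)
  simp only [Pi.add_apply, Real.norm_eq_abs]
  rw [sq_abs, Even.pow_abs (by decide)]

theorem Nonlinearity.integrable_comp {V : R3 → ℝ} {W : ℝ → ℝ} {E₀ : ℝ}
    (hW : Nonlinearity V W E₀) {f : R3 → ℝ} (h2 : MemLp f 2 volume)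
    (h6 : MemLp f 6 volume) : Integrable (fun x => W (f x)) := by
  obtain ⟨C, hC, h⟩ := hW.bound
  exact ((h2.integrable_sq_add_pow_six h6).const_mul C).mono'
    (hW.continuous.comp_aestronglyMeasurable h2.1) (ae_of_all _ fun x => h (f x))

theorem integral_norm_sq_eq {α E : Type*} [MeasurableSpace α] {μ : Measure α}
    [NormedAddCommGroup E] [InnerProductSpace ℝ E] (f : Lp E 2 μ) :
    ∫ x, ‖f x‖ ^ 2 ∂μ = ‖f‖ ^ 2 := by
  rw [← real_inner_self_eq_norm_sq f, L2.inner_def]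
  simp_rw [real_inner_self_eq_norm_sq]

theorem integral_sq_eq {α : Type*} [MeasurableSpace α] {μ : Measure α} (f : Lp ℝ 2 μ) :
    ∫ x, f x ^ 2 ∂μ = ‖f‖ ^ 2 := by
  rw [← integral_norm_sq_eq]
  simp

theorem charge_eq (Y : Fields) : charge Y = ‖Y.u‖ ^ 2 := integral_sq_eq Y.u

theorem memH1_of_isWeakGradient {u : Lp ℝ 2 (volume : Measure R3)}
    {Du : Lp R3 2 (volume : Measure R3)} (h : IsWeakGradient u Du) : MemH1 u Du :=
  ⟨Lp.memLp u, Lp.memLp Du, h⟩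

theorem memH1_of_mem_X {q : ℝ} {Y : Fields} (h : Y ∈ X q) : MemH1 Y.u Y.Du :=
  memH1_of_isWeakGradient h.1

theorem energy_eq {V : R3 → ℝ} {W : ℝ → ℝ} {E₀ : ℝ} (hV : LatticePotential V)
    (hW : Nonlinearity V W E₀) {Y : Fields} (hY : MemH1 Y.u Y.Du) :
    energy V W Y = 1 / 2 * ‖Y.Du‖ ^ 2 + (∫ x, V x * Y.u x ^ 2) + (∫ x, W (Y.u x))
      + 1 / 2 * (‖Y.Θ‖ ^ 2 + ‖Y.elec‖ ^ 2 + ‖Y.mag‖ ^ 2) := by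
  have hn : ∀ f : Lp R3 2 (volume : Measure R3), Integrable (fun x => ‖f x‖ ^ 2) := fun f =>
    (Lp.memLp f).integrable_norm_pow (p := 2) (by norm_num)
  have iV : Integrable (fun x => V x * Y.u x ^ 2) := by
    have := MemLp.integrable_mul (hV.memLp_mul hW hY.memLp) hY.memLp
    refine this.congr (ae_of_all _ fun x => ?_)
    simp only [Pi.mul_apply]; ring
  have iW := hW.integrable_comp hY.memLp hY.memLp_six
  have i1 : Integrable (fun x => 1 / 2 * ‖Y.Du x‖ ^ 2) := (hn Y.Du).const_mul (1 / 2)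
  have i2 : Integrable (fun x => 1 / 2 * ‖Y.Du x‖ ^ 2 + V x * Y.u x ^ 2) := i1.add iV
  have i3 : Integrable (fun x => 1 / 2 * ‖Y.Du x‖ ^ 2 + V x * Y.u x ^ 2 + W (Y.u x)) := i2.add iW
  have i4 : Integrable (fun x => ‖Y.Θ x‖ ^ 2 + ‖Y.elec x‖ ^ 2) := (hn Y.Θ).add (hn Y.elec)
  have i5 : Integrable (fun x => ‖Y.Θ x‖ ^ 2 + ‖Y.elec x‖ ^ 2 + ‖Y.mag x‖ ^ 2) :=
    i4.add (hn Y.mag)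
  simp only [energy]
  rw [integral_add i3 (i5.const_mul (1 / 2)), integral_add i2 iW, integral_add i1 iV,
    integral_const_mul, integral_const_mul, integral_add i4 (hn Y.mag),
    integral_add (hn Y.Θ) (hn Y.elec)]
  simp only [integral_norm_sq_eq]

/-! ### Minimizers at fixed charge: vanishing of `Θ` and `𝐇`, and nontriviality. -/

/-- A minimizer of the energy on `X` at prescribed charge. -/
structure IsMinimizer (V : R3 → ℝ) (W : ℝ → ℝ) (q : ℝ) (U : Fields) : Prop where
  mem : U ∈ X q
  le : ∀ Y ∈ X q, charge Y = charge U → energy V W U ≤ energy V W Y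

theorem abs_charge (Y : Fields) : |charge Y| = charge Y := by
  rw [charge_eq]; exact abs_of_nonneg (sq_nonneg _)

theorem isMinimizer_of_isLeast {V : R3 → ℝ} {W : ℝ → ℝ} {q e₀ c₀ : ℝ}
    (h : IsLeast (energy V W '' {Y | Y ∈ X q ∧ |charge Y| = c₀}) e₀) {U : Fields}
    (hU : U ∈ {Y | Y ∈ X q ∧ energy V W Y = e₀ ∧ |charge Y| = c₀}) : IsMinimizer V W q U := by
  refine ⟨hU.1, fun Y hY hc => ?_⟩
  rw [hU.2.1]
  exact h.2 ⟨Y, ⟨hY, by rw [hc, hU.2.2]⟩, rfl⟩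

section Minimizer

variable {V : R3 → ℝ} {W : ℝ → ℝ} {E₀ q : ℝ} {U : Fields}

theorem IsMinimizer.memH1 (h : IsMinimizer V W q U) : MemH1 U.u U.Du := memH1_of_mem_X h.mem

theorem IsMinimizer.Θ_mag_eq_zero (hV : LatticePotential V) (hW : Nonlinearity V W E₀)
    (h : IsMinimizer V W q U) : U.Θ = 0 ∧ U.mag = 0 := by
  have h1 := h.le ⟨U.u, U.Du, 0, U.elec, 0⟩ h.mem rfl
  rw [energy_eq hV hW h.memH1, energy_eq (Y := ⟨U.u, U.Du, 0, U.elec, 0⟩) hV hW h.memH1] at h1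
  simp only [norm_zero] at h1
  have h2 : ‖U.Θ‖ ^ 2 + ‖U.mag‖ ^ 2 ≤ 0 := by linarith
  have h3 : ‖U.Θ‖ ^ 2 = 0 := by nlinarith [sq_nonneg ‖U.Θ‖, sq_nonneg ‖U.mag‖]
  have h4 : ‖U.mag‖ ^ 2 = 0 := by nlinarith [sq_nonneg ‖U.Θ‖, sq_nonneg ‖U.mag‖]
  simpa using And.intro h3 h4

theorem zero_mem_X (q : ℝ) : (0 : Fields) ∈ X q := by
  have h0 : ((0 : Fields).u : R3 → ℝ) =ᵐ[volume] fun _ => 0 := Lp.coeFn_zero ℝ 2 volume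
  have h0' : ((0 : Fields).Du : R3 → R3) =ᵐ[volume] fun _ => 0 := Lp.coeFn_zero R3 2 volume
  have h0'' : ((0 : Fields).elec : R3 → R3) =ᵐ[volume] fun _ => 0 := Lp.coeFn_zero R3 2 volume
  refine ⟨?_, fun η hη => ?_⟩
  · have := (IsTest.zero (F := R3)).memH1
    exact this.weak.congr h0.symm (h0'.symm.mono fun x hx => by rw [← hx]; simp [gradient])
  · rw [integral_congr_ae (g := fun _ => 0) (h0''.mono fun x hx => by simp [hx]),
      integral_congr_ae (f := fun x => q * (0 : Fields).u x ^ 2 * η x) (g := fun _ => 0)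
        (h0.mono fun x hx => by simp [hx])]
    simp

theorem energy_of_u_eq_zero (hV : LatticePotential V) (hW : Nonlinearity V W E₀) {Y : Fields}
    (hY : MemH1 Y.u Y.Du) (h : Y.u = 0) : energy V W Y = 1 / 2 * ‖Y.Du‖ ^ 2
      + 1 / 2 * (‖Y.Θ‖ ^ 2 + ‖Y.elec‖ ^ 2 + ‖Y.mag‖ ^ 2) := by
  have h0 : (Y.u : R3 → ℝ) =ᵐ[volume] fun _ => 0 := by rw [h]; exact Lp.coeFn_zero ℝ 2 volume
  rw [energy_eq hV hW hY, integral_congr_ae (g := fun _ => 0) (h0.mono fun x hx => by simp [hx]),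
    integral_congr_ae (f := fun x => W (Y.u x)) (g := fun _ => 0)
      (h0.mono fun x hx => by simp [hx, hW.zero])]
  simp

/-- If `u = 0` then `c₀ = 0`, so the zero state, of energy `0`, competes. The energy of `U` is then
a sum of squares, so `0` would be a minimizer and belong to `Γ`. Positivity allows division by
`‖U.u‖ ^ 2` later. -/
theorem charge_pos_of_zero_notMem (hV : LatticePotential V) (hW : Nonlinearity V W E₀)
    {e₀ c₀ : ℝ} (hl : IsLeast (energy V W '' {Y | Y ∈ X q ∧ |charge Y| = c₀}) e₀)
    (h0 : (0 : Fields) ∉ {Y | Y ∈ X q ∧ energy V W Y = e₀ ∧ |charge Y| = c₀})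
    (hU : U ∈ {Y | Y ∈ X q ∧ energy V W Y = e₀ ∧ |charge Y| = c₀}) : 0 < ‖U.u‖ := by
  by_contra hn
  have hu : U.u = 0 := norm_eq_zero.1 (le_antisymm (not_lt.1 hn) (norm_nonneg _))
  have hc : c₀ = 0 := by rw [← hU.2.2, abs_charge, charge_eq, hu]; simp
  have z1 : (0 : Fields).u = 0 := rfl
  have hc0 : |charge 0| = c₀ := by rw [abs_charge, charge_eq, z1, hc]; simp
  have e0 : energy V W 0 = 0 := by
    rw [energy_of_u_eq_zero hV hW (memH1_of_mem_X (zero_mem_X q)) z1]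
    have z2 : (0 : Fields).Du = 0 := rfl
    have z3 : (0 : Fields).Θ = 0 := rfl
    have z4 : (0 : Fields).elec = 0 := rfl
    have z5 : (0 : Fields).mag = 0 := rfl
    rw [z2, z3, z4, z5]; simp
  refine h0 ⟨zero_mem_X q, le_antisymm ?_ (hl.2 ⟨0, ⟨zero_mem_X q, hc0⟩, rfl⟩), hc0⟩
  rw [e0, ← hU.2.1, energy_of_u_eq_zero hV hW (memH1_of_mem_X hU.1) hu]
  positivity

end Minimizer

/-! ### Gradients inside `L²` and fields of prescribed divergence. -/

/-- The space of test functions on `ℝ³`. -/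
def testSpace : Submodule ℝ (R3 → ℝ) where
  carrier := {η | IsTest η}
  add_mem' h h' := IsTest.add h h'
  zero_mem' := IsTest.zero
  smul_mem' c _ h := IsTest.const_mul h c

/-- The gradient of a test function as an element of `L²`. -/
def gradMap : testSpace →ₗ[ℝ] Lp R3 2 (volume : Measure R3) where
  toFun η := (IsTest.memLp_gradient η.2 2).toLp
  map_add' η χ := by
    rw [← MemLp.toLp_add]
    refine MemLp.toLp_congr _ _ (ae_of_all _ fun x => ?_)
    ext i
    have h : fderiv ℝ (fun x => (η : R3 → ℝ) x + (χ : R3 → ℝ) x) x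
        = fderiv ℝ (η : R3 → ℝ) x + fderiv ℝ (χ : R3 → ℝ) x :=
      fderiv_fun_add (IsTest.differentiable η.2 x) (IsTest.differentiable χ.2 x)
    rw [Pi.add_apply, PiLp.add_apply, gradient_apply, gradient_apply, gradient_apply,
      ← add_apply, ← h]
    rfl
  map_smul' c η := by
    rw [RingHom.id_apply, ← MemLp.toLp_const_smul]
    refine MemLp.toLp_congr _ _ (ae_of_all _ fun x => ?_)
    ext i
    have h : fderiv ℝ (fun x => c * (η : R3 → ℝ) x) x = c • fderiv ℝ (η : R3 → ℝ) x :=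
      fderiv_const_mul (IsTest.differentiable η.2 x) c
    rw [Pi.smul_apply, PiLp.smul_apply, gradient_apply, gradient_apply,
      ← smul_apply, ← h]
    rfl

theorem coeFn_gradMap (η : testSpace) : gradMap η =ᵐ[volume] gradient (η : R3 → ℝ) :=
  MemLp.coeFn_toLp (IsTest.memLp_gradient η.2 2)

theorem inner_gradMap (F : Lp R3 2 (volume : Measure R3)) (η : testSpace) :
    inner ℝ F (gradMap η) = ∫ x, ∑ i, F x i * fderiv ℝ (η : R3 → ℝ) x (e i) := by
  rw [L2.inner_def]
  refine integral_congr_ae ?_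
  filter_upwards [coeFn_gradMap η] with x hx
  rw [hx, PiLp.inner_apply]
  refine Finset.sum_congr rfl fun i _ => ?_
  rw [gradient_apply]
  simp [mul_comm]

/-- The Gauss law as a Hilbert space pairing with gradients, the form in which the field can be
projected and varied. -/
theorem mem_X_iff {q : ℝ} {Y : Fields} : Y ∈ X q ↔ IsWeakGradient Y.u Y.Du ∧
    ∀ η : testSpace, inner ℝ Y.elec (gradMap η) = -∫ x, q * Y.u x ^ 2 * (η : R3 → ℝ) x := by
  simp_rw [inner_gradMap]
  exact ⟨fun h => ⟨h.1, fun η => h.2 η η.2⟩, fun h => ⟨h.1, fun η hη => h.2 ⟨η, hη⟩⟩⟩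

theorem eLpNorm_six_le_norm_gradMap (η : testSpace) :
    eLpNorm (η : R3 → ℝ) 6 volume ≤ sobolevConst * ENNReal.ofReal ‖gradMap η‖ := by
  refine (IsTest.eLpNorm_six_le η.2).trans (le_of_eq ?_)
  rw [Lp.norm_def, ENNReal.ofReal_toReal (Lp.eLpNorm_ne_top _), eLpNorm_congr_ae (coeFn_gradMap η)]

/-- If `ℓ` is a linear functional with `|ℓ v| ≤ C ‖D v‖`, then `ℓ v = ⟪F, D v⟫` for some `F`. -/
theorem exists_inner_eq {T H : Type*} [AddCommGroup T] [Module ℝ T] [NormedAddCommGroup H]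
    [InnerProductSpace ℝ H] [CompleteSpace H] (D : T →ₗ[ℝ] H) (l : T →ₗ[ℝ] ℝ) {C : ℝ}
    (h : ∀ v, |l v| ≤ C * ‖D v‖) : ∃ F : H, ∀ v, inner ℝ F (D v) = l v := by
  obtain ⟨s, hs⟩ := D.rangeRestrict.exists_rightInverse_of_surjective D.range_rangeRestrict
  have hs' : ∀ y, D (s y) = y := fun y => by
    have := LinearMap.congr_fun hs y
    exact congrArg Subtype.val this
  let f : StrongDual ℝ (LinearMap.range D) := (l ∘ₗ s).mkContinuous C fun y => by
    have := h (s y)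
    rw [hs'] at this
    exact this
  -- The range of `D` need not be closed, so the functional is extended by Hahn–Banach before the
  -- Riesz representation is applied.
  obtain ⟨g, hg, -⟩ := exists_extension_norm_eq (LinearMap.range D) f
  refine ⟨(InnerProductSpace.toDual ℝ H).symm g, fun v => ?_⟩
  rw [InnerProductSpace.toDual_symm_apply]
  have h1 := hg (D.rangeRestrict v)
  -- The bound forces `l` to vanish on the kernel of `D`, so the choice of the preimage `s` is
  -- immaterial.
  have h2 : l v = l (s (D.rangeRestrict v)) := by
    have h3 := h (v - s (D.rangeRestrict v))
    have h4 : D (v - s (D.rangeRestrict v)) = 0 := by rw [map_sub, hs']; simp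
    rw [h4, norm_zero, mul_zero, map_sub] at h3
    exact sub_eq_zero.1 (abs_eq_zero.1 (le_antisymm h3 (abs_nonneg _)))
  rw [h2]
  exact h1

theorem eLpNorm_mul_le {α : Type*} [MeasurableSpace α] {μ : Measure α} {p q r : ENNReal}
    [p.HolderTriple q r] {f g : α → ℝ} (hf : AEStronglyMeasurable f μ)
    (hg : AEStronglyMeasurable g μ) :
    eLpNorm (fun x => f x * g x) r μ ≤ eLpNorm f p μ * eLpNorm g q μ := by
  have h := eLpNorm_smul_le_mul_eLpNorm (p := p) (q := q) (r := r) hg hf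
  exact h

instance holderTriple_three_six_two : ENNReal.HolderTriple 3 6 2 := ⟨by
  rw [← ENNReal.toReal_eq_toReal_iff' (by finiteness) (by finiteness),
    ENNReal.toReal_add (by finiteness) (by finiteness)]
  norm_num⟩

/-- Hölder with exponents `2, 3, 6`, then Sobolev for `χ`. This is the boundedness that
`exists_div_eq` needs. -/
theorem abs_integral_mul_mul_le {a η : R3 → ℝ} (ha : MemLp a 2 volume) (hη : IsTest η)
    (χ : testSpace) : |∫ x, a x * η x * (χ : R3 → ℝ) x| ≤
      (eLpNorm a 2 volume * eLpNorm η 3 volume * sobolevConst).toReal * ‖gradMap χ‖ := by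
  have hm1 : AEStronglyMeasurable (χ : R3 → ℝ) volume :=
    (IsTest.continuous χ.2).aestronglyMeasurable
  have h1 := eLpNorm_mul_le (p := 3) (q := 6) (r := 2) hη.continuous.aestronglyMeasurable hm1
  have h2 := eLpNorm_mul_le (p := 2) (q := 2) (r := 1) ha.1
    (hη.continuous.aestronglyMeasurable.mul hm1)
  have h3 : ‖∫ x, a x * η x * (χ : R3 → ℝ) x‖ₑ ≤
      eLpNorm a 2 volume * eLpNorm η 3 volume * sobolevConst * ENNReal.ofReal ‖gradMap χ‖ := by
    refine (enorm_integral_le_lintegral_enorm _).trans ?_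
    rw [← eLpNorm_one_eq_lintegral_enorm]
    simp_rw [mul_assoc (a _)]
    refine h2.trans ?_
    calc _ ≤ eLpNorm a 2 volume * (eLpNorm η 3 volume *
          (sobolevConst * ENNReal.ofReal ‖gradMap χ‖)) :=
          mul_le_mul_right (h1.trans (mul_le_mul_right (eLpNorm_six_le_norm_gradMap χ) _)) _
      _ = _ := by ring
  have hfin : eLpNorm a 2 volume * eLpNorm η 3 volume * sobolevConst
      * ENNReal.ofReal ‖gradMap χ‖ ≠ ⊤ :=
    ENNReal.mul_ne_top (ENNReal.mul_ne_top (ENNReal.mul_ne_top ha.2.ne (hη.memLp 3).2.ne)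
      ENNReal.coe_ne_top) ENNReal.ofReal_ne_top
  have h4 := ENNReal.toReal_mono hfin h3
  rwa [toReal_enorm, Real.norm_eq_abs, ENNReal.toReal_mul,
    ENNReal.toReal_ofReal (norm_nonneg _)] at h4

theorem integrable_mul_mul_test {a b : R3 → ℝ} (ha : MemLp a 2 volume) (hb : MemLp b 2 volume)
    {χ : R3 → ℝ} (hχ : IsTest χ) : Integrable (fun x => a x * b x * χ x) := by
  have h1 : Integrable (fun x => a x * b x) := MemLp.integrable_mul ha hb
  refine (hχ.integrable_mul h1.locallyIntegrable).congr (ae_of_all _ fun x => ?_)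
  simp only [mul_comm]

/-- A field with divergence `q a η`. -/
theorem exists_div_eq (q : ℝ) {a η : R3 → ℝ} (ha : MemLp a 2 volume) (hη : IsTest η) :
    ∃ F : Lp R3 2 (volume : Measure R3), ∀ χ : testSpace,
      inner ℝ F (gradMap χ) = -∫ x, q * (a x * η x) * (χ : R3 → ℝ) x := by
  let l : testSpace →ₗ[ℝ] ℝ :=
    { toFun := fun χ => -(q * ∫ x, a x * η x * (χ : R3 → ℝ) x)
      map_add' := fun χ χ' => by
        have : ∫ x, a x * η x * ((χ + χ' : testSpace) : R3 → ℝ) x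
            = (∫ x, a x * η x * (χ : R3 → ℝ) x) + ∫ x, a x * η x * (χ' : R3 → ℝ) x := by
          rw [← integral_add (integrable_mul_mul_test ha (hη.memLp 2) χ.2)
            (integrable_mul_mul_test ha (hη.memLp 2) χ'.2)]
          exact integral_congr_ae (ae_of_all _ fun x => by simp; ring)
        rw [this]; ring
      map_smul' := fun c χ => by
        have : ∫ x, a x * η x * ((c • χ : testSpace) : R3 → ℝ) x
            = c * ∫ x, a x * η x * (χ : R3 → ℝ) x := by
          rw [← integral_const_mul]
          exact integral_congr_ae (ae_of_all _ fun x => by simp; ring)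
        rw [this, RingHom.id_apply, smul_eq_mul]; ring }
  obtain ⟨F, hF⟩ := exists_inner_eq gradMap l
    (C := |q| * (eLpNorm a 2 volume * eLpNorm η 3 volume * sobolevConst).toReal) fun χ => by
      simp only [l, LinearMap.coe_mk, AddHom.coe_mk, abs_neg, abs_mul, mul_assoc |q|]
      gcongr
      exact abs_integral_mul_mul_le ha hη χ
  refine ⟨F, fun χ => ?_⟩
  rw [hF]
  simp only [l, LinearMap.coe_mk, AddHom.coe_mk]
  rw [← integral_const_mul]
  simp only [mul_assoc]

/-! ### The electric potential of a minimizer. -/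

section Minimizer

variable {V : R3 → ℝ} {W : ℝ → ℝ} {E₀ q : ℝ} {U : Fields}

/-- The orthogonal projection onto the closed span of gradients has the same pairings with
gradients, hence satisfies the Gauss law. By Pythagoras it is strictly shorter unless the field
already lies there. -/
theorem IsMinimizer.elec_mem_closure (hV : LatticePotential V) (hW : Nonlinearity V W E₀)
    (h : IsMinimizer V W q U) : U.elec ∈ (LinearMap.range gradMap).topologicalClosure := by
  set K := (LinearMap.range gradMap).topologicalClosure with hK
  have hc : CompleteSpace K := (Submodule.isClosed_topologicalClosure _).completeSpace_coe
  set E' : Lp R3 2 (volume : Measure R3) := K.starProjection U.elec with hE'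
  have hmem : E' ∈ K := Submodule.starProjection_apply_mem _ _
  have horth : U.elec - E' ∈ Kᗮ := Submodule.sub_starProjection_mem_orthogonal _
  have hdiv : ∀ η, inner ℝ E' (gradMap η) = inner ℝ U.elec (gradMap η) := fun η => by
    have h1 : gradMap η ∈ K := Submodule.le_topologicalClosure _ ⟨η, rfl⟩
    have := Submodule.inner_left_of_mem_orthogonal h1 horth
    rw [inner_sub_left] at this
    linarith
  have hY : (⟨U.u, U.Du, U.Θ, E', U.mag⟩ : Fields) ∈ X q := by
    have := mem_X_iff.1 h.mem
    exact mem_X_iff.2 ⟨this.1, fun η => (hdiv η).trans (this.2 η)⟩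
  have h1 := h.le _ hY rfl
  rw [energy_eq hV hW h.memH1,
    energy_eq (Y := ⟨U.u, U.Du, U.Θ, E', U.mag⟩) hV hW h.memH1] at h1
  simp only at h1
  have h2 : ‖U.elec‖ ^ 2 ≤ ‖E'‖ ^ 2 := by linarith
  have h3 : ‖U.elec‖ ^ 2 = ‖E'‖ ^ 2 + ‖U.elec - E'‖ ^ 2 := by
    have h4 := Submodule.inner_right_of_mem_orthogonal hmem horth
    have h5 := norm_add_sq_real E' (U.elec - E')
    rw [h4, add_sub_cancel] at h5
    linarith
  have h6 : ‖U.elec - E'‖ = 0 := by nlinarith [norm_nonneg (U.elec - E')]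
  rw [sub_eq_zero.1 (norm_eq_zero.1 h6)]
  exact hmem

/-- The electric field of a minimizer is `-∇φ` with `φ ∈ 𝒟^{1,2}`. -/
theorem IsMinimizer.exists_potential (hV : LatticePotential V) (hW : Nonlinearity V W E₀)
    (h : IsMinimizer V W q U) : ∃ (φ : R3 → ℝ) (η : ℕ → testSpace), MemLp φ 6 volume ∧
      Tendsto (fun n => eLpNorm (fun x => (η n : R3 → ℝ) x - φ x) 6 volume) atTop (𝓝 0) ∧
      Tendsto (fun n => eLpNorm (fun x => gradient (η n : R3 → ℝ) x - -U.elec x) 2 volume)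
        atTop (𝓝 0) ∧ Tendsto (fun n => gradMap (η n)) atTop (𝓝 (-U.elec)) := by
  have h1 : -U.elec ∈ (LinearMap.range gradMap).topologicalClosure :=
    Submodule.neg_mem _ (h.elec_mem_closure hV hW)
  rw [← SetLike.mem_coe, Submodule.topologicalClosure_coe, mem_closure_iff_seq_limit] at h1
  obtain ⟨x, hx, hlim⟩ := h1
  choose η hη using hx
  have ht : Tendsto (fun n => gradMap (η n)) atTop (𝓝 (-U.elec)) := by simpa [hη] using hlim
  have ht2 : Tendsto (fun n => eLpNorm (fun x => gradient (η n : R3 → ℝ) x - -U.elec x) 2 volume)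
      atTop (𝓝 0) := by
    rw [tendsto_iff_edist_tendsto_0] at ht
    refine ht.congr fun n => ?_
    rw [Lp.edist_def]
    refine eLpNorm_congr_ae ?_
    filter_upwards [coeFn_gradMap (η n), Lp.coeFn_neg U.elec] with x h1 h2
    simp only [Pi.sub_apply, h1, h2, Pi.neg_apply]
  obtain ⟨φ, hφ, h6, -⟩ := exists_tendsto_eLpNorm_six (fun n => (η n).2)
    (Lp.memLp U.elec).neg ht2
  exact ⟨φ, η, hφ, h6, ht2, ht⟩

end Minimizer

/-! ### First variation of the energy under the charge and Gauss constraints. -/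

theorem hasDerivAt_inv_sqrt {κ : ℝ} (hκ : 0 ≤ κ) (s : ℝ) :
    HasDerivAt (fun s => (√(1 + κ * s ^ 2))⁻¹)
      (-(κ * s) / (√(1 + κ * s ^ 2)) ^ 3) s := by
  have hp : 0 < 1 + κ * s ^ 2 := by positivity
  have hs := Real.sqrt_pos.2 hp
  have h := ((((hasDerivAt_pow 2 s).const_mul κ).const_add 1).sqrt hp.ne').fun_inv hs.ne'
  refine h.congr_deriv ?_
  field_simp
  norm_num

theorem one_le_sqrt_one_add {κ : ℝ} (hκ : 0 ≤ κ) (s : ℝ) : 1 ≤ √(1 + κ * s ^ 2) :=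
  Real.one_le_sqrt.2 (by have : 0 ≤ κ * s ^ 2 := by positivity
                         linarith)

/-- Differentiation under the integral. For `|s| < 1` the scaling factor is at most `1` and its
derivative at most `κ`, so everything is dominated in terms of `P = |f| + |ζ|`. At `s = 0` the
scaling factor has zero derivative and leaves no trace. -/
theorem Nonlinearity.hasDerivAt_integral {V : R3 → ℝ} {W : ℝ → ℝ} {E₀ : ℝ}
    (hW : Nonlinearity V W E₀) {f ζ : R3 → ℝ} (hf : MemLp f 2 volume) (hf6 : MemLp f 6 volume)
    (hζ : MemLp ζ 2 volume) (hζ6 : MemLp ζ 6 volume) {κ : ℝ} (hκ : 0 ≤ κ) :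
    HasDerivAt (fun s => ∫ x, W ((√(1 + κ * s ^ 2))⁻¹ * (f x + s * ζ x)))
      (∫ x, deriv W (f x) * ζ x) 0 := by
  obtain ⟨C, hC, hb⟩ := hW.deriv_bound
  let lam : ℝ → ℝ := fun s => (√(1 + κ * s ^ 2))⁻¹
  let lam' : ℝ → ℝ := fun s => -(κ * s) / (√(1 + κ * s ^ 2)) ^ 3
  let P : R3 → ℝ := fun x => |f x| + |ζ x|
  have hP0 : ∀ x, 0 ≤ P x := fun x => by positivity
  have hPi : Integrable (fun x => P x ^ 2 + P x ^ 6) :=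
    MemLp.integrable_sq_add_pow_six (hf.abs.add hζ.abs) (hf6.abs.add hζ6.abs)
  have hm : ∀ s : ℝ, AEStronglyMeasurable (fun x => lam s * (f x + s * ζ x)) volume := fun s =>
    (hf.1.add (hζ.1.const_mul s)).const_mul _
  have h := hasDerivAt_integral_of_dominated_loc_of_deriv_le (μ := (volume : Measure R3))
    (F := fun s x => W (lam s * (f x + s * ζ x)))
    (F' := fun s x => deriv W (lam s * (f x + s * ζ x)) * (lam' s * (f x + s * ζ x) + lam s * ζ x))
    (x₀ := 0) (s := Metric.ball 0 1) (bound := fun x => C * (κ + 1) * (P x ^ 2 + P x ^ 6))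
    (Metric.ball_mem_nhds 0 one_pos)
    (Eventually.of_forall fun s => hW.continuous.comp_aestronglyMeasurable (hm s)) ?_ ?_ ?_
    (hPi.const_mul _) ?_
  · have h2 := h.2
    refine h2.congr_deriv (integral_congr_ae (ae_of_all _ fun x => ?_))
    simp [lam, lam']
  · simpa [lam] using hW.integrable_comp hf hf6
  · refine (hW.continuous_deriv.comp_aestronglyMeasurable (hm 0)).mul ?_
    exact ((hf.1.add (hζ.1.const_mul 0)).const_mul _).add (hζ.1.const_mul _)
  · refine ae_of_all _ fun x s hs => ?_
    have hs1 : |s| ≤ 1 := by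
      have := mem_ball_zero_iff.1 hs
      exact this.le
    have hq := one_le_sqrt_one_add hκ s
    have hl : |lam s| ≤ 1 := by
      rw [abs_of_nonneg (by positivity)]
      exact inv_le_one_of_one_le₀ hq
    have hl' : |lam' s| ≤ κ := by
      simp only [lam']
      rw [abs_div, abs_neg, abs_mul, abs_of_nonneg hκ,
        abs_of_nonneg (by positivity : 0 ≤ √(1 + κ * s ^ 2) ^ 3)]
      refine (div_le_self (by positivity) (one_le_pow₀ hq)).trans ?_
      exact mul_le_of_le_one_right hκ hs1
    have h1 : |f x + s * ζ x| ≤ P x := by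
      refine (abs_add_le _ _).trans (add_le_add le_rfl ?_)
      rw [abs_mul]
      exact mul_le_of_le_one_left (abs_nonneg _) hs1
    have h2 : |lam s * (f x + s * ζ x)| ≤ P x := by
      rw [abs_mul]
      exact (mul_le_of_le_one_left (abs_nonneg _) hl).trans h1
    have h3 : |lam' s * (f x + s * ζ x) + lam s * ζ x| ≤ (κ + 1) * P x := by
      refine (abs_add_le _ _).trans ?_
      rw [abs_mul, abs_mul]
      have a1 : |lam' s| * |f x + s * ζ x| ≤ κ * P x :=
        mul_le_mul hl' h1 (abs_nonneg _) hκ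
      have a2 : |lam s| * |ζ x| ≤ P x :=
        (mul_le_of_le_one_left (abs_nonneg _) hl).trans (le_add_of_nonneg_left (abs_nonneg _))
      linarith
    rw [norm_mul, Real.norm_eq_abs, Real.norm_eq_abs]
    calc _ ≤ (C * (P x + P x ^ 5)) * ((κ + 1) * P x) := by
          have hPx := hP0 x
          refine mul_le_mul ((hb _).trans ?_) h3 (abs_nonneg _) (by positivity)
          gcongr
      _ = _ := by ring
  · refine ae_of_all _ fun x s _ => ?_
    have h1 : HasDerivAt (fun s => lam s * (f x + s * ζ x))
        (lam' s * (f x + s * ζ x) + lam s * ζ x) s :=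
      ((hasDerivAt_inv_sqrt hκ s).fun_mul
        (((hasDerivAt_id' s).mul_const (ζ x)).const_add (f x))).congr_deriv (by simp [lam, lam'])
    exact (hW.hasDerivAt _).comp s h1

section Minimizer

variable {V : R3 → ℝ} {W : ℝ → ℝ} {E₀ q : ℝ} {U : Fields}

/-- A competitor for a minimizer: `u` is replaced with `λ (u + s ζ)`. -/
def variation (U : Fields) (ζ : Lp ℝ 2 (volume : Measure R3))
    (Dζ F G : Lp R3 2 (volume : Measure R3)) (l s : ℝ) : Fields where
  u := l • (U.u + s • ζ)
  Du := l • (U.Du + s • Dζ)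
  Θ := U.Θ
  elec := l ^ 2 • (U.elec + (2 * s) • F + s ^ 2 • G)
  mag := U.mag

theorem coeFn_smul_add_smul {E : Type*} [NormedAddCommGroup E] [NormedSpace ℝ E]
    (f g : Lp E 2 (volume : Measure R3)) (l s : ℝ) :
    (l • (f + s • g) : Lp E 2 (volume : Measure R3)) =ᵐ[volume]
      fun x => l • (f x + s • g x) := by
  filter_upwards [Lp.coeFn_smul l (f + s • g), Lp.coeFn_add f (s • g), Lp.coeFn_smul s g]
    with x h1 h2 h3
  rw [h1, Pi.smul_apply, h2, Pi.add_apply, h3, Pi.smul_apply]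

/-- The fields `F` and `G` have divergences `q u ζ` and `q ζ²`, so the new field matches `q λ²(u² +
2s u ζ + s² ζ²)` term by term: the nonlinear constraint holds exactly, not just to first order. -/
theorem variation_mem_X (hU : U ∈ X q) {ζ : Lp ℝ 2 (volume : Measure R3)}
    {Dζ F G : Lp R3 2 (volume : Measure R3)} (hζ : MemH1 ζ Dζ)
    (hF : ∀ χ : testSpace, inner ℝ F (gradMap χ) = -∫ x, q * (U.u x * ζ x) * (χ : R3 → ℝ) x)
    (hG : ∀ χ : testSpace, inner ℝ G (gradMap χ) = -∫ x, q * (ζ x * ζ x) * (χ : R3 → ℝ) x)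
    (l s : ℝ) : variation U ζ Dζ F G l s ∈ X q := by
  obtain ⟨h1, h2⟩ := mem_X_iff.1 hU
  have hu := memH1_of_mem_X hU
  refine mem_X_iff.2 ⟨?_, fun χ => ?_⟩
  · refine ((hu.linear_comb hζ l (l * s)).weak).congr ?_ ?_
    · filter_upwards [coeFn_smul_add_smul U.u ζ l s] with x hx
      simp only [variation]
      rw [hx]
      simp only [smul_eq_mul]
      ring
    · filter_upwards [coeFn_smul_add_smul U.Du Dζ l s] with x hx
      simp only [variation]
      rw [hx, smul_add, smul_smul]
  · have e1 : ∫ x, q * (variation U ζ Dζ F G l s).u x ^ 2 * (χ : R3 → ℝ) x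
        = l ^ 2 * ((∫ x, q * U.u x ^ 2 * (χ : R3 → ℝ) x)
          + 2 * s * (∫ x, q * (U.u x * ζ x) * (χ : R3 → ℝ) x)
          + s ^ 2 * ∫ x, q * (ζ x * ζ x) * (χ : R3 → ℝ) x) := by
      have i1 : Integrable (fun x => q * U.u x ^ 2 * (χ : R3 → ℝ) x) :=
        ((integrable_mul_mul_test hu.memLp hu.memLp χ.2).const_mul q).congr
          (ae_of_all _ fun x => by ring)
      have i2 : Integrable (fun x => q * (U.u x * ζ x) * (χ : R3 → ℝ) x) :=
        ((integrable_mul_mul_test hu.memLp hζ.memLp χ.2).const_mul q).congr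
          (ae_of_all _ fun x => by ring)
      have i3 : Integrable (fun x => q * (ζ x * ζ x) * (χ : R3 → ℝ) x) :=
        ((integrable_mul_mul_test hζ.memLp hζ.memLp χ.2).const_mul q).congr
          (ae_of_all _ fun x => by ring)
      have i12 : Integrable (fun x => q * U.u x ^ 2 * (χ : R3 → ℝ) x
          + 2 * s * (q * (U.u x * ζ x) * (χ : R3 → ℝ) x)) := i1.add (i2.const_mul _)
      rw [← integral_const_mul (2 * s), ← integral_const_mul (s ^ 2),
        ← integral_add i1 (i2.const_mul _), ← integral_add i12 (i3.const_mul _),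
        ← integral_const_mul]
      refine integral_congr_ae ?_
      filter_upwards [coeFn_smul_add_smul U.u ζ l s] with x hx
      simp only [variation]
      rw [hx]
      simp only [smul_eq_mul]
      ring
    rw [e1]
    simp only [variation]
    rw [real_inner_smul_left, inner_add_left, inner_add_left, real_inner_smul_left,
      real_inner_smul_left, h2, hF, hG]
    ring

theorem norm_sq_smul_add_smul {H : Type*} [NormedAddCommGroup H] [InnerProductSpace ℝ H]
    (a b : H) (l s : ℝ) : ‖l • (a + s • b)‖ ^ 2
      = l ^ 2 * (‖a‖ ^ 2 + 2 * s * inner ℝ a b + s ^ 2 * ‖b‖ ^ 2) := by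
  rw [norm_smul, mul_pow, norm_add_sq_real, norm_smul, mul_pow, real_inner_smul_right,
    Real.norm_eq_abs, Real.norm_eq_abs, sq_abs, sq_abs]
  ring

theorem norm_sq_quadratic {H : Type*} [NormedAddCommGroup H] [InnerProductSpace ℝ H]
    (a b c : H) (s : ℝ) : ‖a + (2 * s) • b + s ^ 2 • c‖ ^ 2
      = ‖a‖ ^ 2 + 4 * s * inner ℝ a b
        + s ^ 2 * (4 * ‖b‖ ^ 2 + 2 * inner ℝ a c + 4 * s * inner ℝ b c + s ^ 2 * ‖c‖ ^ 2) := by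
  rw [norm_add_sq_real, norm_add_sq_real, norm_smul, norm_smul, mul_pow, mul_pow,
    inner_add_left, real_inner_smul_right, real_inner_smul_right, real_inner_smul_right,
    real_inner_smul_left, Real.norm_eq_abs, Real.norm_eq_abs, sq_abs, sq_abs]
  ring

theorem integrable_V_mul (hV : LatticePotential V) (hW : Nonlinearity V W E₀)
    {f g : R3 → ℝ} (hf : MemLp f 2 volume) (hg : MemLp g 2 volume) :
    Integrable (fun x => V x * f x * g x) :=
  MemLp.integrable_mul (hV.memLp_mul hW hf) hg

/-- The Euler–Lagrange equation in directions tangent to the constraint. -/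
theorem IsMinimizer.euler_lagrange (hV : LatticePotential V) (hW : Nonlinearity V W E₀)
    (h : IsMinimizer V W q U) (hpos : 0 < ‖U.u‖) {ζ : Lp ℝ 2 (volume : Measure R3)}
    {Dζ F G : Lp R3 2 (volume : Measure R3)} (hζ : MemH1 ζ Dζ) (horth : inner ℝ U.u ζ = 0)
    (hF : ∀ χ : testSpace, inner ℝ F (gradMap χ) = -∫ x, q * (U.u x * ζ x) * (χ : R3 → ℝ) x)
    (hG : ∀ χ : testSpace, inner ℝ G (gradMap χ) = -∫ x, q * (ζ x * ζ x) * (χ : R3 → ℝ) x) :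
    inner ℝ U.Du Dζ + 2 * (∫ x, V x * U.u x * ζ x) + (∫ x, deriv W (U.u x) * ζ x)
      + 2 * inner ℝ U.elec F = 0 := by
  -- For `ζ ⟂ u` one has `‖u + sζ‖² = (1 + κ s²)‖u‖²`, so `lam s` restores the charge exactly.
  set κ : ℝ := ‖ζ‖ ^ 2 / ‖U.u‖ ^ 2 with hκdef
  have hκ : 0 ≤ κ := by positivity
  set lam : ℝ → ℝ := fun s => (√(1 + κ * s ^ 2))⁻¹ with hlam
  have hlam2 : ∀ s, lam s ^ 2 = (1 + κ * s ^ 2)⁻¹ := fun s => by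
    simp only [hlam]
    rw [inv_pow, Real.sq_sqrt (by positivity)]
  have hlam0 : lam 0 = 1 := by simp [hlam]
  -- The renormalization is of second order in `s` and drops out of the first variation.
  have hdl : HasDerivAt lam 0 0 := (hasDerivAt_inv_sqrt hκ 0).congr_deriv (by simp)
  set a : ℝ := inner ℝ U.Du Dζ
  set b : ℝ := ∫ x, V x * U.u x * ζ x
  set J : ℝ → ℝ := fun s => energy V W (variation U ζ Dζ F G (lam s) s) with hJ
  have hu := h.memH1
  have hmem := fun s => variation_mem_X h.mem hζ hF hG (lam s) s
  -- the constraint is preserved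
  have hch : ∀ s, charge (variation U ζ Dζ F G (lam s) s) = charge U := fun s => by
    rw [charge_eq, charge_eq]
    simp only [variation]
    rw [norm_sq_smul_add_smul, horth, hlam2, hκdef]
    have : 0 < ‖U.u‖ ^ 2 + ‖ζ‖ ^ 2 * s ^ 2 := by positivity
    field_simp
    ring
  have hmin : ∀ s, J 0 ≤ J s := fun s => by
    have h0 : variation U ζ Dζ F G (lam 0) 0 = U := by
      rw [hlam0]
      simp [variation]
    simp only [hJ]
    rw [h0]
    exact h.le _ (hmem s) (hch s)
  have hJeq : ∀ s, J s = 1 / 2 * (lam s ^ 2 * (‖U.Du‖ ^ 2 + 2 * s * a + s ^ 2 * ‖Dζ‖ ^ 2))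
      + lam s ^ 2 * ((∫ x, V x * U.u x * U.u x) + 2 * s * b + s ^ 2 * ∫ x, V x * ζ x * ζ x)
      + (∫ x, W ((√(1 + κ * s ^ 2))⁻¹ * (U.u x + s * ζ x)))
      + 1 / 2 * (‖U.Θ‖ ^ 2 + (lam s ^ 2) ^ 2 * (‖U.elec‖ ^ 2 + 4 * s * inner ℝ U.elec F
        + s ^ 2 * (4 * ‖F‖ ^ 2 + 2 * inner ℝ U.elec G + 4 * s * inner ℝ F G + s ^ 2 * ‖G‖ ^ 2))
        + ‖U.mag‖ ^ 2) := fun s => by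
    simp only [hJ]
    rw [energy_eq hV hW (memH1_of_mem_X (hmem s))]
    have e1 : ∫ x, V x * (variation U ζ Dζ F G (lam s) s).u x ^ 2 = lam s ^ 2 *
        ((∫ x, V x * U.u x * U.u x) + 2 * s * b + s ^ 2 * ∫ x, V x * ζ x * ζ x) := by
      have i1 := integrable_V_mul hV hW hu.memLp hu.memLp
      have i2 := integrable_V_mul hV hW hu.memLp hζ.memLp
      have i3 := integrable_V_mul hV hW hζ.memLp hζ.memLp
      have i12 : Integrable (fun x => V x * U.u x * U.u x + 2 * s * (V x * U.u x * ζ x)) :=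
        i1.add (i2.const_mul _)
      rw [← integral_const_mul (2 * s), ← integral_const_mul (s ^ 2),
        ← integral_add i1 (i2.const_mul _), ← integral_add i12 (i3.const_mul _),
        ← integral_const_mul]
      refine integral_congr_ae ?_
      filter_upwards [coeFn_smul_add_smul U.u ζ (lam s) s] with x hx
      simp only [variation]
      rw [hx]
      simp only [smul_eq_mul]
      ring
    have e2 : ∫ x, W ((variation U ζ Dζ F G (lam s) s).u x)
        = ∫ x, W ((√(1 + κ * s ^ 2))⁻¹ * (U.u x + s * ζ x)) := by
      refine integral_congr_ae ?_
      filter_upwards [coeFn_smul_add_smul U.u ζ (lam s) s] with x hx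
      simp only [variation]
      rw [hx]
      simp only [smul_eq_mul, hlam]
    rw [e1, e2]
    simp only [variation]
    rw [norm_sq_smul_add_smul, norm_smul (lam s ^ 2), mul_pow ‖lam s ^ 2‖, norm_sq_quadratic,
      Real.norm_eq_abs, sq_abs]
  have hd2 : HasDerivAt (fun s => lam s ^ 2) 0 0 := (hdl.fun_pow 2).congr_deriv (by simp)
  -- Each quadratic term contributes only its coefficient of `s`; the rest is `s ^ 2` times a
  -- differentiable function.
  have hpoly : ∀ c₀ c₁ : ℝ, ∀ R : ℝ → ℝ, DifferentiableAt ℝ R 0 →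
      HasDerivAt (fun s => c₀ + c₁ * s + s ^ 2 * R s) c₁ 0 := by
    intro c₀ c₁ R hR
    have := (((hasDerivAt_id' (0 : ℝ)).const_mul c₁).const_add c₀).fun_add
      ((hasDerivAt_pow 2 (0 : ℝ)).fun_mul hR.hasDerivAt)
    exact this.congr_deriv (by simp)
  have p1 := hpoly (‖U.Du‖ ^ 2) (2 * a) (fun _ => ‖Dζ‖ ^ 2) (by fun_prop)
  have p2 := hpoly (∫ x, V x * U.u x * U.u x) (2 * b) (fun _ => ∫ x, V x * ζ x * ζ x) (by fun_prop)
  have p3 := hpoly (‖U.elec‖ ^ 2) (4 * inner ℝ U.elec F) (fun s => 4 * ‖F‖ ^ 2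
    + 2 * inner ℝ U.elec G + 4 * s * inner ℝ F G + s ^ 2 * ‖G‖ ^ 2) (by fun_prop)
  have hW' := hW.hasDerivAt_integral hu.memLp hu.memLp_six hζ.memLp hζ.memLp_six hκ
  have hJd := (((hd2.fun_mul p1).const_mul (1 / 2)).fun_add (hd2.fun_mul p2)).fun_add hW'
    |>.fun_add ((((hd2.fun_pow 2).fun_mul p3).const_add (‖U.Θ‖ ^ 2)).add_const
      (‖U.mag‖ ^ 2) |>.const_mul (1 / 2))
  have hJd' : HasDerivAt J (a + 2 * b + (∫ x, deriv W (U.u x) * ζ x)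
      + 2 * inner ℝ U.elec F) 0 := by
    refine (hJd.congr_of_eventuallyEq (Eventually.of_forall fun s => ?_)).congr_deriv ?_
    · rw [hJeq]
      ring
    · simp only [hlam0]
      norm_num
      ring
  have hloc : IsLocalMin J 0 := Eventually.of_forall hmin
  exact hloc.hasDerivAt_eq_zero hJd'

end Minimizer

/-! ### The Lagrange multiplier and the Schrödinger–Poisson system. -/

theorem pow_five_le (s : ℝ) : |s| ^ 5 ≤ 1 + |s| ^ 6 := by
  have h := abs_nonneg s
  rcases le_total |s| 1 with h1 | h1
  · have : |s| ^ 5 ≤ 1 := pow_le_one₀ h h1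
    have : 0 ≤ |s| ^ 6 := by positivity
    linarith
  · have : |s| ^ 5 ≤ |s| ^ 6 := pow_le_pow_right₀ h1 (by norm_num)
    linarith

theorem sq_le_one_add_pow_six (s : ℝ) : s ^ 2 ≤ 1 + s ^ 6 := by
  nlinarith [sq_nonneg (s ^ 2 - 1), sq_nonneg (s ^ 3), sq_nonneg (s * (s ^ 2 - 1)), sq_nonneg s]

theorem integrable_pow_six {f : R3 → ℝ} (h : MemLp f 6 volume) :
    Integrable (fun x => f x ^ 6) := by
  refine (h.integrable_norm_pow (p := 6) (by norm_num)).congr (ae_of_all _ fun x => ?_)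
  simp only [Real.norm_eq_abs]
  rw [Even.pow_abs (by decide)]

/-- Pointwise `|φ f| ≤ φ² + f² ≤ 1 + φ⁶ + f²`. -/
theorem locallyIntegrable_mul_of_memLp_six {f φ : R3 → ℝ} (hf : MemLp f 2 volume)
    (hφ : MemLp φ 6 volume) : LocallyIntegrable (fun x => φ x * f x) := by
  have h1 : LocallyIntegrable (fun x => (1 + φ x ^ 6) + f x ^ 2) :=
    ((locallyIntegrable_const 1).add (integrable_pow_six hφ).locallyIntegrable).add
      hf.integrable_sq.locallyIntegrable
  refine h1.mono (hφ.1.mul hf.1) (ae_of_all _ fun x => ?_)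
  rw [Real.norm_eq_abs, abs_mul]
  refine le_trans ?_ (le_abs_self _)
  have := sq_le_one_add_pow_six (φ x)
  have h2 := sq_abs (φ x)
  have h3 := sq_abs (f x)
  nlinarith [sq_nonneg (|φ x| - |f x|), sq_nonneg (f x), sq_nonneg (φ x)]

section Nonlinearity

variable {V : R3 → ℝ} {W : ℝ → ℝ} {E₀ : ℝ}

theorem Nonlinearity.locallyIntegrable_deriv_comp (hW : Nonlinearity V W E₀) {f : R3 → ℝ}
    (h2 : MemLp f 2 volume) (h6 : MemLp f 6 volume) :
    LocallyIntegrable (fun x => deriv W (f x)) := by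
  obtain ⟨C, hC, hb⟩ := hW.deriv_bound
  have h1 : LocallyIntegrable (fun x => C * (|f x| + (1 + f x ^ 6))) :=
    (((h2.abs).locallyIntegrable (by norm_num)).add
      ((locallyIntegrable_const 1).add (integrable_pow_six h6).locallyIntegrable)).smul C
  refine h1.mono (hW.continuous_deriv.comp_aestronglyMeasurable h2.1) (ae_of_all _ fun x => ?_)
  refine (hb _).trans (le_trans ?_ (le_abs_self _))
  gcongr
  have := pow_five_le (f x)
  rwa [Even.pow_abs (n := 6) (by decide)] at this

theorem Nonlinearity.integrable_deriv_mul (hW : Nonlinearity V W E₀) {f g : R3 → ℝ}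
    (h2 : MemLp f 2 volume) (h6 : MemLp f 6 volume) (g2 : MemLp g 2 volume)
    (g6 : MemLp g 6 volume) : Integrable (fun x => deriv W (f x) * g x) := by
  obtain ⟨C, hC, hb⟩ := hW.deriv_bound
  have hPi : Integrable (fun x => (|f x| + |g x|) ^ 2 + (|f x| + |g x|) ^ 6) :=
    MemLp.integrable_sq_add_pow_six (h2.abs.add g2.abs) (h6.abs.add g6.abs)
  refine (hPi.const_mul C).mono' ((hW.continuous_deriv.comp_aestronglyMeasurable h2.1).mul g2.1)
    (ae_of_all _ fun x => ?_)
  have e1 : |f x| ≤ |f x| + |g x| := by linarith [abs_nonneg (g x)]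
  have e2 : |g x| ≤ |f x| + |g x| := by linarith [abs_nonneg (f x)]
  rw [norm_mul]
  calc _ ≤ (C * ((|f x| + |g x|) + (|f x| + |g x|) ^ 5)) * (|f x| + |g x|) := by
        refine mul_le_mul ((hb _).trans ?_) e2 (abs_nonneg _) (by positivity)
        gcongr
    _ = _ := by ring

end Nonlinearity

theorem coeFn_sub_smul {E : Type*} [NormedAddCommGroup E] [NormedSpace ℝ E]
    (f g : Lp E 2 (volume : Measure R3)) (k : ℝ) :
    (f - k • g : Lp E 2 (volume : Measure R3)) =ᵐ[volume] fun x => f x - k • g x := by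
  filter_upwards [Lp.coeFn_sub f (k • g), Lp.coeFn_smul k g] with x h1 h2
  rw [h1, Pi.sub_apply, h2, Pi.smul_apply]

section Minimizer

variable {V : R3 → ℝ} {W : ℝ → ℝ} {E₀ q : ℝ} {U : Fields}

/-- The Lagrange multiplier of the charge constraint. -/
def multiplier (V : R3 → ℝ) (W : ℝ → ℝ) (U : Fields) : ℝ :=
  (‖U.Du‖ ^ 2 + 2 * (∫ x, V x * U.u x * U.u x) + (∫ x, deriv W (U.u x) * U.u x)
    + 2 * ‖U.elec‖ ^ 2) / ‖U.u‖ ^ 2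

/-- A test function is made tangent to the charge constraint by subtracting its component `k u`
along `u`. The terms with the factor `k` assemble into `multiplier`. -/
theorem IsMinimizer.euler_lagrange_test (hV : LatticePotential V) (hW : Nonlinearity V W E₀)
    (h : IsMinimizer V W q U) (hpos : 0 < ‖U.u‖) (η : testSpace)
    {F : Lp R3 2 (volume : Measure R3)}
    (hF : ∀ χ : testSpace, inner ℝ F (gradMap χ)
      = -∫ x, q * (U.u x * (η : R3 → ℝ) x) * (χ : R3 → ℝ) x) :
    inner ℝ U.Du (gradMap η) + 2 * (∫ x, V x * U.u x * (η : R3 → ℝ) x)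
      + (∫ x, deriv W (U.u x) * (η : R3 → ℝ) x) + 2 * inner ℝ U.elec F
      = multiplier V W U * ∫ x, U.u x * (η : R3 → ℝ) x := by
  have hη : IsTest (η : R3 → ℝ) := η.2
  have hu := h.memH1
  have hE := (mem_X_iff.1 h.mem).2
  set ηL : Lp ℝ 2 (volume : Measure R3) := (hη.memLp 2).toLp with hηL
  have hηae : ηL =ᵐ[volume] (η : R3 → ℝ) := MemLp.coeFn_toLp _
  obtain ⟨G, hG⟩ := exists_div_eq q (hη.memLp 2) hη
  set m : ℝ := ∫ x, U.u x * (η : R3 → ℝ) x with hm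
  have hinner : inner ℝ U.u ηL = m := by
    rw [L2.inner_def]
    refine integral_congr_ae ?_
    filter_upwards [hηae] with x hx
    rw [hx]; simp [mul_comm]
  set k : ℝ := m / ‖U.u‖ ^ 2 with hk
  have hne : ‖U.u‖ ^ 2 ≠ 0 := by positivity
  have hζae : (ηL - k • U.u : Lp ℝ 2 (volume : Measure R3)) =ᵐ[volume]
      fun x => (η : R3 → ℝ) x - k * U.u x := by
    filter_upwards [coeFn_sub_smul ηL U.u k, hηae] with x h1 h2
    rw [h1, h2, smul_eq_mul]
  have hζ : MemH1 (ηL - k • U.u : Lp ℝ 2 (volume : Measure R3))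
      (gradMap η - k • U.Du : Lp R3 2 (volume : Measure R3)) := by
    refine (hη.memH1.linear_comb hu 1 (-k)).congr ?_ ?_
    · filter_upwards [hζae] with x hx
      rw [hx]; ring
    · filter_upwards [coeFn_sub_smul (gradMap η) U.Du k, coeFn_gradMap η] with x h1 h2
      rw [h1, h2, one_smul, neg_smul, sub_eq_add_neg]
  have horth : inner ℝ U.u (ηL - k • U.u) = 0 := by
    rw [inner_sub_right, real_inner_smul_right, hinner, real_inner_self_eq_norm_sq, hk]
    field_simp
    ring
  have i1 : ∀ χ : testSpace, Integrable (fun x => q * (U.u x * (η : R3 → ℝ) x) * (χ : R3 → ℝ) x) :=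
    fun χ => ((integrable_mul_mul_test hu.memLp (hη.memLp 2) χ.2).const_mul q).congr
      (ae_of_all _ fun x => by ring)
  have i2 : ∀ χ : testSpace, Integrable (fun x => q * U.u x ^ 2 * (χ : R3 → ℝ) x) :=
    fun χ => ((integrable_mul_mul_test hu.memLp hu.memLp χ.2).const_mul q).congr
      (ae_of_all _ fun x => by ring)
  have i3 : ∀ χ : testSpace, Integrable
      (fun x => q * ((η : R3 → ℝ) x * (η : R3 → ℝ) x) * (χ : R3 → ℝ) x) :=
    fun χ => ((integrable_mul_mul_test (hη.memLp 2) (hη.memLp 2) χ.2).const_mul q).congr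
      (ae_of_all _ fun x => by ring)
  -- By the Gauss law `elec` itself has divergence `q u²`. The new fields follow from `u(η - ku) =
  -- uη - ku²` and `(η - ku)² = η² - 2k uη + k² u²`.
  have key := h.euler_lagrange hV hW hpos hζ horth (F := F - k • U.elec)
    (G := (G - (2 * k) • F) + k ^ 2 • U.elec) (fun χ => ?_) (fun χ => ?_)
  · have jV1 := integrable_V_mul hV hW hu.memLp (hη.memLp 2)
    have jV2 := integrable_V_mul hV hW hu.memLp hu.memLp
    have jW1 := hW.integrable_deriv_mul hu.memLp hu.memLp_six (hη.memLp 2) (hη.memLp 6)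
    have jW2 := hW.integrable_deriv_mul hu.memLp hu.memLp_six hu.memLp hu.memLp_six
    have eV : ∫ x, V x * U.u x * (ηL - k • U.u : Lp ℝ 2 (volume : Measure R3)) x
        = (∫ x, V x * U.u x * (η : R3 → ℝ) x) - k * ∫ x, V x * U.u x * U.u x := by
      rw [← integral_const_mul, ← integral_sub jV1 (jV2.const_mul k)]
      refine integral_congr_ae ?_
      filter_upwards [hζae] with x hx
      rw [hx]; ring
    have eW : ∫ x, deriv W (U.u x) * (ηL - k • U.u : Lp ℝ 2 (volume : Measure R3)) x
        = (∫ x, deriv W (U.u x) * (η : R3 → ℝ) x) - k * ∫ x, deriv W (U.u x) * U.u x := by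
      rw [← integral_const_mul, ← integral_sub jW1 (jW2.const_mul k)]
      refine integral_congr_ae ?_
      filter_upwards [hζae] with x hx
      rw [hx]; ring
    rw [eV, eW, inner_sub_right, real_inner_smul_right, inner_sub_right, real_inner_smul_right,
      real_inner_self_eq_norm_sq, real_inner_self_eq_norm_sq] at key
    have e3 : multiplier V W U * m = k * (‖U.Du‖ ^ 2 + 2 * (∫ x, V x * U.u x * U.u x)
        + (∫ x, deriv W (U.u x) * U.u x) + 2 * ‖U.elec‖ ^ 2) := by
      rw [multiplier, hk]; ring
    rw [e3]
    linarith
  · rw [inner_sub_left, real_inner_smul_left, hF, hE]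
    have : ∫ x, q * (U.u x * (ηL - k • U.u : Lp ℝ 2 (volume : Measure R3)) x) * (χ : R3 → ℝ) x
        = (∫ x, q * (U.u x * (η : R3 → ℝ) x) * (χ : R3 → ℝ) x)
          - k * ∫ x, q * U.u x ^ 2 * (χ : R3 → ℝ) x := by
      rw [← integral_const_mul, ← integral_sub (i1 χ) ((i2 χ).const_mul k)]
      refine integral_congr_ae ?_
      filter_upwards [hζae] with x hx
      rw [hx]; ring
    rw [this]; ring
  · rw [inner_add_left, inner_sub_left, real_inner_smul_left, real_inner_smul_left, hF, hE, hG]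
    have : ∫ x, q * ((ηL - k • U.u : Lp ℝ 2 (volume : Measure R3)) x
          * (ηL - k • U.u : Lp ℝ 2 (volume : Measure R3)) x) * (χ : R3 → ℝ) x
        = (∫ x, q * ((η : R3 → ℝ) x * (η : R3 → ℝ) x) * (χ : R3 → ℝ) x)
          - (2 * k) * (∫ x, q * (U.u x * (η : R3 → ℝ) x) * (χ : R3 → ℝ) x)
          + k ^ 2 * ∫ x, q * U.u x ^ 2 * (χ : R3 → ℝ) x := by
      have i12 : Integrable (fun x => q * ((η : R3 → ℝ) x * (η : R3 → ℝ) x) * (χ : R3 → ℝ) x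
          - 2 * k * (q * (U.u x * (η : R3 → ℝ) x) * (χ : R3 → ℝ) x)) :=
        (i3 χ).sub ((i1 χ).const_mul _)
      rw [← integral_const_mul (2 * k), ← integral_const_mul (k ^ 2),
        ← integral_sub (i3 χ) ((i1 χ).const_mul _), ← integral_add i12 ((i2 χ).const_mul _)]
      refine integral_congr_ae ?_
      filter_upwards [hζae] with x hx
      rw [hx]; ring
    rw [this]; ring

/-- Integration by parts for the potential: `-elec` is the limit of gradients of test functions,
against which `F` is known, and these test functions converge to `φ` in `L⁶`. This produces the
coupling term `q φ u` of the Schrödinger equation. -/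
theorem inner_elec_eq {φ : R3 → ℝ} {ηs : ℕ → testSpace} (hφ : MemLp φ 6 volume)
    (h6 : Tendsto (fun n => eLpNorm (fun x => (ηs n : R3 → ℝ) x - φ x) 6 volume) atTop (𝓝 0))
    (hE : Tendsto (fun n => gradMap (ηs n)) atTop (𝓝 (-U.elec)))
    {a : R3 → ℝ} (ha : MemLp a 2 volume) (η : testSpace) {F : Lp R3 2 (volume : Measure R3)}
    (hF : ∀ χ : testSpace, inner ℝ F (gradMap χ)
      = -∫ x, q * (a x * (η : R3 → ℝ) x) * (χ : R3 → ℝ) x) :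
    inner ℝ U.elec F = q * ∫ x, φ x * a x * (η : R3 → ℝ) x := by
  have hη : IsTest (η : R3 → ℝ) := η.2
  have hmul : ∀ {g : R3 → ℝ}, MemLp g 6 volume → MemLp (fun x => (η : R3 → ℝ) x * g x) 2 volume :=
    fun hg => MemLp.mul' (p := 3) (q := 6) (r := 2) hg (hη.memLp 3)
  have t1 : Tendsto (fun n => inner ℝ F (gradMap (ηs n))) atTop (𝓝 (inner ℝ F (-U.elec))) :=
    tendsto_const_nhds.inner hE
  have t2 : Tendsto (fun n => eLpNorm (fun x => (η : R3 → ℝ) x * (ηs n : R3 → ℝ) x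
      - (η : R3 → ℝ) x * φ x) 2 volume) atTop (𝓝 0) := by
    have h := ENNReal.Tendsto.const_mul (a := eLpNorm (η : R3 → ℝ) 3 volume) h6
      (Or.inr (hη.memLp 3).2.ne)
    rw [mul_zero] at h
    refine tendsto_of_tendsto_of_tendsto_of_le_of_le tendsto_const_nhds h (fun _ => zero_le)
      fun n => ?_
    have h1 := eLpNorm_mul_le (p := 3) (q := 6) (r := 2) hη.continuous.aestronglyMeasurable
      (((ηs n).2.memLp 6).sub hφ).1
    refine le_of_eq_of_le (eLpNorm_congr_ae (ae_of_all _ fun x => ?_)) h1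
    simp only [Pi.sub_apply]; ring
  have t3 := (tendsto_integral_mul (p := 2) (q := 2) ha (fun n => hmul ((ηs n).2.memLp 6))
    (hmul hφ) t2).const_mul (-q)
  have t4 : Tendsto (fun n => inner ℝ F (gradMap (ηs n))) atTop
      (𝓝 (-q * ∫ x, a x * ((η : R3 → ℝ) x * φ x))) := by
    refine t3.congr fun n => ?_
    rw [hF, ← integral_const_mul, ← integral_neg]
    refine integral_congr_ae (ae_of_all _ fun x => ?_)
    simp only; ring
  have h1 := tendsto_nhds_unique t1 t4
  rw [inner_neg_right, real_inner_comm] at h1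
  have h2 : ∫ x, φ x * a x * (η : R3 → ℝ) x = ∫ x, a x * ((η : R3 → ℝ) x * φ x) :=
    integral_congr_ae (ae_of_all _ fun x => by ring)
  rw [h2]
  linarith

theorem IsMinimizer.exists_solvesSchrodingerPoisson (hV : LatticePotential V)
    (hW : Nonlinearity V W E₀) (h : IsMinimizer V W q U) (hpos : 0 < ‖U.u‖) :
    ∃ φ : R3 → ℝ, MemD12 φ (fun x => -U.elec x) ∧ ∃ ω : ℝ,
      SolvesSchrodingerPoisson V W q ω U.u U.Du φ (fun x => -U.elec x) := by
  obtain ⟨φ, ηs, hφ, h6, h2, hE⟩ := h.exists_potential hV hW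
  have hu := h.memH1
  -- The Euler–Lagrange identity is twice the Schrödinger equation, whence `ω = -multiplier / 2`.
  refine ⟨φ, ⟨fun n => ηs n, fun n => (ηs n).2, h6, h2⟩, -(multiplier V W U) / 2, ?_⟩
  refine
    { grad_u := hu.weak
      grad_φ := isWeakGradient_of_tendsto (p := 6) (by norm_num) (fun n => (ηs n).2.memLp 6)
        (fun n => IsTest.memLp_gradient (ηs n).2 2) hφ (Lp.memLp U.elec).neg
        (fun n => (IsTest.memH1 (ηs n).2).weak) h6 h2
      int_V := (hV.memLp_mul hW hu.memLp).locallyIntegrable (by norm_num)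
      int_W := hW.locallyIntegrable_deriv_comp hu.memLp hu.memLp_six
      int_φ := locallyIntegrable_mul_of_memLp_six hu.memLp hφ
      int_charge := hu.memLp.integrable_sq.locallyIntegrable
      schrodinger := fun η hη => ?_
      poisson := fun η hη => ?_ }
  · obtain ⟨F, hF⟩ := exists_div_eq q hu.memLp hη
    have key := h.euler_lagrange_test hV hW hpos ⟨η, hη⟩ hF
    rw [inner_elec_eq (U := U) hφ h6 hE hu.memLp ⟨η, hη⟩ hF, inner_gradMap] at key
    simp only at key
    have j1 : Integrable (fun x => ∑ i, U.Du x i * fderiv ℝ η x (e i)) :=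
      integrable_finsetSum _ fun i _ =>
        ((hη.fderiv_apply (e i)).integrable_mul (hu.weak i).2.1).congr
          (ae_of_all _ fun x => by ring)
    have j2 := integrable_V_mul hV hW hu.memLp (hη.memLp 2)
    have j3 := hW.integrable_deriv_mul hu.memLp hu.memLp_six (hη.memLp 2) (hη.memLp 6)
    have j4 : Integrable (fun x => φ x * U.u x * η x) :=
      (hη.integrable_mul (locallyIntegrable_mul_of_memLp_six hu.memLp hφ)).congr
        (ae_of_all _ fun x => by ring)
    have j12 : Integrable (fun x => 1 / 2 * (∑ i, U.Du x i * fderiv ℝ η x (e i))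
        + V x * U.u x * η x) := (j1.const_mul _).add j2
    have j123 : Integrable (fun x => 1 / 2 * (∑ i, U.Du x i * fderiv ℝ η x (e i))
        + V x * U.u x * η x + 1 / 2 * (deriv W (U.u x) * η x)) := j12.add (j3.const_mul _)
    have e1 : ∫ x, (1 / 2 * ∑ i, U.Du x i * fderiv ℝ η x (e i)
        + (V x * U.u x + 1 / 2 * deriv W (U.u x) + q * φ x * U.u x) * η x)
        = 1 / 2 * (∫ x, ∑ i, U.Du x i * fderiv ℝ η x (e i)) + (∫ x, V x * U.u x * η x)
          + 1 / 2 * (∫ x, deriv W (U.u x) * η x) + q * ∫ x, φ x * U.u x * η x := by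
      rw [← integral_const_mul, ← integral_const_mul, ← integral_const_mul,
        ← integral_add (j1.const_mul _) j2, ← integral_add j12 (j3.const_mul _),
        ← integral_add j123 (j4.const_mul _)]
      refine integral_congr_ae (ae_of_all _ fun x => ?_)
      simp only; ring
    have e2 : ∫ x, -(-(multiplier V W U) / 2) * U.u x * η x
        = multiplier V W U / 2 * ∫ x, U.u x * η x := by
      rw [← integral_const_mul]
      refine integral_congr_ae (ae_of_all _ fun x => ?_)
      simp only; ring
    rw [e1, e2]
    linarith
  · have := h.mem.2 η hη
    simp only [PiLp.neg_apply, neg_mul, Finset.sum_neg_distrib]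
    rw [integral_neg, this, neg_neg]

end Minimizer

/-! ### Orbits along which `Θ` and `𝐇` vanish are constant. -/

/-- The mollifications of `h` have zero derivative, hence are constant, and they converge pointwise
to `h`. -/
theorem eq_of_integral_deriv_mul_eq_zero {h : ℝ → ℝ} (hc : Continuous h)
    (h0 : ∀ θ : ℝ → ℝ, IsTest θ → ∫ t, deriv θ t * h t = 0) (s t : ℝ) : h s = h t := by
  let φ : ℕ → ContDiffBump (0 : ℝ) := fun k =>
    ⟨((k : ℝ) + 1)⁻¹, 2 * ((k : ℝ) + 1)⁻¹, by positivity, by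
      have : 0 < ((k : ℝ) + 1)⁻¹ := by positivity
      linarith⟩
  have hφ : Tendsto (fun k => (φ k).rOut) atTop (𝓝 0) := by
    have : Tendsto (fun n : ℕ => ((n : ℝ) + 1)⁻¹) atTop (𝓝 0) := by
      simpa using tendsto_one_div_add_atTop_nhds_zero_nat (𝕜 := ℝ)
    simpa using this.const_mul 2
  have hlim := fun x => ContDiffBump.convolution_tendsto_right_of_continuous
    (μ := (volume : Measure ℝ)) hφ hc x
  have hconst : ∀ k x y, convolution ((φ k).normed volume) h (ContinuousLinearMap.lsmul ℝ ℝ)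
      volume x = convolution ((φ k).normed volume) h (ContinuousLinearMap.lsmul ℝ ℝ) volume y := by
    intro k
    have hd : ∀ x, HasDerivAt (convolution ((φ k).normed volume) h
        (ContinuousLinearMap.lsmul ℝ ℝ) volume) 0 x := fun x => by
      have h1 := (φ k).hasCompactSupport_normed (μ := volume) |>.hasDerivAt_convolution_left
        (ContinuousLinearMap.lsmul ℝ ℝ) ((φ k).contDiff_normed (μ := volume) (n := 1))
        (hc.locallyIntegrable (μ := volume)) x
      refine h1.congr_deriv ?_
      have hη : IsTest (fun t => (φ k).normed volume (x - t)) :=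
        ⟨(φ k).contDiff_normed.comp (contDiff_const.sub contDiff_id),
          (φ k).hasCompactSupport_normed.comp_homeomorph (Homeomorph.subLeft x)⟩
      have h2 := h0 _ hη
      rw [convolution, ← integral_sub_left_eq_self _ volume x]
      simp only [ContinuousLinearMap.lsmul_apply, smul_eq_mul, sub_sub_cancel]
      simp_rw [deriv_comp_const_sub] at h2
      simp only [neg_mul, integral_neg, neg_eq_zero] at h2
      exact h2
    exact is_const_of_deriv_eq_zero (fun x => (hd x).differentiableAt) fun x => (hd x).deriv
  refine tendsto_nhds_unique (hlim s) ?_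
  simp_rw [fun k => hconst k s t]
  exact hlim t

theorem IsTest.prod_mul {θ : ℝ → ℝ} {ψ : R3 → ℝ} (hθ : IsTest θ) (hψ : IsTest ψ) :
    IsTest (fun z : M4 => θ z.1 * ψ z.2) := by
  refine ⟨(hθ.1.comp contDiff_fst).mul (hψ.1.comp contDiff_snd),
    HasCompactSupport.intro (hθ.2.prod hψ.2) fun z hz => ?_⟩
  by_contra hne
  exact hz ⟨subset_tsupport _ (left_ne_zero_of_mul hne), subset_tsupport _ (right_ne_zero_of_mul hne)⟩

theorem fderiv_prod_mul_dt {θ : ℝ → ℝ} {ψ : R3 → ℝ} (hθ : IsTest θ) (hψ : IsTest ψ) (z : M4) :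
    fderiv ℝ (fun z : M4 => θ z.1 * ψ z.2) z dt = deriv θ z.1 * ψ z.2 := by
  have h1 : HasFDerivAt (fun z : M4 => θ z.1)
      ((fderiv ℝ θ z.1).comp (ContinuousLinearMap.fst ℝ ℝ R3)) z :=
    (hθ.differentiable z.1).hasFDerivAt.comp z hasFDerivAt_fst
  have h2 : HasFDerivAt (fun z : M4 => ψ z.2)
      ((fderiv ℝ ψ z.2).comp (ContinuousLinearMap.snd ℝ ℝ R3)) z :=
    (hψ.differentiable z.2).hasFDerivAt.comp z hasFDerivAt_snd
  rw [(h1.fun_mul h2).fderiv]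
  simp [dt, mul_comm]

/-- The converse half of Fubini for null sets needs a measurable set, so it is applied to a
measurable representative. -/
theorem ae_eq_zero_of_ae_ae {E : Type*} [NormedAddCommGroup E] {f : M4 → E}
    (hf : AEStronglyMeasurable f volume) (h : ∀ᵐ t : ℝ, ∀ᵐ x : R3, f (t, x) = 0) :
    ∀ᵐ z, f z = 0 := by
  borelize E
  have h1 := Measure.ae_ae_of_ae_prod (μ := (volume : Measure ℝ)) (ν := (volume : Measure R3))
    hf.ae_eq_mk
  have hm : MeasurableSet {z : M4 | hf.mk f z = 0} :=
    hf.stronglyMeasurable_mk.measurableSet_eq_fun stronglyMeasurable_const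
  have h2 : ∀ᵐ z : M4, hf.mk f z = 0 := by
    refine (Measure.ae_prod_iff_ae_ae (μ := (volume : Measure ℝ)) (ν := (volume : Measure R3))
      hm).2 ?_
    filter_upwards [h, h1] with t ha hb
    filter_upwards [ha, hb] with x h3 h4
    rw [← h4, h3]
  filter_upwards [h2, hf.ae_eq_mk] with z h3 h4
  rw [h4, h3]

theorem norm_elec_sub_le_fdist {E₀ : ℝ} (hE : 0 ≤ E₀) (Y Y' : Fields) :
    ‖Y.elec - Y'.elec‖ ≤ fdist E₀ Y Y' := by
  refine Real.le_sqrt_of_sq_le ?_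
  have : 0 ≤ E₀ * ‖Y.u - Y'.u‖ ^ 2 := by positivity
  nlinarith [sq_nonneg ‖Y.Du - Y'.Du‖, sq_nonneg ‖Y.Θ - Y'.Θ‖, sq_nonneg ‖Y.mag - Y'.mag‖]

theorem norm_u_sub_le_fdist {E₀ : ℝ} (hE : 0 ≤ E₀) (Y Y' : Fields) :
    √(2 * E₀) * ‖Y.u - Y'.u‖ ≤ fdist E₀ Y Y' := by
  refine Real.le_sqrt_of_sq_le ?_
  rw [mul_pow, Real.sq_sqrt (by positivity)]
  nlinarith [sq_nonneg ‖Y.Du - Y'.Du‖, sq_nonneg ‖Y.Θ - Y'.Θ‖, sq_nonneg ‖Y.mag - Y'.mag‖,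
    sq_nonneg ‖Y.elec - Y'.elec‖]

section Trajectory

variable {V : R3 → ℝ} {W : ℝ → ℝ} {q E₀ : ℝ} {Y : ℝ → Fields}

theorem IsTrajectory.continuous_elec (hE : 0 < E₀) (h : IsTrajectory V W q E₀ Y) :
    Continuous (fun t => (Y t).elec) := by
  rw [continuous_iff_continuousAt]
  intro t₀
  rw [ContinuousAt, tendsto_iff_norm_sub_tendsto_zero]
  exact squeeze_zero (fun _ => norm_nonneg _) (fun t => norm_elec_sub_le_fdist hE.le _ _) (h.2.1 t₀)

theorem IsTrajectory.continuous_u (hE : 0 < E₀) (h : IsTrajectory V W q E₀ Y) :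
    Continuous (fun t => (Y t).u) := by
  rw [continuous_iff_continuousAt]
  intro t₀
  have hs : 0 < √(2 * E₀) := Real.sqrt_pos.2 (by positivity)
  rw [ContinuousAt, tendsto_iff_norm_sub_tendsto_zero]
  have t := (h.2.1 t₀).const_mul (√(2 * E₀))⁻¹
  rw [mul_zero] at t
  refine squeeze_zero (fun _ => norm_nonneg _) (fun t => ?_) t
  rw [inv_mul_eq_div, le_div_iff₀ hs, mul_comm]
  exact norm_u_sub_le_fdist hE.le _ _

theorem integrable_test_mul {F : Type*} [NormedAddCommGroup F] [NormedSpace ℝ F]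
    [MeasureSpace F] [BorelSpace F] {η : F → ℝ} (hη : IsTest η) {f : F → R3}
    (hf : LocallyIntegrable f) (i : Fin 3) : Integrable (fun z => f z i * η z) := by
  have h := hf.integrable_smul_left_of_hasCompactSupport hη.continuous hη.2
  refine ((EuclideanSpace.proj i : R3 →L[ℝ] ℝ).integrable_comp h).congr (ae_of_all _ fun z => ?_)
  simp [mul_comm]

/-- Without magnetic field and current, Ampère's law reads `∂ₜ𝐄 = 0` in the weak sense. Testing with
products `θ(t) ψ(x)` shows that each continuous function `t ↦ ∫ ψ 𝐄ᵢ(t)` has zero weak derivative.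
-/
theorem IsTrajectory.elec_eq (hE : 0 < E₀) (h : IsTrajectory V W q E₀ Y)
    (hΘ : ∀ t, (Y t).Θ = 0) (hmag : ∀ t, (Y t).mag = 0) (t : ℝ) : (Y t).elec = (Y 0).elec := by
  have hcont := h.continuous_elec hE
  obtain ⟨-, -, u, Du, S, St, DS, φ, A, elec, mag, hsol, hae⟩ := h
  have hmag0 : ∀ᵐ z, mag z = 0 := by
    refine ae_eq_zero_of_ae_ae hsol.int_mag.aestronglyMeasurable ?_
    filter_upwards [hae] with t ht
    filter_upwards [ht, (Lp.eq_zero_iff_ae_eq_zero.1 (hmag t))] with x hx h0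
    rw [← hx.2.2.2.2, h0]; rfl
  -- The current carries the factor `u²`, hence equals `u Θ` almost everywhere.
  have hcur0 : ∀ᵐ z, u z ^ 2 • (DS z - q • A z) = 0 := by
    refine ae_eq_zero_of_ae_ae hsol.int_current.aestronglyMeasurable ?_
    filter_upwards [hae] with t ht
    filter_upwards [ht, (Lp.eq_zero_iff_ae_eq_zero.1 (hΘ t))] with x hx h0
    rw [sq, mul_smul, ← hx.2.2.1, h0]; simp
  have key : ∀ i, ∀ η : M4 → ℝ, IsTest η → ∫ z, elec z i * fderiv ℝ η z dt = 0 := by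
    intro i η hη
    have h1 := hsol.ampere i η hη
    have h2 : ∫ z, q * (DS z - q • A z) i * u z ^ 2 * η z = 0 := by
      refine integral_eq_zero_of_ae ?_
      filter_upwards [hcur0] with z hz
      have : u z ^ 2 * (DS z - q • A z) i = 0 := by
        have := congrArg (fun v : R3 => v i) hz
        simpa using this
      calc _ = q * (u z ^ 2 * (DS z - q • A z) i) * η z := by ring
        _ = _ := by rw [this]; simp
    rw [h2] at h1
    rw [← h1]
    refine integral_congr_ae ?_
    filter_upwards [hmag0] with z hz
    rw [hz]; simp
  have hcomp : ∀ i, ∀ ψ : R3 → ℝ, IsTest ψ → ∫ x, ψ x * (Y t).elec x i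
      = ∫ x, ψ x * (Y 0).elec x i := by
    intro i ψ hψ
    have : Fact ((1 : ENNReal) ≤ 2) := ⟨by norm_num⟩
    -- Writing the pairing as an `L²` inner product makes its continuity in time evident.
    have hvm : MemLp (fun x => ψ x • e i) 2 volume :=
      (hψ.continuous.smul continuous_const).memLp_of_hasCompactSupport hψ.2.smul_right
    have hinner : ∀ s, inner ℝ hvm.toLp (Y s).elec = ∫ x, ψ x * (Y s).elec x i := fun s => by
      rw [L2.inner_def]
      refine integral_congr_ae ?_
      filter_upwards [hvm.coeFn_toLp] with x hx
      rw [hx, real_inner_smul_left, e, EuclideanSpace.inner_single_left]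
      simp
    refine eq_of_integral_deriv_mul_eq_zero (h := fun s => ∫ x, ψ x * (Y s).elec x i) ?_ ?_ t 0
    · simp_rw [← hinner]
      exact continuous_const.inner hcont
    · intro θ hθ
      have h1 := key i _ (hθ.prod_mul hψ)
      have hint : Integrable (fun z : M4 =>
          elec z i * fderiv ℝ (fun z : M4 => θ z.1 * ψ z.2) z dt) :=
        integrable_test_mul ((hθ.prod_mul hψ).fderiv_apply dt) hsol.int_elec i
      have h2 := integral_prod (μ := (volume : Measure ℝ)) (ν := (volume : Measure R3)) _ hint
      rw [← h1]
      refine Eq.trans ?_ h2.symm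
      refine integral_congr_ae ?_
      filter_upwards [hae] with s hs
      rw [← integral_const_mul]
      refine integral_congr_ae ?_
      filter_upwards [hs] with x hx
      rw [fderiv_prod_mul_dt hθ hψ, ← hx.2.2.2.1]
      ring
  refine Lp.ext ?_
  have : ∀ i, ∀ᵐ x, (Y t).elec x i = (Y 0).elec x i := fun i =>
    ae_eq_of_integral_contDiff_smul_eq
      (((Lp.memLp (Y t).elec).component i).locallyIntegrable (by norm_num))
      (((Lp.memLp (Y 0).elec).component i).locallyIntegrable (by norm_num))
      fun ψ h1 h2 => hcomp i ψ ⟨h1, h2⟩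
  filter_upwards [ae_all_iff.2 this] with x hx
  ext i
  exact hx i

/-- The Gauss law recovers `q u²` as the divergence of the field. -/
theorem sq_eq_of_elec_eq {Y Y' : Fields} (hq : q ≠ 0) (hY : Y ∈ X q) (hY' : Y' ∈ X q)
    (h : Y.elec = Y'.elec) : ∀ᵐ x, Y.u x ^ 2 = Y'.u x ^ 2 := by
  refine ae_eq_of_integral_contDiff_smul_eq
    ((memH1_of_mem_X hY).memLp.integrable_sq.locallyIntegrable)
    ((memH1_of_mem_X hY').memLp.integrable_sq.locallyIntegrable) fun η h1 h2 => ?_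
  have e1 := hY.2 η ⟨h1, h2⟩
  have e2 := hY'.2 η ⟨h1, h2⟩
  rw [h] at e1
  have e3 := neg_injective (e1.symm.trans e2)
  simp_rw [mul_assoc, integral_const_mul] at e3
  have e4 := mul_left_cancel₀ hq e3
  simp only [smul_eq_mul]
  simp_rw [mul_comm (η _)]
  exact e4

/-- A trajectory with vanishing `Θ` and `𝐇` is constant. -/
theorem IsTrajectory.eq_initial (hE : 0 < E₀) (hq : q ≠ 0) (h : IsTrajectory V W q E₀ Y)
    (hΘ : ∀ t, (Y t).Θ = 0) (hmag : ∀ t, (Y t).mag = 0) (t : ℝ) : Y t = Y 0 := by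
  have hX := h.1
  have helec := h.elec_eq hE hΘ hmag
  have hu : (Y t).u = (Y 0).u := by
    refine Lp.ext ?_
    refine ae_eq_of_continuous_of_sq_eq (u := fun t => (Y t).u) (g := fun t => (Y t).Du)
      (fun t => memH1_of_mem_X (hX t)) (fun t => sq_eq_of_elec_eq hq (hX t) (hX 0) (helec t))
      (fun t₀ => ?_) t
    have : Fact ((1 : ENNReal) ≤ 2) := ⟨by norm_num⟩
    have hc := (h.continuous_u hE).tendsto t₀
    rw [tendsto_iff_edist_tendsto_0] at hc
    refine hc.congr fun s => ?_
    rw [Lp.edist_def]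
    rfl
  have hDu : (Y t).Du = (Y 0).Du := by
    refine Lp.ext ?_
    have h1 := (hX t).1
    rw [hu] at h1
    exact h1.ae_eq (hX 0).1
  exact Fields.ext hu hDu ((hΘ t).trans (hΘ 0).symm) (helec t) ((hmag t).trans (hmag 0).symm)

end Trajectory

/-! ### From the static system to weak solutions on space-time. -/

theorem locallyIntegrable_comp_snd {E : Type*} [NormedAddCommGroup E] {f : R3 → E}
    (hf : LocallyIntegrable f) : LocallyIntegrable (fun z : M4 => f z.2) := by
  intro z
  obtain ⟨s, hs, h⟩ := hf z.2
  refine ⟨Icc (z.1 - 1) (z.1 + 1) ×ˢ s,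
    prod_mem_nhds (Icc_mem_nhds (by linarith) (by linarith)) hs, ?_⟩
  rw [IntegrableOn, Measure.volume_eq_prod, ← Measure.prod_restrict]
  exact Integrable.comp_snd h _

theorem IsTest.slice_snd {η : M4 → ℝ} (hη : IsTest η) (t : ℝ) :
    IsTest (fun x : R3 => η (t, x)) := by
  refine ⟨hη.1.comp (contDiff_const.prodMk contDiff_id), ?_⟩
  refine HasCompactSupport.intro (hη.2.image continuous_snd) fun x hx => ?_
  by_contra hne
  exact hx ⟨(t, x), subset_tsupport _ hne, rfl⟩

theorem IsTest.slice_fst {η : M4 → ℝ} (hη : IsTest η) (x : R3) :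
    IsTest (fun t : ℝ => η (t, x)) := by
  refine ⟨hη.1.comp (contDiff_id.prodMk contDiff_const), ?_⟩
  refine HasCompactSupport.intro (hη.2.image continuous_fst) fun t ht => ?_
  by_contra hne
  exact ht ⟨(t, x), subset_tsupport _ hne, rfl⟩

theorem IsTest.fderiv_slice_snd {η : M4 → ℝ} (hη : IsTest η) (t : ℝ) (x : R3) (i : Fin 3) :
    fderiv ℝ (fun x : R3 => η (t, x)) x (e i) = fderiv ℝ η (t, x) (dx i) := by
  have h := (hη.differentiable (t, x)).hasFDerivAt.comp x
    ((hasFDerivAt_const t x).prodMk (hasFDerivAt_id x))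
  have h' := h.fderiv
  simp only [Function.comp_def] at h'
  rw [h']
  simp [dx]

theorem IsTest.hasDerivAt_slice_fst {η : M4 → ℝ} (hη : IsTest η) (t : ℝ) (x : R3) :
    HasDerivAt (fun t : ℝ => η (t, x)) (fderiv ℝ η (t, x) dt) t :=
  (hη.differentiable (t, x)).hasFDerivAt.comp_hasDerivAt t
    ((hasDerivAt_id' t).prodMk (hasDerivAt_const t x))

theorem integral_mul_fderiv_dt_eq_zero {f : R3 → ℝ} (hf : LocallyIntegrable f) {η : M4 → ℝ}
    (hη : IsTest η) : ∫ z : M4, f z.2 * fderiv ℝ η z dt = 0 := by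
  have hint : Integrable (fun z : M4 => f z.2 * fderiv ℝ η z dt) :=
    ((hη.fderiv_apply dt).integrable_mul (locallyIntegrable_comp_snd hf)).congr
      (ae_of_all _ fun z => mul_comm _ _)
  rw [Measure.volume_eq_prod, integral_prod_symm _ hint]
  refine integral_eq_zero_of_ae (ae_of_all _ fun x => ?_)
  simp only [integral_const_mul, Pi.zero_apply]
  have h0 : ∫ t, fderiv ℝ η (t, x) dt = 0 :=
    integral_eq_zero_of_hasDerivAt_of_integrable (fun t => hη.hasDerivAt_slice_fst t x)
      (((hη.fderiv_apply dt).slice_fst x).continuous.integrable_of_hasCompactSupport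
        ((hη.fderiv_apply dt).slice_fst x).2)
      ((hη.slice_fst x).continuous.integrable_of_hasCompactSupport (hη.slice_fst x).2)
  rw [h0, mul_zero]

/-- For static fields each weak equation on space-time reduces to the static one tested with the
slices `η (t, ·)`. -/
theorem integral_eq_of_slices {F G : M4 → ℝ} (hF : Integrable F) (hG : Integrable G)
    (h : ∀ t, ∫ x, F (t, x) = ∫ x, G (t, x)) : ∫ z, F z = ∫ z, G z := by
  rw [Measure.volume_eq_prod, integral_prod _ hF, integral_prod _ hG]
  exact integral_congr_ae (ae_of_all _ h)

/-- The direction `v` is arbitrary: `v = dt` gives `∂ₜS = ω`, and `v = dx i` gives `∇S = 0`. -/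
theorem isWeakDeriv_phase (ω : ℝ) (v : M4) :
    IsWeakDeriv (fun z : M4 => ((((ω * z.1 : ℝ) : Real.Angle).toCircle : Circle) : ℂ)) v
      (fun z => Complex.I * ((ω * v.1 : ℝ) : ℂ)
        * ((((ω * z.1 : ℝ) : Real.Angle).toCircle : Circle) : ℂ)) := by
  have e1 : (fun z : M4 => ((((ω * z.1 : ℝ) : Real.Angle).toCircle : Circle) : ℂ))
      = fun z : M4 => Complex.exp (((ω * z.1 : ℝ) : ℂ) * Complex.I) := by
    ext z
    rw [Real.Angle.toCircle_coe, Circle.coe_exp]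
  have hd : ∀ z : M4, HasFDerivAt (fun z : M4 => Complex.exp (((ω * z.1 : ℝ) : ℂ) * Complex.I))
      ((Complex.exp (((ω * z.1 : ℝ) : ℂ) * Complex.I) * Complex.I) •
        (Complex.ofRealCLM.comp (ω • ContinuousLinearMap.fst ℝ ℝ R3))) z := by
    intro z
    have h1 : HasFDerivAt (fun z : M4 => ((ω * z.1 : ℝ) : ℂ))
        (Complex.ofRealCLM.comp (ω • ContinuousLinearMap.fst ℝ ℝ R3)) z :=
      Complex.ofRealCLM.hasFDerivAt.comp z (hasFDerivAt_fst.const_mul ω)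
    have h2 := (h1.mul_const Complex.I).cexp
    refine h2.congr_fderiv ?_
    rw [smul_smul]
  have hc : Continuous (fun z : M4 => Complex.exp (((ω * z.1 : ℝ) : ℂ) * Complex.I)) := by
    fun_prop
  have e2 : ∀ z, (fderiv ℝ (fun z : M4 => Complex.exp (((ω * z.1 : ℝ) : ℂ) * Complex.I)) z) v
      = Complex.I * ((ω * v.1 : ℝ) : ℂ) * Complex.exp (((ω * z.1 : ℝ) : ℂ) * Complex.I) := by
    intro z
    rw [(hd z).fderiv]
    simp
    ring
  have hc' : Continuous (fun z : M4 =>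
      Complex.I * ((ω * v.1 : ℝ) : ℂ) * Complex.exp (((ω * z.1 : ℝ) : ℂ) * Complex.I)) :=
    continuous_const.mul hc
  have e3 : ∀ z : M4, ((((ω * z.1 : ℝ) : Real.Angle).toCircle : Circle) : ℂ)
      = Complex.exp (((ω * z.1 : ℝ) : ℂ) * Complex.I) := fun z => congrFun e1 z
  simp_rw [e3]
  refine ⟨hc.locallyIntegrable, hc'.locallyIntegrable, fun η hη => ?_⟩
  have hi : ∀ {θ : M4 → ℝ} {g : M4 → ℂ}, IsTest θ → Continuous g →
      Integrable (fun z => θ z • g z) := fun hθ hg =>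
    hg.locallyIntegrable.integrable_smul_left_of_hasCompactSupport hθ.continuous hθ.2
  have : (volume : Measure M4).IsAddHaarMeasure :=
    inferInstanceAs ((volume : Measure ℝ).prod (volume : Measure R3)).IsAddHaarMeasure
  have h := integral_smul_fderiv_eq_neg_fderiv_smul_of_integrable (μ := (volume : Measure M4))
    (f := η) (g := fun z : M4 => Complex.exp (((ω * z.1 : ℝ) : ℂ) * Complex.I)) (v := v)
    (hi (hη.fderiv_apply v) hc) (by simp_rw [e2]; exact hi hη hc') (hi hη hc)
    (fun x _ => hη.differentiable x) (fun x _ => (hd x).differentiableAt)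
  simp_rw [e2] at h
  rw [h, neg_neg]

theorem SolvesSchrodingerPoisson.isWeakSolution {V : R3 → ℝ} {W : ℝ → ℝ} {q ω : ℝ} {u : R3 → ℝ}
    {Du : R3 → R3} {φ : R3 → ℝ} {elec : R3 → R3} (helec : LocallyIntegrable elec)
    (h : SolvesSchrodingerPoisson V W q ω u Du φ (fun x => -elec x)) :
    IsWeakSolution V W q (fun z => u z.2) (fun z => Du z.2)
      (fun z => ((ω * z.1 : ℝ) : Real.Angle)) (fun _ => ω) (fun _ => 0)
      (fun z => φ z.2) (fun _ => 0) (fun z => elec z.2) (fun _ => 0) := by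
  have hu : LocallyIntegrable u := (h.grad_u 0).1
  have hφ : LocallyIntegrable φ := (h.grad_φ 0).1
  have hDu : ∀ i, LocallyIntegrable (fun x => Du x i) := fun i => (h.grad_u i).2.1
  have hei : ∀ i, LocallyIntegrable (fun x => elec x i) := fun i => by
    have := ((h.grad_φ i).2.1).neg
    refine this.congr (ae_of_all _ fun x => by simp)
  have hi : ∀ {f : R3 → ℝ} {θ : M4 → ℝ}, LocallyIntegrable f → IsTest θ →
      Integrable (fun z : M4 => f z.2 * θ z) := fun hf hθ =>
    (hθ.integrable_mul (locallyIntegrable_comp_snd hf)).congr (ae_of_all _ fun z => mul_comm _ _)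
  have hmat : LocallyIntegrable (fun x => ω * u x + q * (φ x * u x) + V x * u x) :=
    ((hu.smul ω).add (h.int_φ.smul q)).add h.int_V
  have hphase := isWeakDeriv_phase ω
  refine
    { grad_u := fun i => ⟨locallyIntegrable_comp_snd hu, locallyIntegrable_comp_snd (hDu i),
        fun η hη => ?_⟩
      phase_t := by simpa [dt] using hphase dt
      phase_x := fun i => by simpa [dx] using hphase (dx i)
      int_φ := locallyIntegrable_comp_snd hφ
      int_A := locallyIntegrable_const 0
      int_elec := locallyIntegrable_comp_snd helec
      int_mag := locallyIntegrable_const 0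
      int_charge := locallyIntegrable_comp_snd h.int_charge
      int_current := by simpa using locallyIntegrable_const (0 : R3)
      int_W := locallyIntegrable_comp_snd h.int_W
      int_matter := (locallyIntegrable_comp_snd hmat).congr (ae_of_all _ fun z => ?_)
      elec_eq := fun i η hη => ?_
      mag_eq := fun i η hη => by simp
      matter := fun η hη => ?_
      gauss := fun η hη => ?_
      ampere := fun i η hη => ?_ }
  · simp only [smul_eq_mul]
    rw [← integral_neg]
    refine integral_eq_of_slices ((hi hu (hη.fderiv_apply (dx i))).congr
      (ae_of_all _ fun z => mul_comm _ _)) ((hi (hDu i) hη).neg.congr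
      (ae_of_all _ fun z => by simp [mul_comm])) fun t => ?_
    have := (h.grad_u i).2.2 _ (hη.slice_snd t)
    simp only [hη.fderiv_slice_snd, smul_eq_mul] at this
    rw [this, integral_neg]
  · simp
    ring
  · simp only [PiLp.zero_apply, zero_mul, zero_add]
    refine integral_eq_of_slices (hi (hei i) hη) (hi hφ (hη.fderiv_apply (dx i))) fun t => ?_
    have := (h.grad_φ i).2.2 _ (hη.slice_snd t)
    simp only [hη.fderiv_slice_snd, smul_eq_mul, PiLp.neg_apply, mul_neg, integral_neg,
      neg_neg] at this
    simp_rw [mul_comm (φ _), this, mul_comm]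
  · have i1 : Integrable (fun z : M4 => 1 / 2 * ∑ i, Du z.2 i * fderiv ℝ η z (dx i)) :=
      (integrable_finsetSum _ fun i _ => hi (hDu i) (hη.fderiv_apply (dx i))).const_mul _
    have i2 : Integrable (fun z : M4 => 1 / 2 * deriv W (u z.2) * η z) :=
      ((hi h.int_W hη).const_mul (1 / 2)).congr (ae_of_all _ fun z => by ring)
    have i3 := hi hmat hη
    have hF : Integrable (fun z : M4 => 1 / 2 * ∑ i, Du z.2 i * fderiv ℝ η z (dx i)
        + 1 / 2 * deriv W (u z.2) * η z
        + (ω * u z.2 + q * (φ z.2 * u z.2) + V z.2 * u z.2) * η z) := (i1.add i2).add i3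
    have h0 : ∫ z : M4, (1 / 2 * ∑ i, Du z.2 i * fderiv ℝ η z (dx i)
        + 1 / 2 * deriv W (u z.2) * η z
        + (ω * u z.2 + q * (φ z.2 * u z.2) + V z.2 * u z.2) * η z) = ∫ _ : M4, (0 : ℝ) := by
      refine integral_eq_of_slices hF (integrable_zero _ _ _) fun t => ?_
      have hs := hη.slice_snd t
      have key := h.schrodinger _ hs
      simp only [hη.fderiv_slice_snd] at key
      have k0 : ∀ {f : R3 → ℝ} {θ : M4 → ℝ}, LocallyIntegrable f → IsTest θ →
          Integrable (fun x : R3 => f x * θ (t, x)) := fun hf hθ =>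
        ((hθ.slice_snd t).integrable_mul hf).congr (ae_of_all _ fun z => mul_comm _ _)
      have k1 : Integrable (fun x : R3 => 1 / 2 * ∑ i, Du x i * fderiv ℝ η (t, x) (dx i)) :=
        (integrable_finsetSum _ fun i _ => k0 (hDu i) (hη.fderiv_apply (dx i))).const_mul _
      have k2 : Integrable (fun x : R3 =>
          (V x * u x + 1 / 2 * deriv W (u x) + q * φ x * u x) * η (t, x)) := by
        refine ((k0 h.int_V hη).add (((k0 h.int_W hη).const_mul (1 / 2)).add
          ((k0 h.int_φ hη).const_mul q))).congr (ae_of_all _ fun x => ?_)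
        simp only [Pi.add_apply]; ring
      -- On a time slice the integrand is the difference of the two sides of the Schrödinger
      -- equation, the term `ω u` coming from `∂ₜS`.
      have k12 : Integrable (fun x : R3 => 1 / 2 * ∑ i, Du x i * fderiv ℝ η (t, x) (dx i)
          + (V x * u x + 1 / 2 * deriv W (u x) + q * φ x * u x) * η (t, x)) := k1.add k2
      have k3 : Integrable (fun x : R3 => -ω * u x * η (t, x)) :=
        ((k0 hu hη).const_mul (-ω)).congr (ae_of_all _ fun x => by ring)
      rw [integral_zero, ← sub_eq_zero.2 key, ← integral_sub k12 k3]
      refine integral_congr_ae (ae_of_all _ fun x => ?_)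
      simp only; ring
    rw [integral_zero] at h0
    rw [← h0]
    refine integral_congr_ae (ae_of_all _ fun z => ?_)
    simp only [smul_zero, sub_zero, norm_zero]
    ring
  · rw [← integral_neg]
    refine integral_eq_of_slices (integrable_finsetSum _ fun i _ =>
      hi (hei i) (hη.fderiv_apply (dx i))) (((hi h.int_charge hη).const_mul q).neg.congr
        (ae_of_all _ fun z => by simp [mul_assoc])) fun t => ?_
    have := h.poisson _ (hη.slice_snd t)
    simp only [hη.fderiv_slice_snd, PiLp.neg_apply, neg_mul, Finset.sum_neg_distrib,
      integral_neg] at this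
    rw [integral_neg]
    linarith
  -- With zero magnetic field and current only the displacement term remains in Ampère's law; it
  -- vanishes because the field is static.
  · have := integral_mul_fderiv_dt_eq_zero (hei i) hη
    simpa using this

end NSM

end

/-! ### The main theorem. -/

theorem mainTheorem4 (V : NSM.R3 → ℝ) (W : ℝ → ℝ) (E₀ q : ℝ)
    (hV : NSM.LatticePotential V) (hW : NSM.Nonlinearity V W E₀) (hq : 0 < q)
    (D : Set NSM.Fields) (γ : ℝ → NSM.Fields → NSM.Fields)
    (hγ : NSM.IsEvolution V W q E₀ D γ)
    (U : NSM.Fields) (hU : NSM.IsHylomorphicSoliton V W q E₀ D γ U) :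
    U.Θ = 0 ∧ U.mag = 0 ∧ (∀ t : ℝ, γ t U = U) ∧
    ∃ φ : NSM.R3 → ℝ, NSM.MemD12 φ (fun x => -U.elec x) ∧
    ∃ ω : ℝ,
      NSM.SolvesSchrodingerPoisson V W q ω U.u U.Du φ (fun x => -U.elec x) ∧
      NSM.IsWeakSolution V W q (fun z => U.u z.2) (fun z => U.Du z.2)
        (fun z => ((ω * z.1 : ℝ) : Real.Angle)) (fun _ => ω) (fun _ => 0)
        (fun z => φ z.2) (fun _ => 0) (fun z => U.elec z.2) (fun _ => 0) := by
  obtain ⟨e₀, c₀, hl, hΓ, hU⟩ := hU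
  have hmin := NSM.isMinimizer_of_isLeast hl hU
  have hpos := NSM.charge_pos_of_zero_notMem hV hW hl hΓ.zero_notMem hU
  obtain ⟨hΘ, hmag⟩ := hmin.Θ_mag_eq_zero hV hW
  refine ⟨hΘ, hmag, fun t => ?_, ?_⟩
  · have hD := hΓ.subset hU
    -- By invariance every state of the orbit stays in `Γ`, hence is itself a minimizer.
    have hz := fun s =>
      (NSM.isMinimizer_of_isLeast hl (hΓ.invariant U hU s)).Θ_mag_eq_zero hV hW
    have h := (hγ.solves U hD).eq_initial hW.E₀_pos hq.ne' (fun s => (hz s).1)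
      (fun s => (hz s).2) t
    exact h.trans (hγ.initial U hD)
  · obtain ⟨φ, hφ, ω, hsol⟩ := hmin.exists_solvesSchrodingerPoisson hV hW hpos
    exact ⟨φ, hφ, ω, hsol, hsol.isWeakSolution
      ((Lp.memLp U.elec).locallyIntegrable (by norm_num))⟩
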